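/- **Proposition ($L^2$ boundedness).** Let $\mathbb T^n=\mathbb R^n/\mathbb Z^n$, let $\mathbf v_1,\dots,\mathbf v_d\in\mathbb R^n$ be linearly independent, let $L=\{\xi\in\mathbb R^n:\mathbf v_1\cdot\xi=\dots=\mathbf v_d\cdot\xi=0\}$, and let $\mathcal C=\mathbb T^n\times L\subset T^*\mathbb T^n$ be the associated linear coisotropic. Let $$S_{\mathrm{tot}}=[T^*\mathbb T^n\times[0,1)_h;\ \mathcal C\times\{h=0\}]=\mathbb T^n\times[\mathbb R^n\times[0,1)_h;\ L\times\{0\}]$$ be the real blowup, a manifold with corners, with boundary defining functions $\rho_{\mathrm{ff}}$ of the front face and $\rho_{\mathrm{sf}}$ of the side face such that $\rho_{\mathrm{ff}}\rho_{\mathrm{sf}}=h$. For $X=S_{\mathrm{tot}}$ or $X=\mathbb T^n\times S_{\mathrm{tot}}$, let $C_c^\infty(X)$ denote the compactly supported complex functions that are smooth up to all boundary faces and corners, and put $S^{m,l}(S_{\mathrm{tot}})=\rho_{\mathrm{sf}}^{-m}\rho_{\mathrm{ff}}^{-l}C_c^\infty(S_{\mathrm{tot}})$. Let $\chi\in C^\infty(\mathbb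 T^n\times\mathbb T^n;\mathbb R)$ be a cutoff with $\chi\equiv1$ in a neighbourhood of the diagonal and with support in $\{(x,y):\operatorname{dist}(x_i-y_i,\mathbb Z)<\tfrac12\ \text{for all } i\}$, where $x-y$ is a well-defined vector of $\mathbb R^n$. For an amplitude $a(x,y,\xi;h)$, let $I_h(a)$, $0<h<1$, be the operator on $\mathbb T^n$ with kernel $$(2\pi h)^{-n}\int_{\mathbb R^n}e^{\frac ih(x-y)\cdot\xi}\,\chi(x,y)\,a(x,y,\xi;h)\,d\xi,$$ and let ${}^h\mathrm{Op}_{\mathrm l}(b)=I_h(a)$ with $a(x,y,\xi;h)=b(x,\xi;h)$. Functions on $S_{\mathrm{tot}}$ or $\mathbb T^n\times S_{\mathrm{tot}}$ are regarded as functions of $(x,\xi;h)$ or $(x,y,\xi;h)$, $0<h<1$, through the blowdown map. Let $B_j=\mathbf v_j\cdot hD_x$ with $D_x=-i\partial_x$, and $\mathbf B^\beta=B_1^{\beta_1}\cdots B_d^{\beta_d}$. Let $\Re^l$ be the set of families $R=(R_h)_{0<h<1}$ of bounded operators on $L^2(\mathbb T^n)$ such that, for all multi-indices $\beta,\gamma$,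 the operators $h^{l-|\beta+\gamma|}\mathbf B^\beta R_h\mathbf B^\gamma$ (defined on $C^\infty(\mathbb T^n)$, with values in distributions) extend to bounded operators on $L^2(\mathbb T^n)$ with norm bounded uniformly in $h\in(0,1)$. Let $\Psi^{m,l}_{2,h}(\mathcal C)={}^h\mathrm{Op}_{\mathrm l}(S^{m,l}(S_{\mathrm{tot}}))+\Re^l$. If $s\in C_c^\infty(\mathbb T^n\times S_{\mathrm{tot}})$, then for every $h\in(0,1)$ the integrals that define $I_h(s)$ converge absolutely, $I_h(s)$ is a bounded operator on $L^2(\mathbb T^n)$, the family $I_h(s)$ belongs to $\Psi^{0,0}_{2,h}(\mathcal C)$, and there is a constant $C$ (depending on $s$ and $\chi$ but not on $h$) such that $\|I_h(s)\|_{L^2(\mathbb T^n)\to L^2(\mathbb T^n)}\le C$ for all $h\in(0,1)$. -/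

import Mathlib

open Set MeasureTheory
open scoped ContDiff

noncomputable section

namespace SecondMicro

/-! ### The torus `𝕋ⁿ = ℝⁿ / ℤⁿ` -/

/-- Euclidean space `ℝⁿ`. -/
abbrev E (n : ℕ) := EuclideanSpace ℝ (Fin n)

/-- The torus `𝕋ⁿ = ℝⁿ / ℤⁿ`. -/
abbrev T (n : ℕ) := UnitAddTorus (Fin n)

/-- The projection `ℝⁿ → 𝕋ⁿ`. -/
def toTorus {n : ℕ} (x : E n) : T n := fun i => ((x i : ℝ) : UnitAddCircle)

/-- Lebesgue measure `dx` on `𝕋ⁿ`, that is, the Haar measure of total mass one. -/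
abbrev torusMeasure (n : ℕ) : Measure (T n) :=
  Measure.pi fun _ : Fin n => (AddCircle.haarAddCircle : Measure UnitAddCircle)

/-- The Hilbert space `L²(𝕋ⁿ)`. -/
abbrev L2 (n : ℕ) := Lp ℂ 2 (torusMeasure n)

/-- The representative in `[-1/2, 1/2)ⁿ` of `x - y`. -/
def torusDiff {n : ℕ} (x y : T n) : E n :=
  WithLp.toLp 2 fun i => (AddCircle.equivIco (1 : ℝ) (-1 / 2) (x i - y i) : ℝ)

/-- A cutoff near the diagonal of `𝕋ⁿ × 𝕋ⁿ`: a smooth function which equals one in a neighbourhood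
of the diagonal and is supported in the neighbourhood of the diagonal where each `xᵢ - yᵢ` is at
distance less than `1/2` from `0` in `ℝ / ℤ`, so that `x - y` is a well-defined smooth `ℝⁿ`-valued
function there. -/
structure IsDiagonalCutoff {n : ℕ} (χ : T n × T n → ℝ) : Prop where
  smooth : ContDiff ℝ ∞ fun z : E n × E n => χ (toTorus z.1, toTorus z.2)
  eventually_eq_one : ∀ᶠ z in nhdsSet (diagonal (T n)), χ z = 1
  tsupport_subset : tsupport χ ⊆ {z | ∀ i, ‖z.1 i - z.2 i‖ < 1 / 2}

/-! ### Linear coisotropics and the blown up space `S_tot` -/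

/-- The subspace `{ξ | 𝐯₁ ⬝ ξ = … = 𝐯_d ⬝ ξ = 0}` of `ℝⁿ`; the linear coisotropic is `𝕋ⁿ` times this
subspace. -/
def coisotropicFibre {n d : ℕ} (v : Fin d → E n) : Submodule ℝ (E n) where
  carrier := {ξ | ∀ j, inner ℝ (v j) ξ = 0}
  zero_mem' := fun j => inner_zero_right _
  add_mem' := fun {a b} ha hb j => by rw [inner_add_right, ha j, hb j, add_zero]
  smul_mem' := fun c a ha j => by rw [inner_smul_right, ha j, mul_zero]

/-- Coordinates `(r, w, ω, θ)` for the blowup of `L × {0}` in `ℝⁿ × [0,1)`. -/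
abbrev BlowupAmbient {n : ℕ} (L : Submodule ℝ (E n)) := ℝ × L × Lᗮ × ℝ

/-- The real (radial) blowup `[ℝⁿ × [0,1) ; L × {0}]` in polar coordinates around `L × {0}`: here
`w ∈ L`, the pair `(ω, θ)` with `θ ≥ 0` is an inward pointing unit normal vector to `L × {0}`, and
`r ≥ 0` is the distance to `L × {0}`. The blowdown map is `(r, w, ω, θ) ↦ (w + r ω, r θ)`. The front
face, which is the inward pointing spherical normal bundle, is `{r = 0}`, and the side face is
`{θ = 0}`. -/
def blowupSet {n : ℕ} (L : Submodule ℝ (E n)) : Set (BlowupAmbient L) :=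
  {p | 0 ≤ p.1 ∧ 0 ≤ p.2.2.2 ∧ ‖p.2.2.1‖ ^ 2 + p.2.2.2 ^ 2 = 1 ∧ p.1 * p.2.2.2 < 1}

/-- The blowup `[ℝⁿ × [0,1) ; L × {0}]` as a topological space. -/
abbrev Blowup {n : ℕ} (L : Submodule ℝ (E n)) : Type := blowupSet L

/-- The blowdown map `[ℝⁿ × [0,1) ; L × {0}] → ℝⁿ × [0,1)`. -/
def blowdown {n : ℕ} {L : Submodule ℝ (E n)} (p : Blowup L) : E n × ℝ :=
  ((p.1.2.1 : E n) + p.1.1 • (p.1.2.2.1 : E n), p.1.1 * p.1.2.2.2)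

/-- The boundary defining function `ρ_ff` of the front face. -/
def rhoFF {n : ℕ} {L : Submodule ℝ (E n)} (p : Blowup L) : ℝ := p.1.1

/-- The boundary defining function `ρ_sf` of the side face. -/
def rhoSF {n : ℕ} {L : Submodule ℝ (E n)} (p : Blowup L) : ℝ := p.1.2.2.2

/-- The semiclassical parameter ranges over `(0,1)`. -/
abbrev Param : Type := Ioo (0 : ℝ) 1

/-- The distance `(|ξ''|² + h²)^{1/2}` of `(ξ, h)` to `L × {0}`, with `ξ''` the component of `ξ`
orthogonal to `L`. -/
def radius {n : ℕ} (L : Submodule ℝ (E n)) (ξ : E n) (h : ℝ) : ℝ :=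
  Real.sqrt (‖Lᗮ.orthogonalProjectionOnto ξ‖ ^ 2 + h ^ 2)

theorem radius_pos {n : ℕ} (L : Submodule ℝ (E n)) (ξ : E n) {h : ℝ} (hh : 0 < h) :
    0 < radius L ξ h := by
  unfold radius
  positivity

/-- The inverse of the blowdown map over the interior `{0 < h < 1}`. -/
def blowupLift {n : ℕ} (L : Submodule ℝ (E n)) (ξ : E n) (h : Param) : Blowup L :=
  ⟨(radius L ξ h, L.orthogonalProjectionOnto ξ,
      (radius L ξ h)⁻¹ • Lᗮ.orthogonalProjectionOnto ξ, (h : ℝ) / radius L ξ h), by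
    have hr := radius_pos L ξ h.2.1
    have h0 := h.2.1
    have hsq : radius L ξ h ^ 2 = ‖Lᗮ.orthogonalProjectionOnto ξ‖ ^ 2 + (h : ℝ) ^ 2 :=
      Real.sq_sqrt (by positivity)
    refine ⟨hr.le, by positivity, ?_, ?_⟩
    · simp only [norm_smul, norm_inv, Real.norm_eq_abs, abs_of_pos hr]
      field_simp
      rw [hsq]
    · simp only
      rw [mul_div_cancel₀ _ hr.ne']
      exact h.2.2⟩

theorem blowdown_blowupLift {n : ℕ} (L : Submodule ℝ (E n)) (ξ : E n) (h : Param) :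
    blowdown (blowupLift L ξ h) = (ξ, (h : ℝ)) := by
  have hr := (radius_pos L ξ h.2.1).ne'
  refine Prod.ext ?_ ?_
  · simp only [blowdown, blowupLift, Submodule.coe_smul, smul_smul, mul_inv_cancel₀ hr, one_smul]
    exact Submodule.starProjection_add_starProjection_orthogonal ξ
  · simp only [blowdown, blowupLift]
    exact mul_div_cancel₀ _ hr

/-- The space `S_tot = [T^*𝕋ⁿ × [0,1) ; 𝒞 × {h = 0}]`, for the linear coisotropic `𝒞 = 𝒞(𝐯)`. As `𝒞`
is the product of `𝕋ⁿ` and a subspace of `ℝⁿ`, it is the product of `𝕋ⁿ` and a blowup of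
`ℝⁿ × [0,1)`. -/
abbrev Stot {n d : ℕ} (v : Fin d → E n) := T n × Blowup (coisotropicFibre v)

/-- `C_c^∞(S_tot)`: compactly supported functions which are smooth up to the front face, the side
face and the corner. -/
structure IsCcSmooth {n d : ℕ} {v : Fin d → E n} (b : Stot v → ℂ) : Prop where
  smooth : ∃ F : E n × BlowupAmbient (coisotropicFibre v) → ℂ,
    ContDiffOn ℝ ∞ F (univ ×ˢ blowupSet (coisotropicFibre v)) ∧
      ∀ (x : E n) (p : Blowup (coisotropicFibre v)),
        F (x, (p : BlowupAmbient (coisotropicFibre v))) = b (toTorus x, p)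
  compact : HasCompactSupport b

/-- `C_c^∞(𝕋ⁿ × S_tot)`. -/
structure IsCcSmoothAmplitude {n d : ℕ} {v : Fin d → E n} (s : T n × Stot v → ℂ) : Prop where
  smooth : ∃ F : E n × E n × BlowupAmbient (coisotropicFibre v) → ℂ,
    ContDiffOn ℝ ∞ F (univ ×ˢ univ ×ˢ blowupSet (coisotropicFibre v)) ∧
      ∀ (x y : E n) (p : Blowup (coisotropicFibre v)),
        F (x, y, (p : BlowupAmbient (coisotropicFibre v))) = s (toTorus x, toTorus y, p)
  compact : HasCompactSupport s

/-- A function `s` on `𝕋ⁿ × S_tot` seen as an amplitude `s(x, y, ξ; h)`, for `0 < h < 1`. -/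
def amplitude {n d : ℕ} {v : Fin d → E n} (s : T n × Stot v → ℂ) :
    T n → T n → E n → Param → ℂ :=
  fun x y ξ h => s (x, y, blowupLift (coisotropicFibre v) ξ h)

/-- The total symbols `S^{m,l}(S_tot) = ρ_sf^{-m} ρ_ff^{-l} C_c^∞(S_tot)`, as functions
`a(x, ξ; h)` with `0 < h < 1`. -/
def IsTotalSymbol {n d : ℕ} (v : Fin d → E n) (m l : ℝ) (a : T n → E n → Param → ℂ) : Prop :=
  ∃ b : Stot v → ℂ, IsCcSmooth b ∧ ∀ (x : T n) (ξ : E n) (h : Param),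
    a x ξ h =
      ((rhoSF (blowupLift (coisotropicFibre v) ξ h) ^ (-m) *
        rhoFF (blowupLift (coisotropicFibre v) ξ h) ^ (-l) : ℝ) : ℂ) *
        b (x, blowupLift (coisotropicFibre v) ξ h)

/-! ### Quantization -/

/-- The Schwartz kernel
`(2πh)^{-n} ∫ e^{(i/h) (x-y)⬝ξ} χ(x,y) a(x,y,ξ;h) dξ` of `I_h(a)`. -/
def kernel {n : ℕ} (χ : T n × T n → ℝ) (a : T n → T n → E n → Param → ℂ) (h : Param)
    (x y : T n) : ℂ :=
  (((2 * Real.pi * (h : ℝ)) ^ n : ℝ) : ℂ)⁻¹ *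
    ∫ ξ : E n, Complex.exp (Complex.I * ((inner ℝ (torusDiff x y) ξ / (h : ℝ) : ℝ) : ℂ)) *
      (χ (x, y) : ℂ) * a x y ξ h

/-- `A = I_h(a)`: the family `A` of bounded operators on `L²(𝕋ⁿ)` is given by the kernel of
`I_h(a)`, and the integrals involved converge absolutely. -/
def IsQuantization {n : ℕ} (χ : T n × T n → ℝ) (a : T n → T n → E n → Param → ℂ)
    (A : Param → L2 n →L[ℂ] L2 n) : Prop :=
  ∀ h : Param,
    (∀ x y, Integrable (fun ξ => a x y ξ h)) ∧
    ∀ u : L2 n, ∀ᵐ x ∂(torusMeasure n),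
      Integrable (fun y => kernel χ a h x y * u y) (torusMeasure n) ∧
      A h u x = ∫ y, kernel χ a h x y * u y ∂(torusMeasure n)

/-- `A = ʰOp_l(a)`. -/
def IsLeftQuantization {n : ℕ} (χ : T n × T n → ℝ) (a : T n → E n → Param → ℂ)
    (A : Param → L2 n →L[ℂ] L2 n) : Prop :=
  IsQuantization χ (fun x _ ξ h => a x ξ h) A

/-! ### Residual operators and the calculus -/

theorem isOpenQuotientMap_toTorus (n : ℕ) : IsOpenQuotientMap (toTorus (n := n)) := by
  have h1 : IsOpenQuotientMap (fun (x : Fin n → ℝ) i => ((x i : ℝ) : UnitAddCircle)) :=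
    IsOpenQuotientMap.piMap fun _ => QuotientAddGroup.isOpenQuotientMap_mk
  exact h1.comp (EuclideanSpace.equiv (Fin n) ℝ).toHomeomorph.isOpenQuotientMap

theorem toTorus_add {n : ℕ} (x y : E n) : toTorus (x + y) = toTorus x + toTorus y := by
  funext i
  simp [toTorus]

/-- The space `C^∞(𝕋ⁿ)`. -/
def SmoothFun (n : ℕ) : Submodule ℂ C(T n, ℂ) where
  carrier := {u | ContDiff ℝ ∞ fun x : E n => u (toTorus x)}
  zero_mem' := show ContDiff ℝ ∞ fun _ : E n => (0 : ℂ) from contDiff_const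
  add_mem' {a b} ha hb :=
    show ContDiff ℝ ∞ fun x : E n => a (toTorus x) + b (toTorus x) from ContDiff.add ha hb
  smul_mem' c a ha :=
    show ContDiff ℝ ∞ fun x : E n => c * a (toTorus x) from ContDiff.mul contDiff_const ha

theorem hasDerivAt_along {n : ℕ} (v : E n) (u : SmoothFun n) (x : E n) :
    HasDerivAt (fun t : ℝ => u.1 (toTorus x + toTorus (t • v)))
      (fderiv ℝ (fun z : E n => u.1 (toTorus z)) x v) 0 := by
  have hu : DifferentiableAt ℝ (fun z : E n => u.1 (toTorus z)) x :=
    ((show ContDiff ℝ ∞ _ from u.2).differentiable (by simp)) x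
  simpa only [HasLineDerivAt, toTorus_add] using hu.hasFDerivAt.hasLineDerivAt v

/-- The operator `𝐯 ⬝ h D_x` on `C^∞(𝕋ⁿ)`, where `D_x = -i ∂_x`. -/
def hD {n : ℕ} (v : E n) (h : ℝ) : Module.End ℂ (SmoothFun n) where
  toFun u :=
    ⟨⟨fun x => -Complex.I * h * deriv (fun t : ℝ => u.1 (x + toTorus (t • v))) 0, by
      rw [(isOpenQuotientMap_toTorus n).isQuotientMap.continuous_iff]
      have hu : ContDiff ℝ ∞ fun x : E n => u.1 (toTorus x) := u.2
      have : Continuous fun x : E n => fderiv ℝ (fun z : E n => u.1 (toTorus z)) x v :=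
        (hu.continuous_fderiv (by simp)).clm_apply continuous_const
      refine Continuous.congr (f := fun x : E n => -Complex.I * h *
        fderiv ℝ (fun z : E n => u.1 (toTorus z)) x v) (continuous_const.mul this) fun x => ?_
      exact congrArg (-Complex.I * h * ·) (hasDerivAt_along v u x).deriv.symm⟩, by
      have hu : ContDiff ℝ ∞ fun x : E n => u.1 (toTorus x) := u.2
      have h2 : ContDiff ℝ ∞ fun x : E n => fderiv ℝ (fun z : E n => u.1 (toTorus z)) x v :=
        (hu.fderiv_right (by simp)).clm_apply contDiff_const
      have h3 : ContDiff ℝ ∞ fun x : E n =>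
          -Complex.I * h * fderiv ℝ (fun z : E n => u.1 (toTorus z)) x v :=
        contDiff_const.mul h2
      exact Eq.mp (congrArg (ContDiff ℝ ∞) (funext fun x =>
        congrArg (-Complex.I * h * ·) (hasDerivAt_along v u x).deriv.symm)) h3⟩
  map_add' u w := by
    refine Subtype.ext (ContinuousMap.ext fun x => ?_)
    obtain ⟨x, rfl⟩ := (isOpenQuotientMap_toTorus n).surjective x
    have h1 := hasDerivAt_along v u x
    have h2 := hasDerivAt_along v w x
    have h3 := (h1.add h2).deriv
    simp only [Submodule.coe_add, ContinuousMap.add_apply, ContinuousMap.coe_mk]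
    rw [h1.deriv, h2.deriv, ← mul_add, ← h3]
    rfl
  map_smul' c u := by
    refine Subtype.ext (ContinuousMap.ext fun x => ?_)
    obtain ⟨x, rfl⟩ := (isOpenQuotientMap_toTorus n).surjective x
    have h1 := hasDerivAt_along v u x
    have h3 := (h1.const_mul c).deriv
    simp only [SetLike.val_smul, ContinuousMap.smul_apply, ContinuousMap.coe_mk, smul_eq_mul,
      RingHom.id_apply]
    rw [h1.deriv, h3]
    ring

/-- The monomial `𝐁^β = B₁^{β₁} ⋯ B_d^{β_d}` with `B_j = 𝐯_j ⬝ h D_x`. -/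
def monomialB {n d : ℕ} (v : Fin d → E n) (h : ℝ) (β : Fin d → ℕ) :
    Module.End ℂ (SmoothFun n) :=
  (List.ofFn fun j => hD (v j) h ^ β j).prod

/-- The inclusion `C^∞(𝕋ⁿ) → L²(𝕋ⁿ)`. -/
def toL2 {n : ℕ} (u : SmoothFun n) : L2 n := ContinuousMap.toLp 2 (torusMeasure n) ℂ u.1

/-- The residual space `ℜ^l`: for all multi-indices `β, γ`, the operators
`h^{l - |β + γ|} 𝐁^β R 𝐁^γ` are bounded on `L²(𝕋ⁿ)`, uniformly in `h`. Here `𝐁^γ` acts on smooth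
functions and `𝐁^β`, which is formally self-adjoint, acts in the sense of distributions: `W h` is
the bounded extension of `h^{l - |β + γ|} 𝐁^β R 𝐁^γ`. -/
def IsResidual {n d : ℕ} (v : Fin d → E n) (l : ℝ) (R : Param → L2 n →L[ℂ] L2 n) : Prop :=
  ∀ β γ : Fin d → ℕ, ∃ C : ℝ, ∃ W : Param → L2 n →L[ℂ] L2 n, ∀ h : Param, ‖W h‖ ≤ C ∧
    ∀ u w : SmoothFun n,
      inner ℂ (toL2 w) (W h (toL2 u)) =
        (((h : ℝ) ^ (l - ((∑ j, β j + ∑ j, γ j : ℕ) : ℝ)) : ℝ) : ℂ) *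
          inner ℂ (toL2 (monomialB v h β w)) (R h (toL2 (monomialB v h γ u)))

/-- `Ψ^{m,l}_{2,h}(𝒞) = ʰOp_l(S^{m,l}(S_tot)) + ℜ^l`. -/
def IsSecondMicrolocal {n d : ℕ} (v : Fin d → E n) (χ : T n × T n → ℝ) (m l : ℝ)
    (A : Param → L2 n →L[ℂ] L2 n) : Prop :=
  ∃ b : T n → E n → Param → ℂ, IsTotalSymbol v m l b ∧
    ∃ B R : Param → L2 n →L[ℂ] L2 n,
      IsLeftQuantization χ b B ∧ IsResidual v l R ∧ ∀ h, A h = B h + R h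

end SecondMicro

end

/-!
Write `z = x - y` and expand the amplitude in a Fourier series in `(x, y)`,
`s(x, y, ξ; h) = ∑ s_{k,m}(ξ; h) e^{2πi(k⬝x + m⬝y)}`. As `e^{2πi m⬝y} = e^{2πi m⬝x} e^{-2πi m⬝z}`,
the second factor can be absorbed into the phase `e^{(i/h) z⬝ξ}` by the translation
`ξ ↦ ξ + 2πhm` of the variable of integration. Hence `I_h(s)` is exactly the left quantization of
`b(x, ξ; h) = ∑ s_{k,m}(ξ + 2πhm; h) e^{2πi(k + m)⬝x}`; no asymptotic expansion or Borel summation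
is needed.

* The symbol `b` is smooth up to the corners of the blowup. The translation `ξ ↦ ξ + 2πhm` does not
  preserve the unit normals, but it lifts to a smooth map `shift` of the cone `cone L` of
  unnormalized coordinates `(r, w, ω, θ)`, where `(r, w, ω, θ)` and `(r/t, w, tω, tθ)` are
  identified. On the cone the Fourier coefficients of `s` are invariant under these dilations
  (`amplitudeCoef_dilation`), and by this invariance a bound on a compact set becomes a bound
  on the whole cone (`exists_amplitudeCoef_bound`). So translating costs only powers of `|m|`, which
  are absorbed by the rapid decay of the coefficients (`exists_leftTerm_bound`). Smoothness up to
  the boundary is handled on sets that are locally convex (`IsCornerDomain`).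

* The symbol `b` need not have compact support in `ξ`, and is cut off by a function `η(ξ)`. The
  remainder has the coefficients `(1 - η(ξ - 2πhm)) s_{k,m}(ξ; h)`, which vanish unless `|m|` is at
  least of size `1/h`; by the rapid decay in `m` they are smaller than any power of `h`, and the
  remainder is residual (`IsDiagonalCutoff.isResidual_quantOp_one_sub`).

* All operators are written as series of `u ↦ ⟨e_b, u⟩ e_a`, with `e_a` the exponentials. To this
  end `χ` is expanded in a Fourier series too, and the oscillatory integral
  `(2πh)^{-n} ∫ e^{(i/h) z⬝ξ} s_{k,m}(ξ; h) dξ` is multiplied by a bump function `ψ(z)` on the unit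
  cell and expanded in a Fourier series in `z` (`CellBump.hasSum_cellCoef`). For fixed indices of
  the first two expansions, the terms of the third are weighted shifts of the orthonormal basis, and
  their weights are bounded by `‖s_{k,m}‖_∞ ‖ψ̂‖_{L¹}`, uniformly in `h` (`norm_cellCoef_le`). Thus
  Bessel's inequality gives the uniform bound on `L²` (`norm_seriesOp_le`).
-/

noncomputable section

namespace SecondMicro

/-! ### Differentiating integrals and series within a set -/

section Within

variable {Q G : Type} [NormedAddCommGroup Q] [NormedSpace ℝ Q] [NormedAddCommGroup G]
  [NormedSpace ℝ G]

/-- The difference quotients of a function with bounded derivative on a convex set, minus the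
derivative, are bounded by the mean value inequality. -/
theorem norm_slope_le_of_convex {S : Set Q} (hS : Convex ℝ S) {f : Q → G} {f' : Q → Q →L[ℝ] G}
    (hf : ∀ q ∈ S, HasFDerivWithinAt f (f' q) S q) {C : ℝ} (hC : ∀ q ∈ S, ‖f' q‖ ≤ C) {x y : Q}
    (hx : x ∈ S) (hy : y ∈ S) : ‖‖y - x‖⁻¹ • (f y - f x - f' x (y - x))‖ ≤ 2 * C := by
  have h1 := hS.norm_image_sub_le_of_norm_hasFDerivWithin_le hf hC hx hy
  have h2 : ‖f' x (y - x)‖ ≤ C * ‖y - x‖ :=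
    ((f' x).le_opNorm _).trans (mul_le_mul_of_nonneg_right (hC x hx) (norm_nonneg _))
  have h3 : ‖f y - f x - f' x (y - x)‖ ≤ ‖y - x‖ * (2 * C) := by
    refine (norm_sub_le _ _).trans ?_
    linarith
  rcases (norm_nonneg (y - x)).eq_or_lt with h0 | h0
  · rw [← h0, inv_zero, zero_smul, norm_zero]
    have := (norm_nonneg _).trans (hC x hx)
    positivity
  · rw [norm_smul, norm_inv, norm_norm, inv_mul_le_iff₀ h0]
    exact h3

theorem hasFDerivWithinAt_iff_tendsto_smul {f : Q → G} {f' : Q →L[ℝ] G} {S : Set Q} {x : Q} :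
    HasFDerivWithinAt f f' S x ↔
      Filter.Tendsto (fun y => ‖y - x‖⁻¹ • (f y - f x - f' (y - x))) (nhdsWithin x S) (nhds 0) := by
  rw [hasFDerivWithinAt_iff_tendsto,
    tendsto_zero_iff_norm_tendsto_zero (f := fun y => ‖y - x‖⁻¹ • (f y - f x - f' (y - x)))]
  simp only [norm_smul, norm_inv, norm_norm]

/-- Differentiation under the integral sign within a convex set, which need not be open: the mean
value inequality dominates the difference quotients. -/
theorem hasFDerivWithinAt_integral {α : Type} [MeasurableSpace α] {μ : Measure α} {S : Set Q}
    (hS : Convex ℝ S) {x : Q} (hx : x ∈ S) {F : α → Q → G} {F' : α → Q → Q →L[ℝ] G}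
    {bound : α → ℝ} (hF : ∀ a, ∀ q ∈ S, HasFDerivWithinAt (F a) (F' a q) S q)
    (hb : ∀ a, ∀ q ∈ S, ‖F' a q‖ ≤ bound a) (hbound : Integrable bound μ)
    (hint : ∀ q ∈ S, Integrable (fun a => F a q) μ)
    (hmeas : AEStronglyMeasurable (fun a => F' a x) μ) :
    HasFDerivWithinAt (fun q => ∫ a, F a q ∂μ) (∫ a, F' a x ∂μ) S x := by
  have hint' : Integrable (fun a => F' a x) μ :=
    hbound.mono' hmeas (Filter.Eventually.of_forall fun a => hb a x hx)
  rw [hasFDerivWithinAt_iff_tendsto_smul]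
  have key : ∀ y ∈ S, ∫ a, ‖y - x‖⁻¹ • (F a y - F a x - F' a x (y - x)) ∂μ =
      ‖y - x‖⁻¹ • ((∫ a, F a y ∂μ) - (∫ a, F a x ∂μ) - (∫ a, F' a x ∂μ) (y - x)) := by
    intro y hy
    have h1 : Integrable (fun a => F a y - F a x) μ := (hint y hy).sub (hint x hx)
    rw [integral_smul, integral_sub h1 (hint'.apply_continuousLinearMap _),
      integral_sub (hint y hy) (hint x hx), ContinuousLinearMap.integral_apply hint']
  have h0 : (0 : G) = ∫ _ : α, (0 : G) ∂μ := by simp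
  refine Filter.Tendsto.congr' (Filter.eventuallyEq_of_mem self_mem_nhdsWithin key) ?_
  rw [h0]
  refine tendsto_integral_filter_of_dominated_convergence (fun a => 2 * bound a) ?_ ?_
    (hbound.const_mul 2) ?_
  · filter_upwards [self_mem_nhdsWithin] with y hy
    exact ((((hint y hy).sub (hint x hx)).sub
      (hint'.apply_continuousLinearMap _)).smul ‖y - x‖⁻¹).aestronglyMeasurable
  · filter_upwards [self_mem_nhdsWithin] with y hy
    exact Filter.Eventually.of_forall fun a => norm_slope_le_of_convex hS (hF a) (hb a) hx hy
  · exact Filter.Eventually.of_forall fun a => hasFDerivWithinAt_iff_tendsto_smul.1 (hF a x hx)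

/-- Termwise differentiation of a series within a convex set, which need not be open. -/
theorem hasFDerivWithinAt_tsum_of_convex [CompleteSpace G] {J : Type} {S : Set Q}
    (hS : Convex ℝ S) {x : Q} (hx : x ∈ S) {F : J → Q → G} {F' : J → Q → Q →L[ℝ] G}
    {u : J → ℝ} (hF : ∀ a, ∀ q ∈ S, HasFDerivWithinAt (F a) (F' a q) S q)
    (hb : ∀ a, ∀ q ∈ S, ‖F' a q‖ ≤ u a) (hu : Summable u)
    (hsum : ∀ q ∈ S, Summable (fun a => F a q)) :
    HasFDerivWithinAt (fun q => ∑' a, F a q) (∑' a, F' a x) S x := by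
  have hs' : Summable (fun a => F' a x) := Summable.of_norm_bounded hu fun a => hb a x hx
  rw [hasFDerivWithinAt_iff_tendsto_smul]
  have key : ∀ y ∈ S, ∑' a, ‖y - x‖⁻¹ • (F a y - F a x - F' a x (y - x)) =
      ‖y - x‖⁻¹ • ((∑' a, F a y) - (∑' a, F a x) - (∑' a, F' a x) (y - x)) := by
    intro y hy
    have h1 : HasSum (fun a => F' a x (y - x)) ((∑' a, F' a x) (y - x)) :=
      hs'.hasSum.mapL (ContinuousLinearMap.apply ℝ G (y - x))
    exact ((((hsum y hy).hasSum.sub (hsum x hx).hasSum).sub h1).const_smul _).tsum_eq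
  have h0 : (0 : G) = ∑' _ : J, (0 : G) := by simp
  refine Filter.Tendsto.congr' (Filter.eventuallyEq_of_mem self_mem_nhdsWithin key) ?_
  rw [h0]
  refine tendsto_tsum_of_dominated_convergence (bound := fun a => 2 * u a) (hu.mul_left 2) ?_ ?_
  · exact fun a => hasFDerivWithinAt_iff_tendsto_smul.1 (hF a x hx)
  · filter_upwards [self_mem_nhdsWithin] with y hy
    exact fun a => norm_slope_le_of_convex hS (hF a) (hb a) hx hy

/-- A relatively open subset of a convex set with interior: locally convex, with unique
differentials, and possibly with boundary and corners. -/
structure IsCornerDomain (D : Set Q) : Prop where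
  uniqueDiffOn : UniqueDiffOn ℝ D
  exists_convex : ∀ x ∈ D, ∃ ε > 0, Convex ℝ (D ∩ Metric.ball x ε)
  exists_compact : ∀ x ∈ D, ∃ ε > 0, IsCompact (D ∩ Metric.closedBall x ε)

theorem isCornerDomain_of_inter [ProperSpace Q] {C U : Set Q} (hC : Convex ℝ C)
    (hCc : IsClosed C) (hCi : (interior C).Nonempty) (hU : IsOpen U) : IsCornerDomain (C ∩ U) where
  uniqueDiffOn := (uniqueDiffOn_convex hC hCi).inter hU
  exists_convex := by
    rintro x ⟨-, hx⟩
    obtain ⟨ε, hε, h⟩ := Metric.isOpen_iff.1 hU x hx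
    refine ⟨ε, hε, ?_⟩
    rw [inter_assoc, inter_eq_self_of_subset_right h]
    exact hC.inter (convex_ball x ε)
  exists_compact := by
    rintro x ⟨-, hx⟩
    obtain ⟨ε, hε, h⟩ := Metric.nhds_basis_closedBall.mem_iff.1 (hU.mem_nhds hx)
    refine ⟨ε, hε, ?_⟩
    rw [inter_assoc, inter_eq_self_of_subset_right h]
    exact (isCompact_closedBall x ε).inter_left hCc

theorem IsCornerDomain.exists_convex_compact {D : Set Q} (hD : IsCornerDomain D) {x : Q}
    (hx : x ∈ D) : ∃ ε > 0, Convex ℝ (D ∩ Metric.ball x ε) ∧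
      IsCompact (D ∩ Metric.closedBall x ε) := by
  obtain ⟨ε₁, h1, h1'⟩ := hD.exists_convex x hx
  obtain ⟨ε₂, h2, h2'⟩ := hD.exists_compact x hx
  refine ⟨min ε₁ ε₂, lt_min h1 h2, ?_, ?_⟩
  · have : D ∩ Metric.ball x (min ε₁ ε₂) =
        (D ∩ Metric.ball x ε₁) ∩ Metric.ball x (min ε₁ ε₂) := by
      rw [inter_assoc, inter_eq_self_of_subset_right (Metric.ball_subset_ball (min_le_left _ _))]
    rw [this]
    exact h1'.inter (convex_ball _ _)
  · have : D ∩ Metric.closedBall x (min ε₁ ε₂) =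
        (D ∩ Metric.closedBall x ε₂) ∩ Metric.closedBall x (min ε₁ ε₂) := by
      rw [inter_assoc,
        inter_eq_self_of_subset_right (Metric.closedBall_subset_closedBall (min_le_right _ _))]
    rw [this]
    exact h2'.inter_right Metric.isClosed_closedBall

theorem contDiffOn_nat_tsum {J : Type} (k : ℕ) {D : Set Q} (hD : IsCornerDomain D) :
    ∀ {G : Type} [NormedAddCommGroup G] [NormedSpace ℝ G] [CompleteSpace G] {F : J → Q → G},
    (∀ a, ContDiffOn ℝ ∞ (F a) D) →
    (∀ k : ℕ, ∀ x ∈ D, ∃ ε > 0, ∃ u : J → ℝ, Summable u ∧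
      ∀ a, ∀ q ∈ D ∩ Metric.ball x ε, ‖iteratedFDerivWithin ℝ k (F a) D q‖ ≤ u a) →
    ContDiffOn ℝ k (fun q => ∑' a, F a q) D := by
  -- the values change to linear maps in the induction, so that the space `G` has to vary
  induction k with
  | zero =>
    intro G _ _ _ F hF hb
    rw [Nat.cast_zero, contDiffOn_zero]
    intro x hx
    obtain ⟨ε, hε, u, hu, hub⟩ := hb 0 x hx
    have : ContinuousOn (fun q => ∑' a, F a q) (D ∩ Metric.ball x ε) :=
      continuousOn_tsum (fun a => (hF a).continuousOn.mono inter_subset_left) hu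
        fun a q hq => by simpa using hub a q hq
    exact ((this x ⟨hx, Metric.mem_ball_self hε⟩).mono_of_mem_nhdsWithin
      (inter_mem_nhdsWithin _ (Metric.ball_mem_nhds x hε)))
  | succ k ih =>
    intro G _ _ _ F hF hb
    have hder : ∀ x ∈ D, HasFDerivWithinAt (fun q => ∑' a, F a q)
        (∑' a, fderivWithin ℝ (F a) D x) D x := by
      intro x hx
      obtain ⟨ε₀, hε₀, u₀, hu₀, hb₀⟩ := hb 0 x hx
      obtain ⟨ε₁, hε₁, u₁, hu₁, hb₁⟩ := hb 1 x hx
      obtain ⟨ε₂, hε₂, hconv⟩ := hD.exists_convex x hx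
      set ε := min ε₂ (min ε₀ ε₁) with hε_def
      have hε : 0 < ε := lt_min hε₂ (lt_min hε₀ hε₁)
      have hconv' : Convex ℝ (D ∩ Metric.ball x ε) := by
        have : D ∩ Metric.ball x ε = (D ∩ Metric.ball x ε₂) ∩ Metric.ball x ε := by
          rw [inter_assoc, inter_eq_self_of_subset_right
            (Metric.ball_subset_ball (min_le_left _ _))]
        rw [this]
        exact hconv.inter (convex_ball _ _)
      have hmono : ∀ q ∈ D ∩ Metric.ball x ε, q ∈ D ∩ Metric.ball x ε₀ ∧
          q ∈ D ∩ Metric.ball x ε₁ := fun q hq =>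
        ⟨⟨hq.1, Metric.ball_subset_ball ((min_le_right _ _).trans (min_le_left _ _)) hq.2⟩,
          ⟨hq.1, Metric.ball_subset_ball ((min_le_right _ _).trans (min_le_right _ _)) hq.2⟩⟩
      have := hasFDerivWithinAt_tsum_of_convex (F := F)
        (F' := fun a q => fderivWithin ℝ (F a) D q) hconv'
        (x := x) ⟨hx, Metric.mem_ball_self hε⟩
        (fun a q hq => (((hF a).differentiableOn (by simp)) q hq.1).hasFDerivWithinAt.mono
          inter_subset_left)
        (fun a q hq => by
          rw [← norm_iteratedFDerivWithin_one _ (hD.uniqueDiffOn q hq.1)]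
          exact hb₁ a q (hmono q hq).2) hu₁
        (fun q hq => Summable.of_norm_bounded hu₀ fun a => by
          simpa using hb₀ a q (hmono q hq).1)
      exact this.mono_of_mem_nhdsWithin (inter_mem_nhdsWithin _ (Metric.ball_mem_nhds x hε))
    rw [Nat.cast_succ, contDiffOn_succ_iff_fderivWithin hD.uniqueDiffOn]
    refine ⟨fun x hx => (hder x hx).differentiableWithinAt, by simp, ?_⟩
    refine ContDiffOn.congr (ih (F := fun a q => fderivWithin ℝ (F a) D q)
      (fun a => (hF a).fderivWithin hD.uniqueDiffOn (by simp)) ?_)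
      fun x hx => (hder x hx).fderivWithin (hD.uniqueDiffOn x hx)
    intro j x hx
    obtain ⟨ε, hε, u, hu, hub⟩ := hb (j + 1) x hx
    refine ⟨ε, hε, u, hu, fun a q hq => ?_⟩
    rw [norm_iteratedFDerivWithin_fderivWithin hD.uniqueDiffOn hq.1]
    exact hub a q hq

/-- A series whose derivatives of every order converge normally, locally up to the boundary, is
smooth up to the boundary. -/
theorem contDiffOn_tsum [CompleteSpace G] {J : Type} {D : Set Q} (hD : IsCornerDomain D)
    {F : J → Q → G} (hF : ∀ a, ContDiffOn ℝ ∞ (F a) D)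
    (hb : ∀ k : ℕ, ∀ x ∈ D, ∃ ε > 0, ∃ u : J → ℝ, Summable u ∧
      ∀ a, ∀ q ∈ D ∩ Metric.ball x ε, ‖iteratedFDerivWithin ℝ k (F a) D q‖ ≤ u a) :
    ContDiffOn ℝ ∞ (fun q => ∑' a, F a q) D :=
  contDiffOn_infty.2 fun k => contDiffOn_nat_tsum k hD hF hb

theorem norm_iteratedFDerivWithin_eq_zero {f : Q → G} {D : Set Q} {x : Q}
    (hf : f =ᶠ[nhdsWithin x D] fun _ => 0) (hx : x ∈ D) (k : ℕ) :
    ‖iteratedFDerivWithin ℝ k f D x‖ = 0 := by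
  rw [hf.iteratedFDerivWithin_eq (hf.self_of_nhdsWithin hx) k]
  simp

theorem norm_iteratedFDerivWithin_comp_equiv_le {P : Type} [NormedAddCommGroup P]
    [NormedSpace ℝ P] (e : P ≃L[ℝ] Q) (f : Q → G) {D : Set Q} (hD : UniqueDiffOn ℝ D) {x : P}
    (hx : e x ∈ D) (k : ℕ) :
    ‖iteratedFDerivWithin ℝ k (f ∘ e) (e ⁻¹' D) x‖ ≤
      ‖iteratedFDerivWithin ℝ k f D (e x)‖ * ‖(e : P →L[ℝ] Q)‖ ^ k := by
  rw [e.iteratedFDerivWithin_comp_right f hD hx k]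
  refine (ContinuousMultilinearMap.norm_compContinuousLinearMap_le _ _).trans ?_
  simp

end Within

/-! ### Fourier coefficients of smooth functions on a torus, with parameters -/

section FourierCoeff

open UnitAddTorus

set_option linter.unusedSectionVars false

variable {ι : Type} [Fintype ι]

/-- The projection `ℝ^ι → (ℝ/ℤ)^ι`. -/
def torusMk (y : ι → ℝ) : UnitAddTorus ι := fun i => (y i : UnitAddCircle)

/-- The Haar probability measure on `(ℝ/ℤ)^ι`. -/
abbrev torusHaar (ι : Type) [Fintype ι] : Measure (UnitAddTorus ι) :=
  Measure.pi fun _ : ι => (AddCircle.haarAddCircle : Measure UnitAddCircle)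

theorem torusMk_add (y z : ι → ℝ) : torusMk (y + z) = torusMk y + torusMk z := by
  funext i
  simp [torusMk]

theorem isOpenQuotientMap_torusMk : IsOpenQuotientMap (torusMk (ι := ι)) :=
  IsOpenQuotientMap.piMap fun _ => QuotientAddGroup.isOpenQuotientMap_mk

theorem exists_torusMk_eq (t : UnitAddTorus ι) :
    ∃ y ∈ Icc (0 : ι → ℝ) 1, torusMk y = t := by
  have h : ∀ i, ∃ y ∈ Icc (0 : ℝ) (0 + 1), (y : UnitAddCircle) = t i := fun i => by
    have := AddCircle.coe_image_Icc_eq (1 : ℝ) 0 ▸ mem_univ (t i)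
    simpa only [mem_image] using this
  choose y hy hyt using h
  exact ⟨y, ⟨fun i => (hy i).1, fun i => by simpa using (hy i).2⟩, funext hyt⟩

/-- The Fourier coefficient of index `κ` of a function on a torus. -/
def fourierCoef {G : Type} [NormedAddCommGroup G] [NormedSpace ℝ G] [NormedSpace ℂ G]
    (f : UnitAddTorus ι → G) (κ : ι → ℤ) : G :=
  ∫ t, mFourier (-κ) t • f t ∂(torusHaar ι)

theorem norm_mFourier_apply (κ : ι → ℤ) (t : UnitAddTorus ι) : ‖mFourier κ t‖ = 1 := by
  simp [mFourier, norm_prod, fourier_apply, Circle.norm_coe]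

theorem mFourier_add_apply (κ : ι → ℤ) (s t : UnitAddTorus ι) :
    mFourier κ (s + t) = mFourier κ s * mFourier κ t := by
  simp only [mFourier, ContinuousMap.coe_mk, Pi.add_apply, ← Finset.prod_mul_distrib]
  refine Finset.prod_congr rfl fun i _ => ?_
  rw [fourier_apply, fourier_apply, fourier_apply, smul_add, AddCircle.toCircle_add,
    Circle.coe_mul]

theorem mFourier_torusMk (κ : ι → ℤ) (y : ι → ℝ) :
    mFourier κ (torusMk y) =
      Complex.exp (2 * Real.pi * Complex.I * ((∑ i, κ i * y i : ℝ) : ℂ)) := by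
  simp only [mFourier, ContinuousMap.coe_mk, torusMk, fourier_coe_apply]
  rw [← Complex.exp_sum]
  congr 1
  push_cast
  rw [Finset.mul_sum]
  exact Finset.sum_congr rfl fun i _ => by simp; ring

variable {G : Type} [NormedAddCommGroup G] [NormedSpace ℝ G]

theorem integrable_of_continuous {f : UnitAddTorus ι → G} (hf : Continuous f) :
    Integrable f (torusHaar ι) :=
  hf.integrable_of_hasCompactSupport (HasCompactSupport.of_compactSpace f)

theorem continuous_of_lift {X : Type} [TopologicalSpace X] {f : UnitAddTorus ι → X}
    (hf : Continuous fun y => f (torusMk y)) : Continuous f :=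
  isOpenQuotientMap_torusMk.isQuotientMap.continuous_iff.2 hf

/-- The derivative of a function on a torus in the direction of `v`. -/
def torusDeriv (v : ι → ℝ) (f : UnitAddTorus ι → G) (t : UnitAddTorus ι) : G :=
  deriv (fun s : ℝ => f (t + torusMk (s • v))) 0

theorem hasDerivAt_torus {f : UnitAddTorus ι → G} (hf : ContDiff ℝ 1 fun y => f (torusMk y))
    (v : ι → ℝ) (y : ι → ℝ) :
    HasDerivAt (fun s : ℝ => f (torusMk y + torusMk (s • v)))
      (fderiv ℝ (fun z => f (torusMk z)) y v) 0 := by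
  have hu : DifferentiableAt ℝ (fun z => f (torusMk z)) y := hf.differentiable (by simp) y
  simpa only [HasLineDerivAt, torusMk_add] using hu.hasFDerivAt.hasLineDerivAt v

theorem torusDeriv_torusMk {f : UnitAddTorus ι → G} (hf : ContDiff ℝ 1 fun y => f (torusMk y))
    (v : ι → ℝ) (y : ι → ℝ) :
    torusDeriv v f (torusMk y) = fderiv ℝ (fun z => f (torusMk z)) y v :=
  (hasDerivAt_torus hf v y).deriv

theorem continuous_torusDeriv {f : UnitAddTorus ι → G} (hf : ContDiff ℝ 1 fun y => f (torusMk y))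
    (v : ι → ℝ) : Continuous (torusDeriv v f) := by
  refine continuous_of_lift ?_
  simp only [torusDeriv_torusMk hf]
  exact (hf.continuous_fderiv (by simp)).clm_apply continuous_const

variable [NormedSpace ℂ G]

theorem norm_fourierCoef_le {f : UnitAddTorus ι → G} {C : ℝ} (h : ∀ t, ‖f t‖ ≤ C) (κ : ι → ℤ) :
    ‖fourierCoef f κ‖ ≤ C := by
  have := norm_integral_le_of_norm_le_const (μ := torusHaar ι)
    (f := fun t => mFourier (-κ) t • f t) (C := C)
    (Filter.Eventually.of_forall fun t => by
      rw [norm_smul, norm_mFourier_apply, one_mul]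
      exact h t)
  simpa [fourierCoef] using this

theorem fourierCoef_translate (f : UnitAddTorus ι → G) (κ : ι → ℤ) (c : UnitAddTorus ι) :
    fourierCoef (fun t => f (c + t)) κ = mFourier κ c • fourierCoef f κ := by
  have h := integral_add_left_eq_self (μ := torusHaar ι)
    (fun t => mFourier (-κ) (t - c) • f t) c
  have h2 : mFourier κ c • fourierCoef f κ
      = ∫ t, mFourier κ c • (mFourier (-κ) t • f t) ∂(torusHaar ι) := by
    rw [fourierCoef, integral_smul]
  rw [h2, fourierCoef]
  refine Eq.trans ?_ (h.trans ?_)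
  · simp
  · refine integral_congr_ae (Filter.Eventually.of_forall fun t => ?_)
    have : mFourier (-κ) (t - c) = mFourier κ c * mFourier (-κ) t := by
      have h3 : mFourier κ c * mFourier (-κ) c = 1 := by
        rw [← mFourier_add]
        simp [mFourier_zero]
      have h4 := mFourier_add_apply (-κ) (t - c) c
      rw [sub_add_cancel] at h4
      rw [h4, mul_left_comm, h3, mul_one]
    simp only [this, smul_smul]

/-- Integration by parts, obtained by differentiating the action of translations on the Fourier
coefficient. -/
theorem fourierCoef_torusDeriv [CompleteSpace G] [SMulCommClass ℝ ℂ G] [IsScalarTower ℝ ℂ G]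
    {f : UnitAddTorus ι → G}
    (hf : ContDiff ℝ 1 fun y => f (torusMk y)) (v : ι → ℝ) (κ : ι → ℤ) :
    fourierCoef (torusDeriv v f) κ
      = (2 * Real.pi * Complex.I * ((∑ i, κ i * v i : ℝ) : ℂ)) • fourierCoef f κ := by
  have hfc : Continuous f := continuous_of_lift hf.continuous
  have hdc := continuous_torusDeriv hf v
  obtain ⟨C, hC⟩ := isCompact_univ.exists_bound_of_continuousOn hdc.continuousOn
  have hder : ∀ (t : UnitAddTorus ι) (s : ℝ), HasDerivAt (fun s : ℝ => f (torusMk (s • v) + t))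
      (torusDeriv v f (torusMk (s • v) + t)) s := by
    intro t s
    obtain ⟨y, rfl⟩ := isOpenQuotientMap_torusMk.surjective t
    have h1 := hasDerivAt_torus hf v (s • v + y)
    rw [← torusMk_add, torusDeriv_torusMk hf]
    have h2 := HasDerivAt.scomp_of_eq s h1 ((hasDerivAt_id s).sub_const s) (by simp)
    rw [one_smul] at h2
    refine h2.congr_of_eventuallyEq (Filter.Eventually.of_forall fun r => ?_)
    simp only [Function.comp_def, id]
    rw [← torusMk_add, ← torusMk_add, sub_smul]
    congr 2
    abel
  have h1 := (hasDerivAt_integral_of_dominated_loc_of_deriv_le (μ := torusHaar ι)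
    (F := fun (s : ℝ) t => mFourier (-κ) t • f (torusMk (s • v) + t))
    (F' := fun (s : ℝ) t => mFourier (-κ) t • torusDeriv v f (torusMk (s • v) + t))
    (x₀ := (0 : ℝ)) (s := univ) (bound := fun _ => C) Filter.univ_mem
    (Filter.Eventually.of_forall fun s => (by fun_prop :
      Continuous fun t => mFourier (-κ) t • f (torusMk (s • v) + t)).aestronglyMeasurable)
    (integrable_of_continuous (by fun_prop))
    (by fun_prop : Continuous fun t => mFourier (-κ) t •
      torusDeriv v f (torusMk ((0 : ℝ) • v) + t)).aestronglyMeasurable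
    (Filter.Eventually.of_forall fun t s _ => by
      rw [norm_smul, norm_mFourier_apply, one_mul]; exact hC _ (mem_univ _))
    (integrable_const C)
    (Filter.Eventually.of_forall fun t s _ => (hder t s).const_smul _)).2
  have h2 : ∀ s : ℝ, ∫ t, mFourier (-κ) t • f (torusMk (s • v) + t) ∂(torusHaar ι)
      = Complex.exp (s * (2 * Real.pi * Complex.I * ((∑ i, κ i * v i : ℝ) : ℂ))) •
        fourierCoef f κ := by
    intro s
    have := fourierCoef_translate f κ (torusMk (s • v))
    rw [mFourier_torusMk] at this
    refine this.trans ?_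
    congr 2
    simp only [Pi.smul_apply, smul_eq_mul, mul_left_comm _ s, ← Finset.mul_sum]
    push_cast
    ring
  simp only [h2] at h1
  have h3 : HasDerivAt (fun s : ℝ => Complex.exp
      (s * (2 * Real.pi * Complex.I * ((∑ i, κ i * v i : ℝ) : ℂ))))
      (2 * Real.pi * Complex.I * ((∑ i, κ i * v i : ℝ) : ℂ)) 0 := by
    have := ((Complex.ofRealCLM.hasDerivAt (x := (0 : ℝ))).mul_const
      (2 * Real.pi * Complex.I * ((∑ i, κ i * v i : ℝ) : ℂ))).cexp
    simpa using this
  have h4 := h3.smul_const (fourierCoef f κ)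
  have h5 := h1.unique h4
  rw [← h5, fourierCoef]
  have h0 : torusMk ((0 : ℝ) • v) = 0 := by
    funext i
    simp [torusMk]
  simp only [h0, zero_add]

end FourierCoeff

section SmoothFamily

open UnitAddTorus

set_option linter.unusedSectionVars false

variable {ι : Type} [Fintype ι] {Q : Type} [NormedAddCommGroup Q] [NormedSpace ℝ Q]
  {G : Type} [NormedAddCommGroup G] [NormedSpace ℝ G]

theorem one_le_infty : (1 : WithTop ℕ∞) ≤ ∞ := by
  exact_mod_cast le_top

/-- The weight `1 + |κ|`, with the supremum norm, that measures the decay of Fourier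
coefficients. -/
def weight (κ : ι → ℤ) : ℝ := 1 + ‖κ‖

theorem one_le_weight (κ : ι → ℤ) : 1 ≤ weight κ := by
  unfold weight
  linarith [norm_nonneg κ]

theorem weight_pos (κ : ι → ℤ) : 0 < weight κ := one_pos.trans_le (one_le_weight κ)

/-- A function on the product of a torus and `D` which is smooth up to the boundary of `D`; the
smoothness is that of the lift to `ℝ^ι × D`. -/
def IsSmoothFamily (D : Set Q) (f : UnitAddTorus ι → Q → G) : Prop :=
  ContDiffOn ℝ ∞ (fun z : (ι → ℝ) × Q => f (torusMk z.1) z.2) (univ ×ˢ D)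

variable {D : Set Q} {f : UnitAddTorus ι → Q → G}

theorem IsSmoothFamily.contDiff (hf : IsSmoothFamily D f) {q : Q} (hq : q ∈ D) :
    ContDiff ℝ ∞ fun y => f (torusMk y) q :=
  contDiffOn_univ.1 (ContDiffOn.comp hf (f := fun y : ι → ℝ => (y, q))
    (contDiff_id.prodMk contDiff_const).contDiffOn fun _ _ => ⟨mem_univ _, hq⟩)

theorem IsSmoothFamily.contDiffOn (hf : IsSmoothFamily D f) (t : UnitAddTorus ι) :
    ContDiffOn ℝ ∞ (f t) D := by
  obtain ⟨y, rfl⟩ := isOpenQuotientMap_torusMk.surjective t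
  exact ContDiffOn.comp hf (f := fun q : Q => (y, q))
    (contDiff_const.prodMk contDiff_id).contDiffOn fun q hq => ⟨mem_univ _, hq⟩

theorem IsSmoothFamily.continuous (hf : IsSmoothFamily D f) {q : Q} (hq : q ∈ D) :
    Continuous fun t => f t q :=
  continuous_of_lift (hf.contDiff hq).continuous

theorem IsSmoothFamily.exists_bound (hf : IsSmoothFamily D f) {K : Set Q} (hK : IsCompact K)
    (hKD : K ⊆ D) : ∃ C : ℝ, ∀ t, ∀ q ∈ K, ‖f t q‖ ≤ C := by
  have hcomp := (isCompact_Icc (a := (0 : ι → ℝ)) (b := 1)).prod hK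
  obtain ⟨C, hC⟩ := hcomp.exists_bound_of_continuousOn
    (hf.continuousOn.mono (prod_mono (subset_univ _) hKD))
  refine ⟨C, fun t q hq => ?_⟩
  obtain ⟨y, hy, rfl⟩ := exists_torusMk_eq t
  exact hC (y, q) ⟨hy, hq⟩

theorem IsSmoothFamily.paramDeriv (hD : UniqueDiffOn ℝ D) (hf : IsSmoothFamily D f) :
    IsSmoothFamily D fun t q => fderivWithin ℝ (f t) D q := by
  have hU : UniqueDiffOn ℝ ((univ : Set (ι → ℝ)) ×ˢ D) := uniqueDiffOn_univ.prod hD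
  have h1 := ContDiffOn.fderivWithin (m := ∞) hf hU (by simp)
  have h2 : ContDiffOn ℝ ∞ (fun z : (ι → ℝ) × Q =>
      (fderivWithin ℝ (fun z : (ι → ℝ) × Q => f (torusMk z.1) z.2) (univ ×ˢ D) z).comp
        (ContinuousLinearMap.inr ℝ (ι → ℝ) Q)) (univ ×ˢ D) := h1.clm_comp contDiffOn_const
  refine h2.congr ?_
  rintro ⟨y, q⟩ ⟨-, hq⟩
  have h3 : HasFDerivWithinAt (fun z : (ι → ℝ) × Q => f (torusMk z.1) z.2)
      (fderivWithin ℝ (fun z : (ι → ℝ) × Q => f (torusMk z.1) z.2) (univ ×ˢ D) (y, q))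
      (univ ×ˢ D) (y, q) :=
    (hf.differentiableOn (by simp) (y, q) ⟨mem_univ _, hq⟩).hasFDerivWithinAt
  have h4 := h3.comp q (f := fun q : Q => (y, q)) (t := univ ×ˢ D) (s := D)
    (hasFDerivAt_prodMk_right y q).hasFDerivWithinAt fun q hq => ⟨mem_univ _, hq⟩
  exact h4.fderivWithin (hD q hq)

theorem IsSmoothFamily.lineDeriv (hD : UniqueDiffOn ℝ D) (hf : IsSmoothFamily D f) (v : ι → ℝ) :
    IsSmoothFamily D fun t q => torusDeriv v (fun t => f t q) t := by
  have hU : UniqueDiffOn ℝ ((univ : Set (ι → ℝ)) ×ˢ D) := uniqueDiffOn_univ.prod hD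
  have h1 := ContDiffOn.fderivWithin (m := ∞) hf hU (by simp)
  have h2 : ContDiffOn ℝ ∞ (fun z : (ι → ℝ) × Q =>
      fderivWithin ℝ (fun z : (ι → ℝ) × Q => f (torusMk z.1) z.2) (univ ×ˢ D) z (v, 0))
      (univ ×ˢ D) := h1.clm_apply contDiffOn_const
  refine h2.congr ?_
  rintro ⟨y, q⟩ ⟨-, hq⟩
  have h3 : HasFDerivWithinAt (fun z : (ι → ℝ) × Q => f (torusMk z.1) z.2)
      (fderivWithin ℝ (fun z : (ι → ℝ) × Q => f (torusMk z.1) z.2) (univ ×ˢ D) (y, q))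
      (univ ×ˢ D) (y, q) :=
    (hf.differentiableOn (by simp) (y, q) ⟨mem_univ _, hq⟩).hasFDerivWithinAt
  have h4 := h3.comp y (f := fun y : ι → ℝ => (y, q)) (t := univ ×ˢ D) (s := univ)
    (hasFDerivAt_prodMk_left y q).hasFDerivWithinAt fun y _ => ⟨mem_univ _, hq⟩
  rw [hasFDerivWithinAt_univ] at h4
  have h5 := torusDeriv_torusMk (f := fun t => f t q) ((hf.contDiff hq).of_le one_le_infty) v y
  simp only
  rw [h5]
  exact congrArg (fun L : (ι → ℝ) →L[ℝ] G => L v) h4.fderiv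

variable [NormedSpace ℂ G] [SMulCommClass ℝ ℂ G]

theorem IsSmoothFamily.hasFDerivWithinAt_fourierCoef (hD : IsCornerDomain D)
    (hf : IsSmoothFamily D f) (κ : ι → ℤ) {q : Q} (hq : q ∈ D) :
    HasFDerivWithinAt (fun q => fourierCoef (fun t => f t q) κ)
      (fourierCoef (fun t => fderivWithin ℝ (f t) D q) κ) D q := by
  have hf' := hf.paramDeriv hD.uniqueDiffOn
  obtain ⟨ε, hε, hconv, hcomp⟩ := hD.exists_convex_compact hq
  obtain ⟨C, hC⟩ := hf'.exists_bound hcomp inter_subset_left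
  have hsub : D ∩ Metric.ball q ε ⊆ D ∩ Metric.closedBall q ε :=
    inter_subset_inter_right _ Metric.ball_subset_closedBall
  have h := hasFDerivWithinAt_integral (μ := torusHaar ι) hconv
    (x := q) ⟨hq, Metric.mem_ball_self hε⟩
    (F := fun t q => mFourier (-κ) t • f t q)
    (F' := fun t q => mFourier (-κ) t • fderivWithin ℝ (f t) D q) (bound := fun _ => C)
    (fun t x hx => (((hf.contDiffOn t).differentiableOn
      (by simp) x hx.1).hasFDerivWithinAt.const_smul _).mono inter_subset_left)
    (fun t x hx => by
      rw [norm_smul, norm_mFourier_apply, one_mul]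
      exact hC t x (hsub hx))
    (integrable_const C)
    (fun x hx => by
      have := hf.continuous hx.1
      exact integrable_of_continuous (by fun_prop))
    (by
      have := hf'.continuous hq
      exact (by fun_prop : Continuous fun t =>
        mFourier (-κ) t • fderivWithin ℝ (f t) D q).aestronglyMeasurable)
  exact h.mono_of_mem_nhdsWithin (inter_mem_nhdsWithin _ (Metric.ball_mem_nhds q hε))

theorem contDiffOn_nat_fourierCoef (k : ℕ) (hD : IsCornerDomain D) (κ : ι → ℤ) :
    ∀ {G : Type} [NormedAddCommGroup G] [NormedSpace ℝ G] [NormedSpace ℂ G] [SMulCommClass ℝ ℂ G]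
      {f : UnitAddTorus ι → Q → G}, IsSmoothFamily D f →
      ContDiffOn ℝ k (fun q => fourierCoef (fun t => f t q) κ) D := by
  induction k with
  | zero =>
    intro G _ _ _ _ f hf
    rw [Nat.cast_zero, contDiffOn_zero]
    exact fun q hq => (hf.hasFDerivWithinAt_fourierCoef hD κ hq).continuousWithinAt
  | succ k ih =>
    intro G _ _ _ _ f hf
    rw [Nat.cast_succ, contDiffOn_succ_iff_fderivWithin hD.uniqueDiffOn]
    refine ⟨fun x hx => (hf.hasFDerivWithinAt_fourierCoef hD κ hx).differentiableWithinAt,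
      by simp, ?_⟩
    exact ContDiffOn.congr (ih (hf.paramDeriv hD.uniqueDiffOn)) fun x hx =>
      (hf.hasFDerivWithinAt_fourierCoef hD κ hx).fderivWithin (hD.uniqueDiffOn x hx)

theorem IsSmoothFamily.contDiffOn_fourierCoef (hD : IsCornerDomain D) (hf : IsSmoothFamily D f)
    (κ : ι → ℤ) : ContDiffOn ℝ ∞ (fun q => fourierCoef (fun t => f t q) κ) D :=
  contDiffOn_infty.2 fun k => contDiffOn_nat_fourierCoef k hD κ hf

theorem weight_le (κ : ι → ℤ) : weight κ ≤ 1 + ∑ i, |(κ i : ℝ)| := by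
  unfold weight
  gcongr
  refine (pi_norm_le_iff_of_nonneg (Finset.sum_nonneg fun i _ => abs_nonneg _)).2 fun i => ?_
  rw [Int.norm_eq_abs]
  exact Finset.single_le_sum (f := fun i => |(κ i : ℝ)|) (fun i _ => abs_nonneg _)
    (Finset.mem_univ i)

/-- Fourier coefficients of smooth functions decrease rapidly, by repeated integration by parts. -/
theorem IsSmoothFamily.exists_weight_bound [CompleteSpace G] [IsScalarTower ℝ ℂ G]
    (hD : UniqueDiffOn ℝ D) (N : ℕ) :
    ∀ {f : UnitAddTorus ι → Q → G}, IsSmoothFamily D f → ∀ {K : Set Q}, IsCompact K → K ⊆ D →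
    ∃ C : ℝ, ∀ κ : ι → ℤ, ∀ q ∈ K, weight κ ^ N * ‖fourierCoef (fun t => f t q) κ‖ ≤ C := by
  classical
  induction N with
  | zero =>
    intro f hf K hK hKD
    obtain ⟨C, hC⟩ := hf.exists_bound hK hKD
    exact ⟨C, fun κ q hq => by
      rw [pow_zero, one_mul]
      exact norm_fourierCoef_le (fun t => hC t q hq) κ⟩
  | succ N ih =>
    intro f hf K hK hKD
    obtain ⟨C, hC⟩ := ih hf hK hKD
    choose B hB using fun i : ι => ih (hf.lineDeriv hD (Pi.single i 1)) hK hKD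
    refine ⟨C + ∑ i, B i, fun κ q hq => ?_⟩
    have h1 : ∀ i, |(κ i : ℝ)| * ‖fourierCoef (fun t => f t q) κ‖ ≤
        ‖fourierCoef (fun t => torusDeriv (Pi.single i 1) (fun t => f t q) t) κ‖ := by
      intro i
      have := fourierCoef_torusDeriv (f := fun t => f t q)
        ((hf.contDiff (hKD hq)).of_le one_le_infty) (Pi.single i 1) κ
      rw [show (fun t => torusDeriv (Pi.single i 1) (fun t => f t q) t)
        = torusDeriv (Pi.single i 1) (fun t => f t q) from rfl, this, norm_smul]
      refine mul_le_mul_of_nonneg_right ?_ (norm_nonneg _)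
      have h2 : (∑ j, (κ j : ℝ) * (Pi.single i (1 : ℝ) : ι → ℝ) j) = κ i := by
        simp [Pi.single_apply]
      rw [h2]
      simp only [norm_mul, Complex.norm_I, mul_one, Complex.norm_real, Real.norm_eq_abs]
      rw [abs_of_pos Real.pi_pos, Complex.norm_ofNat]
      nlinarith [Real.pi_gt_three, abs_nonneg (κ i : ℝ)]
    have h0 : 0 ≤ weight κ ^ N := pow_nonneg (weight_pos κ).le N
    calc weight κ ^ (N + 1) * ‖fourierCoef (fun t => f t q) κ‖
        = weight κ ^ N * (weight κ * ‖fourierCoef (fun t => f t q) κ‖) := by ring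
      _ ≤ weight κ ^ N * ((1 + ∑ i, |(κ i : ℝ)|) * ‖fourierCoef (fun t => f t q) κ‖) := by
          gcongr
          exact weight_le κ
      _ = weight κ ^ N * ‖fourierCoef (fun t => f t q) κ‖ +
          ∑ i, weight κ ^ N * (|(κ i : ℝ)| * ‖fourierCoef (fun t => f t q) κ‖) := by
          rw [← Finset.mul_sum, ← Finset.sum_mul]
          ring
      _ ≤ C + ∑ i, B i := by
          refine add_le_add (hC κ q hq) (Finset.sum_le_sum fun i _ => ?_)
          exact (mul_le_mul_of_nonneg_left (h1 i) h0).trans (hB i κ q hq)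

/-- The Fourier coefficients of a smooth family are rapidly decreasing, with all their derivatives
in the parameters, locally uniformly up to the boundary. -/
theorem exists_weight_bound_iteratedFDerivWithin (hD : IsCornerDomain D) (N k : ℕ) {K : Set Q}
    (hK : IsCompact K) (hKD : K ⊆ D) :
    ∀ {G : Type} [NormedAddCommGroup G] [NormedSpace ℝ G] [NormedSpace ℂ G] [SMulCommClass ℝ ℂ G]
      [CompleteSpace G] [IsScalarTower ℝ ℂ G]
      {f : UnitAddTorus ι → Q → G}, IsSmoothFamily D f →
    ∃ C : ℝ, ∀ κ : ι → ℤ, ∀ q ∈ K,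
      weight κ ^ N *
        ‖iteratedFDerivWithin ℝ k (fun q => fourierCoef (fun t => f t q) κ) D q‖ ≤ C := by
  induction k with
  | zero =>
    intro G _ _ _ _ _ _ f hf
    simpa only [norm_iteratedFDerivWithin_zero] using
      hf.exists_weight_bound hD.uniqueDiffOn N hK hKD
  | succ k ih =>
    intro G _ _ _ _ _ _ f hf
    obtain ⟨C, hC⟩ := ih (hf.paramDeriv hD.uniqueDiffOn)
    refine ⟨C, fun κ q hq => ?_⟩
    rw [← norm_iteratedFDerivWithin_fderivWithin hD.uniqueDiffOn (hKD hq)]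
    rw [iteratedFDerivWithin_congr (fun x hx =>
      (hf.hasFDerivWithinAt_fourierCoef hD κ hx).fderivWithin (hD.uniqueDiffOn x hx)) (hKD hq)]
    exact hC κ q hq

end SmoothFamily

/-! ### Homogeneous coordinates on the blowup -/

section Homogeneous

variable {n d : ℕ} {L : Submodule ℝ (E n)}

/-- The length of the normal vector `(ω, θ)`. -/
def normalNorm (p : BlowupAmbient L) : ℝ := Real.sqrt (‖p.2.2.1‖ ^ 2 + p.2.2.2 ^ 2)

theorem normalNorm_sq (p : BlowupAmbient L) :
    normalNorm p ^ 2 = ‖p.2.2.1‖ ^ 2 + p.2.2.2 ^ 2 := Real.sq_sqrt (by positivity)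

theorem continuous_normalNorm : Continuous (normalNorm (L := L)) := by
  unfold normalNorm
  fun_prop

theorem norm_fst_le_normalNorm (p : BlowupAmbient L) : ‖p.2.2.1‖ ≤ normalNorm p :=
  Real.le_sqrt_of_sq_le (by nlinarith [sq_nonneg p.2.2.2])

theorem abs_snd_le_normalNorm (p : BlowupAmbient L) : |p.2.2.2| ≤ normalNorm p :=
  Real.le_sqrt_of_sq_le (by rw [sq_abs]; nlinarith [sq_nonneg ‖p.2.2.1‖])

theorem normalNorm_le (p : BlowupAmbient L) : normalNorm p ≤ ‖p.2.2.1‖ + |p.2.2.2| := by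
  refine Real.sqrt_le_iff.2 ⟨by positivity, ?_⟩
  rw [← sq_abs p.2.2.2]
  nlinarith [norm_nonneg p.2.2.1, abs_nonneg p.2.2.2]

/-- The cone over the blowup: the coordinates `(r, w, ω, θ)` with `(ω, θ) ≠ 0` no longer
normalized. The points `(r, w, ω, θ)` and `(r / t, w, t ω, t θ)` have the same image under the
blowdown map `(r, w, ω, θ) ↦ (w + r ω, r θ)`. -/
def cone (L : Submodule ℝ (E n)) : Set (BlowupAmbient L) :=
  {p | (0 ≤ p.1 ∧ 0 ≤ p.2.2.2) ∧ 0 < normalNorm p}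

theorem isCornerDomain_cone (L : Submodule ℝ (E n)) :
    IsCornerDomain ((univ : Set (E n)) ×ˢ cone L) := by
  have h : (univ : Set (E n)) ×ˢ cone L =
      {q : E n × BlowupAmbient L | 0 ≤ q.2.1 ∧ 0 ≤ q.2.2.2.2} ∩ {q | 0 < normalNorm q.2} := by
    ext q
    simp [cone]
  rw [h]
  have hcl : IsClosed {q : E n × BlowupAmbient L | 0 ≤ q.2.1 ∧ 0 ≤ q.2.2.2.2} :=
    (isClosed_le (f := fun _ => (0 : ℝ)) (g := fun q : E n × BlowupAmbient L => q.2.1)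
      (by fun_prop) (by fun_prop)).inter
      (isClosed_le (f := fun _ => (0 : ℝ)) (g := fun q : E n × BlowupAmbient L => q.2.2.2.2)
        (by fun_prop) (by fun_prop))
  refine isCornerDomain_of_inter ?_ hcl ?_ ?_
  · intro a ha b hb s t hs ht _
    exact ⟨add_nonneg (mul_nonneg hs ha.1) (mul_nonneg ht hb.1),
      add_nonneg (mul_nonneg hs ha.2) (mul_nonneg ht hb.2)⟩
  · have ho : IsOpen {q : E n × BlowupAmbient L | 0 < q.2.1 ∧ 0 < q.2.2.2.2} :=
      (isOpen_lt (f := fun _ => (0 : ℝ)) (g := fun q : E n × BlowupAmbient L => q.2.1)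
        (by fun_prop) (by fun_prop)).inter
        (isOpen_lt (f := fun _ => (0 : ℝ)) (g := fun q : E n × BlowupAmbient L => q.2.2.2.2)
          (by fun_prop) (by fun_prop))
    have h1 : ((0, 1, 0, 0, 1) : E n × BlowupAmbient L) ∈
        {q : E n × BlowupAmbient L | 0 < q.2.1 ∧ 0 < q.2.2.2.2} := ⟨one_pos, one_pos⟩
    have hsub : {q : E n × BlowupAmbient L | 0 < q.2.1 ∧ 0 < q.2.2.2.2} ⊆
        {q | 0 ≤ q.2.1 ∧ 0 ≤ q.2.2.2.2} := fun q hq => ⟨hq.1.le, hq.2.le⟩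
    exact ⟨_, interior_maximal hsub ho h1⟩
  · exact isOpen_lt continuous_const (continuous_normalNorm.comp continuous_snd)

/-- Normalization of `(ω, θ)`, the projection of the cone to the blowup. -/
def normalize (p : BlowupAmbient L) : BlowupAmbient L :=
  (p.1 * normalNorm p, p.2.1, (normalNorm p)⁻¹ • p.2.2.1, (normalNorm p)⁻¹ * p.2.2.2)

theorem contDiffOn_normalNorm :
    ContDiffOn ℝ ∞ (normalNorm (L := L)) {p | 0 < normalNorm p} := by
  have h : ContDiff ℝ ∞ fun p : BlowupAmbient L => ‖p.2.2.1‖ ^ 2 + p.2.2.2 ^ 2 :=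
    ContDiff.add (ContDiff.norm_sq ℝ (by fun_prop)) (by fun_prop)
  refine h.contDiffOn.sqrt fun p hp => ?_
  rw [← normalNorm_sq]
  have : 0 < normalNorm p := hp
  positivity

theorem contDiffOn_normalize :
    ContDiffOn ℝ ∞ (normalize (L := L)) {p | 0 < normalNorm p} := by
  have h := contDiffOn_normalNorm (L := L)
  have hinv : ContDiffOn ℝ ∞ (fun p : BlowupAmbient L => (normalNorm p)⁻¹) {p | 0 < normalNorm p} :=
    h.inv fun p hp => ne_of_gt hp
  refine (ContDiffOn.mul (by fun_prop) h).prodMk (ContDiffOn.prodMk (by fun_prop)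
    ((hinv.smul (by fun_prop)).prodMk (hinv.mul (by fun_prop))))

theorem normalize_fst_mul {p : BlowupAmbient L} (hp : 0 < normalNorm p) :
    (normalize p).1 * (normalize p).2.2.2 = p.1 * p.2.2.2 := by
  simp only [normalize]
  field_simp

theorem normalize_mem {p : BlowupAmbient L} (hp : p ∈ cone L) :
    normalize p ∈ blowupSet L ↔ p.1 * p.2.2.2 < 1 := by
  have h := hp.2
  constructor
  · intro h1
    rw [← normalize_fst_mul h]
    exact h1.2.2.2
  · intro h1
    refine ⟨mul_nonneg hp.1.1 h.le, mul_nonneg (inv_nonneg.2 h.le) hp.1.2, ?_, ?_⟩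
    · simp only [normalize, norm_smul, norm_inv, Real.norm_eq_abs, abs_of_pos h]
      field_simp
      exact (normalNorm_sq p).symm
    · rw [normalize_fst_mul h]
      exact h1

theorem normalNorm_of_mem {p : BlowupAmbient L} (hp : p ∈ blowupSet L) : normalNorm p = 1 := by
  rw [normalNorm, hp.2.2.1, Real.sqrt_one]

theorem mem_cone_of_mem {p : BlowupAmbient L} (hp : p ∈ blowupSet L) : p ∈ cone L :=
  ⟨⟨hp.1, hp.2.1⟩, by rw [normalNorm_of_mem hp]; exact one_pos⟩

/-- The action `(r, w, ω, θ) ↦ (r / t, w, t ω, t θ)` of the positive reals, extended by the identity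
to a further variable. -/
def dilation (t : ℝ) (ht : 0 < t) : (E n × BlowupAmbient L) ≃L[ℝ] (E n × BlowupAmbient L) :=
  let u : ℝˣ := Units.mk0 t ht.ne'
  (ContinuousLinearEquiv.refl ℝ (E n)).prodCongr
    ((ContinuousLinearEquiv.smulLeft u⁻¹).prodCongr
      ((ContinuousLinearEquiv.refl ℝ L).prodCongr
        ((ContinuousLinearEquiv.smulLeft u).prodCongr (ContinuousLinearEquiv.smulLeft u))))

theorem dilation_apply (t : ℝ) (ht : 0 < t) (q : E n × BlowupAmbient L) :
    dilation t ht q = (q.1, t⁻¹ * q.2.1, q.2.2.1, t • q.2.2.2.1, t * q.2.2.2.2) := by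
  rfl

theorem normalNorm_dilation (t : ℝ) (ht : 0 < t) (q : E n × BlowupAmbient L) :
    normalNorm (dilation t ht q).2 = t * normalNorm q.2 := by
  rw [dilation_apply]
  simp only [normalNorm, norm_smul, Real.norm_eq_abs, abs_of_pos ht]
  rw [show (t * ‖q.2.2.2.1‖) ^ 2 + (t * q.2.2.2.2) ^ 2 =
    t ^ 2 * (‖q.2.2.2.1‖ ^ 2 + q.2.2.2.2 ^ 2) by ring, Real.sqrt_mul (by positivity),
    Real.sqrt_sq ht.le]

theorem dilation_mem_iff (t : ℝ) (ht : 0 < t) (q : E n × BlowupAmbient L) :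
    (dilation t ht q).2 ∈ cone L ↔ q.2 ∈ cone L := by
  unfold cone
  rw [mem_ofPred_eq, mem_ofPred_eq, normalNorm_dilation, dilation_apply]
  simp [ht]

theorem normalize_dilation (t : ℝ) (ht : 0 < t) (q : E n × BlowupAmbient L) :
    normalize (dilation t ht q).2 = normalize q.2 := by
  unfold normalize
  rw [normalNorm_dilation, dilation_apply]
  simp only [smul_smul]
  have h : (t * normalNorm q.2)⁻¹ * t = (normalNorm q.2)⁻¹ := by
    rw [mul_inv, mul_comm, ← mul_assoc, mul_inv_cancel₀ ht.ne', one_mul]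
  rw [← mul_assoc (t * normalNorm q.2)⁻¹, h, mul_mul_mul_comm, inv_mul_cancel₀ ht.ne', one_mul]

theorem norm_dilation_le (t : ℝ) (ht : 0 < t) :
    ‖((dilation t ht : (E n × BlowupAmbient L) ≃L[ℝ] (E n × BlowupAmbient L)) :
      (E n × BlowupAmbient L) →L[ℝ] (E n × BlowupAmbient L))‖ ≤ 1 + t + t⁻¹ := by
  have hti : 0 < t⁻¹ := inv_pos.2 ht
  refine ContinuousLinearMap.opNorm_le_bound _ (by positivity) fun q => ?_
  have h1 : ‖q.1‖ ≤ ‖q‖ := norm_fst_le q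
  have h2 : ‖q.2.1‖ ≤ ‖q‖ := (norm_fst_le q.2).trans (norm_snd_le q)
  have h3 : ‖q.2.2.1‖ ≤ ‖q‖ := (norm_fst_le q.2.2).trans ((norm_snd_le _).trans (norm_snd_le q))
  have h4 : ‖q.2.2.2.1‖ ≤ ‖q‖ := (norm_fst_le q.2.2.2).trans
    ((norm_snd_le _).trans ((norm_snd_le _).trans (norm_snd_le q)))
  have h5 : ‖q.2.2.2.2‖ ≤ ‖q‖ := (norm_snd_le q.2.2.2).trans
    ((norm_snd_le _).trans ((norm_snd_le _).trans (norm_snd_le q)))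
  have h0 := norm_nonneg q
  have hm : ∀ {c x : ℝ}, 0 ≤ x → x ≤ ‖q‖ → 0 ≤ c → c ≤ 1 + t + t⁻¹ →
      c * x ≤ (1 + t + t⁻¹) * ‖q‖ := fun hx hxq hc hct =>
    mul_le_mul hct hxq hx (by positivity)
  rw [ContinuousLinearEquiv.coe_coe, dilation_apply]
  simp only [Prod.norm_mk, max_le_iff, norm_smul, norm_mul, Real.norm_eq_abs, abs_of_pos ht,
    abs_of_pos hti]
  refine ⟨?_, ?_, ?_, ?_, ?_⟩
  · simpa using hm (norm_nonneg _) h1 zero_le_one (by linarith)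
  · exact hm (abs_nonneg _) h2 hti.le (by linarith)
  · simpa using hm (norm_nonneg _) h3 zero_le_one (by linarith)
  · exact hm (norm_nonneg _) h4 ht.le (by linarith)
  · exact hm (abs_nonneg _) h5 ht.le (by linarith)

end Homogeneous

/-! ### Amplitudes in homogeneous coordinates -/

section Amplitude

open UnitAddTorus

variable {n d : ℕ} {v : Fin d → E n}

open Classical in
/-- The function on the cone over the blowup which is induced by `s`, invariant under
`(r, w, ω, θ) ↦ (r / t, w, t ω, t θ)`. It is extended by zero across `h = 1`. -/
def homogenization (s : T n × Stot v → ℂ) (x y : T n) (p : BlowupAmbient (coisotropicFibre v)) :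
    ℂ :=
  if h : normalize p ∈ blowupSet (coisotropicFibre v) then s (x, y, ⟨normalize p, h⟩) else 0

theorem homogenization_lift (s : T n × Stot v → ℂ) (x y : T n) (ξ : E n) (h : Param) :
    homogenization s x y (1, (coisotropicFibre v).orthogonalProjectionOnto ξ,
      (coisotropicFibre v)ᗮ.orthogonalProjectionOnto ξ, (h : ℝ)) = amplitude s x y ξ h := by
  have h1 : normalize ((1, (coisotropicFibre v).orthogonalProjectionOnto ξ,
      (coisotropicFibre v)ᗮ.orthogonalProjectionOnto ξ, (h : ℝ)) :
      BlowupAmbient (coisotropicFibre v)) = blowupLift (coisotropicFibre v) ξ h := by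
    simp only [normalize, blowupLift, normalNorm, radius, one_mul, div_eq_inv_mul]
  have h2 : normalize ((1, (coisotropicFibre v).orthogonalProjectionOnto ξ,
      (coisotropicFibre v)ᗮ.orthogonalProjectionOnto ξ, (h : ℝ)) :
      BlowupAmbient (coisotropicFibre v)) ∈ blowupSet _ := by
    rw [h1]
    exact (blowupLift (coisotropicFibre v) ξ h).2
  rw [homogenization, dif_pos h2, amplitude]
  congr 3
  exact Subtype.ext h1

theorem homogenization_dilation (s : T n × Stot v → ℂ) (x y : T n) (t : ℝ) (ht : 0 < t)
    (q : E n × BlowupAmbient (coisotropicFibre v)) :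
    homogenization s x y (dilation t ht q).2 = homogenization s x y q.2 := by
  unfold homogenization
  rw [normalize_dilation]

/-- The amplitude `s` is supported where `r ≤ R`, `|w| ≤ R` and `h ≤ δ`. -/
structure SupportBound (s : T n × Stot v → ℂ) (R δ : ℝ) : Prop where
  pos : 0 < R
  lt_one : δ < 1
  le : ∀ x y p, s (x, y, p) ≠ 0 → p.1.1 ≤ R ∧ ‖p.1.2.1‖ ≤ R ∧ p.1.1 * p.1.2.2.2 ≤ δ

theorem exists_supportBound {s : T n × Stot v → ℂ} (hs : IsCcSmoothAmplitude s) :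
    ∃ R δ, SupportBound s R δ := by
  have hK : IsCompact (tsupport s) := hs.compact
  obtain ⟨R₁, h1⟩ := hK.exists_bound_of_continuousOn
    (f := fun z : T n × Stot v => z.2.2.1.1) (by fun_prop)
  obtain ⟨R₂, h2⟩ := hK.exists_bound_of_continuousOn
    (f := fun z : T n × Stot v => z.2.2.1.2.1) (by fun_prop)
  have h3 : ∃ δ < 1, ∀ z ∈ tsupport s, z.2.2.1.1 * z.2.2.1.2.2.2 ≤ δ := by
    rcases (tsupport s).eq_empty_or_nonempty with he | hne
    · exact ⟨0, one_pos, by simp [he]⟩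
    · obtain ⟨z, hz, hmax⟩ := hK.exists_isMaxOn hne
        (f := fun z : T n × Stot v => z.2.2.1.1 * z.2.2.1.2.2.2) (by fun_prop)
      exact ⟨_, z.2.2.2.2.2.2, fun w hw => hmax hw⟩
  obtain ⟨δ, hδ, h3⟩ := h3
  refine ⟨max (max R₁ R₂) 1, δ, lt_max_of_lt_right one_pos, hδ, fun x y p hp => ?_⟩
  have hm : (x, y, p) ∈ tsupport s := subset_tsupport s hp
  exact ⟨((le_abs_self _).trans (h1 _ hm)).trans ((le_max_left _ _).trans (le_max_left _ _)),
    (h2 _ hm).trans ((le_max_right _ _).trans (le_max_left _ _)), h3 _ hm⟩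

theorem SupportBound.homogenization_eq_zero {s : T n × Stot v → ℂ} {R δ : ℝ}
    (hs : SupportBound s R δ) {p : BlowupAmbient (coisotropicFibre v)} (hp : p ∈ cone _)
    (h : R < p.1 * normalNorm p ∨ R < ‖p.2.1‖ ∨ δ < p.1 * p.2.2.2) (x y : T n) :
    homogenization s x y p = 0 := by
  by_contra hne
  rw [homogenization] at hne
  split_ifs at hne with h0
  · obtain ⟨h1, h2, h3⟩ := hs.le x y _ hne
    simp only [normalize_fst_mul hp.2] at h3
    simp only [normalize] at h1 h2
    rcases h with h | h | h <;> linarith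
  · exact hne rfl

theorem contDiffOn_homogenization {s : T n × Stot v → ℂ} (hs : IsCcSmoothAmplitude s) :
    ContDiffOn ℝ ∞ (fun z : E n × E n × BlowupAmbient (coisotropicFibre v) =>
      homogenization s (toTorus z.1) (toTorus z.2.1) z.2.2) (univ ×ˢ univ ×ˢ cone _) := by
  obtain ⟨F, hF, hFs⟩ := hs.smooth
  obtain ⟨R, δ, hb⟩ := exists_supportBound hs
  have hcont : Continuous fun z : E n × E n × BlowupAmbient (coisotropicFibre v) =>
    z.2.2.1 * z.2.2.2.2.2 := by fun_prop
  refine contDiffOn_of_locally_contDiffOn fun z hz => ?_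
  by_cases hlt : z.2.2.1 * z.2.2.2.2.2 < 1
  · refine ⟨{z | z.2.2.1 * z.2.2.2.2.2 < 1}, isOpen_lt hcont continuous_const, hlt, ?_⟩
    have hn : ContDiffOn ℝ ∞ (fun z : E n × E n × BlowupAmbient (coisotropicFibre v) =>
        (z.1, z.2.1, normalize z.2.2))
        ((univ ×ˢ univ ×ˢ cone _) ∩ {z | z.2.2.1 * z.2.2.2.2.2 < 1}) :=
      ContDiffOn.prodMk (by fun_prop) (ContDiffOn.prodMk (by fun_prop)
        (contDiffOn_normalize.comp (by fun_prop) fun z hz => hz.1.2.2.2))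
    refine (hF.comp hn fun z hz => ⟨mem_univ _, mem_univ _, (normalize_mem hz.1.2.2).2 hz.2⟩).congr
      fun z hz => ?_
    have hm := (normalize_mem hz.1.2.2).2 hz.2
    rw [homogenization, dif_pos hm]
    exact (hFs z.1 z.2.1 ⟨_, hm⟩).symm
  · refine ⟨{z | δ < z.2.2.1 * z.2.2.2.2.2}, isOpen_lt continuous_const hcont,
      hb.lt_one.trans_le (not_lt.1 hlt), ?_⟩
    exact (contDiffOn_const (c := (0 : ℂ))).congr fun z hz =>
      hb.homogenization_eq_zero hz.1.2.2 (Or.inr (Or.inr hz.2)) _ _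

/-- The amplitude `s`, translated by `x` in both torus variables, as a function on the torus
of dimension `2n` with parameters `(x, p)`. By the translation, the Fourier coefficients are the
summands of the restriction of the Fourier series to the diagonal. -/
def amplitudeFamily (s : T n × Stot v → ℂ) (t : UnitAddTorus (Fin n ⊕ Fin n))
    (q : E n × BlowupAmbient (coisotropicFibre v)) : ℂ :=
  homogenization s (toTorus q.1 + fun i => t (Sum.inl i)) (toTorus q.1 + fun i => t (Sum.inr i)) q.2

theorem isSmoothFamily_amplitudeFamily {s : T n × Stot v → ℂ} (hs : IsCcSmoothAmplitude s) :
    IsSmoothFamily (univ ×ˢ cone _) (amplitudeFamily s) := by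
  have h := contDiffOn_homogenization hs
  have h2 : ContDiff ℝ ∞ fun z : (Fin n ⊕ Fin n → ℝ) × (E n × BlowupAmbient (coisotropicFibre v)) =>
      (z.2.1 + WithLp.toLp 2 (fun i => z.1 (Sum.inl i)),
        z.2.1 + WithLp.toLp 2 (fun i => z.1 (Sum.inr i)), z.2.2) := by
    have h3 : ∀ f : Fin n → Fin n ⊕ Fin n, ContDiff ℝ ∞
        fun z : (Fin n ⊕ Fin n → ℝ) × (E n × BlowupAmbient (coisotropicFibre v)) =>
          (WithLp.toLp 2 (fun i => z.1 (f i)) : E n) := fun f => by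
      refine (PiLp.contDiff_toLp (𝕜 := ℝ) (p := 2)).comp ?_
      fun_prop
    have := h3 Sum.inl
    have := h3 Sum.inr
    fun_prop
  have h4 := h.comp h2.contDiffOn (s := univ ×ˢ (univ ×ˢ cone _))
    fun z hz => ⟨mem_univ _, mem_univ _, hz.2.2⟩
  refine h4.congr fun z hz => ?_
  simp only [amplitudeFamily, Function.comp_apply, toTorus_add]
  rfl

/-- The Fourier coefficient of `amplitudeFamily s`; at `(x, p)` it equals `e^{2πi (k + m)⬝x}` times
the Fourier coefficient of index `κ = (k, m)` of `s(⬝, ⬝, p)`. -/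
def amplitudeCoef (s : T n × Stot v → ℂ) (κ : Fin n ⊕ Fin n → ℤ)
    (q : E n × BlowupAmbient (coisotropicFibre v)) : ℂ :=
  fourierCoef (fun t => amplitudeFamily s t q) κ

theorem contDiffOn_amplitudeCoef {s : T n × Stot v → ℂ} (hs : IsCcSmoothAmplitude s)
    (κ : Fin n ⊕ Fin n → ℤ) : ContDiffOn ℝ ∞ (amplitudeCoef s κ) (univ ×ˢ cone _) :=
  (isSmoothFamily_amplitudeFamily hs).contDiffOn_fourierCoef (isCornerDomain_cone _) κ

theorem amplitudeCoef_dilation (s : T n × Stot v → ℂ) (κ : Fin n ⊕ Fin n → ℤ) (t : ℝ) (ht : 0 < t)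
    (q : E n × BlowupAmbient (coisotropicFibre v)) :
    amplitudeCoef s κ (dilation t ht q) = amplitudeCoef s κ q := by
  simp only [amplitudeCoef, amplitudeFamily, homogenization_dilation]
  rw [dilation_apply]

theorem SupportBound.amplitudeCoef_eq_zero {s : T n × Stot v → ℂ} {R δ : ℝ}
    (hs : SupportBound s R δ) {q : E n × BlowupAmbient (coisotropicFibre v)} (hp : q.2 ∈ cone _)
    (h : R < q.2.1 * normalNorm q.2 ∨ R < ‖q.2.2.1‖ ∨ δ < q.2.1 * q.2.2.2.2)
    (κ : Fin n ⊕ Fin n → ℤ) : amplitudeCoef s κ q = 0 := by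
  simp [amplitudeCoef, amplitudeFamily, fourierCoef, hs.homogenization_eq_zero hp h]

theorem amplitudeCoef_eq_mul (s : T n × Stot v → ℂ) (κ : Fin n ⊕ Fin n → ℤ) (x : E n)
    (p : BlowupAmbient (coisotropicFibre v)) :
    amplitudeCoef s κ (x, p) = mFourier (fun i => κ (Sum.inl i)) (toTorus x) *
      mFourier (fun i => κ (Sum.inr i)) (toTorus x) * amplitudeCoef s κ (0, p) := by
  have h := fourierCoef_translate (fun t => amplitudeFamily s t (0, p)) κ
    (Sum.elim (toTorus x) (toTorus x))
  have h0 : toTorus (0 : E n) = 0 := by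
    funext i
    simp [toTorus]
  have h1 : (fun t => amplitudeFamily s (Sum.elim (toTorus x) (toTorus x) + t) (0, p)) =
      fun t => amplitudeFamily s t (x, p) := by
    funext t
    simp only [amplitudeFamily, h0, zero_add]
    rfl
  rw [h1] at h
  rw [amplitudeCoef, h, smul_eq_mul, amplitudeCoef]
  congr 1
  simp [mFourier, Fintype.prod_sum_type]

end Amplitude

/-! ### Bounds on the cone over the blowup -/

section Bounds

open UnitAddTorus

variable {n d : ℕ} {v : Fin d → E n}

/-- The normalized points with `r ≤ R` and `|w| ≤ R` form a compact set, which meets the front and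
the side face. -/
theorem isCompact_normalized (L : Submodule ℝ (E n)) (R : ℝ) :
    IsCompact {p : BlowupAmbient L |
      p.1 ∈ Icc 0 R ∧ ‖p.2.1‖ ≤ R ∧ 0 ≤ p.2.2.2 ∧ normalNorm p = 1} := by
  have hK : IsCompact ((Icc 0 R : Set ℝ) ×ˢ (Metric.closedBall (0 : L) R) ×ˢ
      (Metric.closedBall (0 : Lᗮ) 1) ×ˢ (Icc 0 1 : Set ℝ)) :=
    isCompact_Icc.prod ((isCompact_closedBall _ _).prod ((isCompact_closedBall _ _).prod
      isCompact_Icc))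
  refine (hK.inter_right (isClosed_eq (continuous_normalNorm (L := L))
    (continuous_const (y := (1 : ℝ))))).of_isClosed_subset ?_ ?_
  · have h1 : IsClosed {p : BlowupAmbient L | p.1 ∈ Icc 0 R} :=
      isClosed_Icc.preimage continuous_fst
    have h2 : IsClosed {p : BlowupAmbient L | ‖p.2.1‖ ≤ R} :=
      isClosed_le (by fun_prop) continuous_const
    have h3 : IsClosed {p : BlowupAmbient L | 0 ≤ p.2.2.2} :=
      isClosed_le continuous_const (by fun_prop)
    have h4 : IsClosed {p : BlowupAmbient L | normalNorm p = 1} :=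
      isClosed_eq continuous_normalNorm continuous_const
    exact h1.inter (h2.inter (h3.inter h4))
  · rintro p ⟨h1, h2, h3, h4⟩
    refine ⟨⟨h1, by simpa using h2, ?_, h3, ?_⟩, h4⟩
    · simpa using (norm_fst_le_normalNorm p).trans h4.le
    · exact (le_abs_self _).trans ((abs_snd_le_normalNorm p).trans h4.le)

theorem preimage_dilation (L : Submodule ℝ (E n)) (t : ℝ) (ht : 0 < t) :
    (dilation t ht : (E n × BlowupAmbient L) ≃L[ℝ] (E n × BlowupAmbient L)) ⁻¹'
      (univ ×ˢ cone L) = univ ×ˢ cone L := by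
  ext q
  have := dilation_mem_iff t ht q
  simp [this]

/-- By invariance under dilations, the bounds over a compact set of normalized points give bounds
over the whole cone, which grow polynomially in `ν` and `ν⁻¹`, `ν` being the length of the normal
vector. -/
theorem exists_amplitudeCoef_bound {s : T n × Stot v → ℂ} (hs : IsCcSmoothAmplitude s) (N k : ℕ)
    {X : Set (E n)} (hX : IsCompact X) :
    ∃ C : ℝ, ∀ κ : Fin n ⊕ Fin n → ℤ, ∀ q ∈ X ×ˢ cone (coisotropicFibre v),
      weight κ ^ N * ‖iteratedFDerivWithin ℝ k (amplitudeCoef s κ) (univ ×ˢ cone _) q‖ ≤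
        C * (1 + normalNorm q.2 + (normalNorm q.2)⁻¹) ^ k := by
  obtain ⟨R, δ, hb⟩ := exists_supportBound hs
  have hD := isCornerDomain_cone (coisotropicFibre v)
  obtain ⟨C, hC⟩ := exists_weight_bound_iteratedFDerivWithin hD N k
    (hX.prod (isCompact_normalized (coisotropicFibre v) R))
    (by
      rintro ⟨x, p⟩ ⟨-, h1, -, h2, h3⟩
      exact ⟨mem_univ _, ⟨h1.1, h2⟩, by simp only [h3]; exact one_pos⟩)
    (isSmoothFamily_amplitudeFamily hs)
  refine ⟨max C 0, fun κ q hq => ?_⟩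
  have hν : 0 < normalNorm q.2 := hq.2.2
  -- the dilation by `t` maps `q` to a normalized point
  set t := (normalNorm q.2)⁻¹ with ht_def
  have ht : 0 < t := inv_pos.2 hν
  have hinv : amplitudeCoef s κ = amplitudeCoef s κ ∘ dilation t ht := by
    funext q
    exact (amplitudeCoef_dilation s κ t ht q).symm
  have hmem : dilation t ht q ∈ (univ : Set (E n)) ×ˢ cone (coisotropicFibre v) :=
    ⟨mem_univ _, (dilation_mem_iff t ht q).2 hq.2⟩
  have hν1 : normalNorm (dilation t ht q).2 = 1 := by
    rw [normalNorm_dilation, ht_def, inv_mul_cancel₀ hν.ne']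
  have hbound : weight κ ^ N * ‖iteratedFDerivWithin ℝ k (amplitudeCoef s κ) (univ ×ˢ cone _)
      (dilation t ht q)‖ ≤ max C 0 := by
    by_cases hin : (dilation t ht q).2 ∈ {p : BlowupAmbient (coisotropicFibre v) |
      p.1 ∈ Icc 0 R ∧ ‖p.2.1‖ ≤ R ∧ 0 ≤ p.2.2.2 ∧ normalNorm p = 1}
    · refine (hC κ (dilation t ht q) ⟨?_, hin⟩).trans (le_max_left _ _)
      rw [dilation_apply]
      exact hq.1
    -- outside this compact set the coefficient vanishes, with its derivatives
    · have hout : R < (dilation t ht q).2.1 * normalNorm (dilation t ht q).2 ∨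
          R < ‖(dilation t ht q).2.2.1‖ := by
        by_contra hcon
        push Not at hcon
        rw [hν1, mul_one] at hcon
        exact hin ⟨⟨hmem.2.1.1, hcon.1⟩, hcon.2, hmem.2.1.2, hν1⟩
      have hopen : IsOpen {q : E n × BlowupAmbient (coisotropicFibre v) |
          R < q.2.1 * normalNorm q.2 ∨ R < ‖q.2.2.1‖} := by
        have h1 : Continuous fun q : E n × BlowupAmbient (coisotropicFibre v) =>
            q.2.1 * normalNorm q.2 :=
          (by fun_prop : Continuous fun q : E n × BlowupAmbient (coisotropicFibre v) => q.2.1).mul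
            (continuous_normalNorm.comp continuous_snd)
        exact (isOpen_lt continuous_const h1).union (isOpen_lt continuous_const
          (by fun_prop : Continuous fun q : E n × BlowupAmbient (coisotropicFibre v) => ‖q.2.2.1‖))
      have hev : amplitudeCoef s κ =ᶠ[nhdsWithin (dilation t ht q)
          (univ ×ˢ cone (coisotropicFibre v))] fun _ => (0 : ℂ) := by
        filter_upwards [inter_mem_nhdsWithin _ (hopen.mem_nhds hout)] with z hz
        refine hb.amplitudeCoef_eq_zero hz.1.2 ?_ κ
        exact hz.2.elim Or.inl fun h => Or.inr (Or.inl h)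
      exact le_of_eq_of_le (mul_eq_zero_of_right _ (norm_iteratedFDerivWithin_eq_zero hev hmem k))
        (le_max_right C 0)
  have hcomp := norm_iteratedFDerivWithin_comp_equiv_le (dilation t ht) (amplitudeCoef s κ)
    hD.uniqueDiffOn hmem k
  rw [preimage_dilation, ← hinv] at hcomp
  have h2 := norm_dilation_le (L := coisotropicFibre v) t ht
  have h3 : 1 + t + t⁻¹ = 1 + normalNorm q.2 + t := by
    rw [ht_def, inv_inv]
    ring
  rw [h3] at h2
  have hw : 0 ≤ weight κ ^ N := pow_nonneg (weight_pos κ).le N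
  calc _ ≤ weight κ ^ N * (‖iteratedFDerivWithin ℝ k (amplitudeCoef s κ) (univ ×ˢ cone _)
        (dilation t ht q)‖ * (1 + normalNorm q.2 + t) ^ k) := by
        refine mul_le_mul_of_nonneg_left (hcomp.trans ?_) hw
        gcongr
    _ ≤ _ := by
        rw [← mul_assoc]
        exact mul_le_mul_of_nonneg_right hbound (by positivity)

end Bounds

/-! ### Translations in the fibres of the blowup -/

section Affine

variable {Q W : Type} [NormedAddCommGroup Q] [NormedSpace ℝ Q] [NormedAddCommGroup W]
  [NormedSpace ℝ W]

theorem contDiff_smul_add_smul {g₁ g₂ : Q → ℝ} (h₁ : ContDiff ℝ ∞ g₁) (h₂ : ContDiff ℝ ∞ g₂)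
    (c₁ c₂ : W) : ContDiff ℝ ∞ fun q => g₁ q • c₁ + g₂ q • c₂ :=
  (h₁.smul contDiff_const).add (h₂.smul contDiff_const)

theorem exists_iteratedFDeriv_add_apply_bound {A : Q → W →L[ℝ] Q} (hA : ContDiff ℝ ∞ A) (k : ℕ)
    {K : Set Q} (hK : IsCompact K) :
    ∃ B ≥ 1, ∀ a : W, ∀ q ∈ K, ∀ i ≤ k,
      ‖iteratedFDeriv ℝ i (fun q => q + A q a) q‖ ≤ B * (1 + ‖a‖) := by
  have h1 : ∀ i : ℕ, ∃ C, ∀ q ∈ K, ‖iteratedFDeriv ℝ i (id : Q → Q) q‖ ≤ C :=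
    fun i => hK.exists_bound_of_continuousOn
      (contDiff_id.continuous_iteratedFDeriv (m := i) (n := ∞)
        (by exact_mod_cast le_top)).continuousOn
  have h2 : ∀ i : ℕ, ∃ C, ∀ q ∈ K, ‖iteratedFDeriv ℝ i A q‖ ≤ C :=
    fun i => hK.exists_bound_of_continuousOn
      (hA.continuous_iteratedFDeriv (m := i) (by exact_mod_cast le_top)).continuousOn
  choose C₁ h1 using h1
  choose C₂ h2 using h2
  refine ⟨1 + ∑ i ∈ Finset.range (k + 1), (|C₁ i| + |C₂ i|), ?_, fun a q hq i hi => ?_⟩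
  · have : 0 ≤ ∑ i ∈ Finset.range (k + 1), (|C₁ i| + |C₂ i|) :=
      Finset.sum_nonneg fun i _ => by positivity
    linarith
  have hle : |C₁ i| + |C₂ i| ≤ ∑ i ∈ Finset.range (k + 1), (|C₁ i| + |C₂ i|) :=
    Finset.single_le_sum (f := fun i => |C₁ i| + |C₂ i|) (fun i _ => by positivity)
      (Finset.mem_range.2 (Nat.lt_succ_of_le hi))
  have hfun : (fun q => q + A q a) = id + (ContinuousLinearMap.apply ℝ Q a) ∘ A := by
    funext q
    simp
  have hs : ContDiff ℝ ∞ ((ContinuousLinearMap.apply ℝ Q a) ∘ A) :=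
    (ContinuousLinearMap.contDiff _).comp hA
  have hi' : (i : WithTop ℕ∞) ≤ ∞ := by exact_mod_cast le_top
  have h3 : ‖iteratedFDeriv ℝ i ((ContinuousLinearMap.apply ℝ Q a) ∘ A) q‖ ≤
      ‖a‖ * ‖iteratedFDeriv ℝ i A q‖ := by
    refine (ContinuousLinearMap.norm_iteratedFDeriv_comp_left _
      hA.contDiffAt hi').trans ?_
    gcongr
    exact ContinuousLinearMap.opNorm_le_bound _ (norm_nonneg _) fun F => by
      rw [ContinuousLinearMap.apply_apply, mul_comm]
      exact F.le_opNorm a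
  rw [hfun, iteratedFDeriv_add (contDiff_id.of_le hi') (hs.of_le hi'), Pi.add_apply]
  refine (norm_add_le _ _).trans ?_
  have h4 : ‖iteratedFDeriv ℝ i (id : Q → Q) q‖ ≤ |C₁ i| :=
    (h1 i q hq).trans (le_abs_self _)
  have h5 : ‖iteratedFDeriv ℝ i A q‖ ≤ |C₂ i| :=
    (h2 i q hq).trans (le_abs_self _)
  have h6 : ‖a‖ * ‖iteratedFDeriv ℝ i A q‖ ≤ ‖a‖ * |C₂ i| := by gcongr
  nlinarith [norm_nonneg a, abs_nonneg (C₁ i), abs_nonneg (C₂ i)]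

end Affine

section Shift

open UnitAddTorus

variable {n d : ℕ} {L : Submodule ℝ (E n)}

/-- An integer vector as a vector of `ℝⁿ`. -/
def intVec (m : Fin n → ℤ) : E n := WithLp.toLp 2 fun i => (m i : ℝ)

theorem norm_intVec_le (m : Fin n → ℤ) : ‖intVec m‖ ≤ n * ‖m‖ := by
  rw [EuclideanSpace.norm_eq]
  refine Real.sqrt_le_iff.2 ⟨by positivity, ?_⟩
  have h : ∀ i, ‖(intVec m) i‖ ^ 2 ≤ ‖m‖ ^ 2 := fun i => by
    have h1 : ‖(intVec m) i‖ = ‖m i‖ := by simp [intVec, Int.norm_eq_abs]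
    rw [h1]
    gcongr
    exact norm_le_pi_norm m i
  refine (Finset.sum_le_sum fun i _ => h i).trans ?_
  simp only [Finset.sum_const, Finset.card_univ, Fintype.card_fin, nsmul_eq_mul]
  rw [mul_pow]
  gcongr
  exact_mod_cast Nat.le_self_pow two_ne_zero n

/-- The linear part of the map which translates the fibre variable. -/
def shiftPart (q : E n × BlowupAmbient L) : E n →L[ℝ] E n × BlowupAmbient L :=
  (q.2.1 * q.2.2.2.2) • ((ContinuousLinearMap.inr ℝ (E n) (BlowupAmbient L)).comp
    ((ContinuousLinearMap.inr ℝ ℝ (L × Lᗮ × ℝ)).comp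
      ((ContinuousLinearMap.inl ℝ L (Lᗮ × ℝ)).comp L.orthogonalProjectionOnto))) +
  q.2.2.2.2 • ((ContinuousLinearMap.inr ℝ (E n) (BlowupAmbient L)).comp
    ((ContinuousLinearMap.inr ℝ ℝ (L × Lᗮ × ℝ)).comp
      ((ContinuousLinearMap.inr ℝ L (Lᗮ × ℝ)).comp
        ((ContinuousLinearMap.inl ℝ Lᗮ ℝ).comp Lᗮ.orthogonalProjectionOnto))))

/-- The lift to the cone over the blowup of the translation `ξ ↦ ξ + h a`. -/
def shift (a : E n) (q : E n × BlowupAmbient L) : E n × BlowupAmbient L := q + shiftPart q a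

theorem shift_apply (a : E n) (q : E n × BlowupAmbient L) :
    shift a q = (q.1, q.2.1, q.2.2.1 + (q.2.1 * q.2.2.2.2) • L.orthogonalProjectionOnto a,
      q.2.2.2.1 + q.2.2.2.2 • Lᗮ.orthogonalProjectionOnto a, q.2.2.2.2) := by
  simp only [shift, shiftPart, add_apply, smul_apply,
    ContinuousLinearMap.comp_apply, ContinuousLinearMap.inr_apply, ContinuousLinearMap.inl_apply]
  refine Prod.ext ?_ (Prod.ext ?_ (Prod.ext ?_ (Prod.ext ?_ ?_))) <;> simp

theorem contDiff_shiftPart : ContDiff ℝ ∞ (shiftPart (L := L)) := by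
  refine contDiff_smul_add_smul (Q := E n × BlowupAmbient L) ?_ ?_ _ _ <;> fun_prop

theorem contDiff_shift (a : E n) : ContDiff ℝ ∞ (shift (L := L) a) :=
  contDiff_id.add (contDiff_shiftPart.clm_apply contDiff_const)

theorem exists_shift_bound (k : ℕ) {K : Set (E n × BlowupAmbient L)} (hK : IsCompact K) :
    ∃ B ≥ 1, ∀ a : E n, ∀ q ∈ K, ∀ i ≤ k, ‖iteratedFDeriv ℝ i (shift a) q‖ ≤ B * (1 + ‖a‖) := by
  have h := exists_iteratedFDeriv_add_apply_bound (Q := E n × BlowupAmbient L)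
    contDiff_shiftPart k hK
  have h1 : ∀ a : E n, (fun q : E n × BlowupAmbient L => q + shiftPart q a) = shift a :=
    fun a => rfl
  simp only [h1] at h
  exact h

theorem normalNorm_le_shift (a : E n) (q : E n × BlowupAmbient L) :
    normalNorm q.2 ≤ (2 + ‖a‖) * normalNorm (shift a q).2 := by
  have h1 := norm_fst_le_normalNorm (shift a q).2
  have h2 := abs_snd_le_normalNorm (shift a q).2
  have h3 := normalNorm_le q.2
  have hP : ‖Lᗮ.orthogonalProjectionOnto a‖ ≤ ‖a‖ :=
    Submodule.norm_orthogonalProjectionOnto_apply_le _ _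
  rw [shift_apply] at h1 h2 ⊢
  simp only at h1 h2
  have h4 : ‖q.2.2.2.1‖ ≤ ‖q.2.2.2.1 + q.2.2.2.2 • Lᗮ.orthogonalProjectionOnto a‖ +
      ‖q.2.2.2.2 • Lᗮ.orthogonalProjectionOnto a‖ := by
    have := norm_sub_le (q.2.2.2.1 + q.2.2.2.2 • Lᗮ.orthogonalProjectionOnto a)
      (q.2.2.2.2 • Lᗮ.orthogonalProjectionOnto a)
    rwa [add_sub_cancel_right] at this
  have h5 : ‖q.2.2.2.2 • Lᗮ.orthogonalProjectionOnto a‖ ≤ |q.2.2.2.2| * ‖a‖ := by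
    rw [norm_smul, Real.norm_eq_abs]
    gcongr
  have h6 := mul_le_mul_of_nonneg_right h2 (norm_nonneg a)
  linarith

theorem normalNorm_shift_le (a : E n) (q : E n × BlowupAmbient L) :
    normalNorm (shift a q).2 ≤ (2 + ‖a‖) * normalNorm q.2 := by
  have h1 := norm_fst_le_normalNorm q.2
  have h2 := abs_snd_le_normalNorm q.2
  have h3 := normalNorm_le (shift a q).2
  have hP : ‖Lᗮ.orthogonalProjectionOnto a‖ ≤ ‖a‖ :=
    Submodule.norm_orthogonalProjectionOnto_apply_le _ _
  rw [shift_apply] at h3 ⊢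
  simp only at h3
  have h4 := norm_add_le q.2.2.2.1 (q.2.2.2.2 • Lᗮ.orthogonalProjectionOnto a)
  have h5 : ‖q.2.2.2.2 • Lᗮ.orthogonalProjectionOnto a‖ ≤ |q.2.2.2.2| * ‖a‖ := by
    rw [norm_smul, Real.norm_eq_abs]
    gcongr
  have h6 := mul_le_mul_of_nonneg_right h2 (norm_nonneg a)
  linarith

theorem shift_mem_cone (a : E n) {q : E n × BlowupAmbient L} (hq : q.2 ∈ cone L) :
    (shift a q).2 ∈ cone L := by
  have h := hq.2.trans_le (normalNorm_le_shift a q)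
  refine ⟨?_, pos_of_mul_pos_right h (by positivity)⟩
  rw [shift_apply]
  exact hq.1

end Shift

/-! ### Decay of the translated Fourier coefficients -/

section LeftTerm

open UnitAddTorus

theorem summable_weight {ι : Type} [Fintype ι] {M : ℕ} (hM : 2 * Fintype.card ι ≤ M) :
    Summable fun κ : ι → ℤ => (weight κ ^ M)⁻¹ := by
  classical
  have h1 : Summable fun j : ℤ => ((1 + |(j : ℝ)|) ^ 2)⁻¹ := by
    have h2 : Summable fun j : ℕ => ((1 + (j : ℝ)) ^ 2)⁻¹ := by
      have := (summable_nat_add_iff 1).2 (Real.summable_nat_pow_inv.2 one_lt_two)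
      refine this.congr fun j => ?_
      push_cast
      rw [add_comm]
    refine Summable.of_nat_of_neg ?_ ?_ <;> simpa using h2
  set S := ∑' j : ℤ, ((1 + |(j : ℝ)|) ^ 2)⁻¹ with hS
  refine summable_of_sum_le (c := ∏ _i : ι, S)
    (fun κ => inv_nonneg.2 (pow_nonneg (weight_pos κ).le M)) fun u => ?_
  have hle : ∀ κ : ι → ℤ, (weight κ ^ M)⁻¹ ≤ ∏ i, ((1 + |(κ i : ℝ)|) ^ 2)⁻¹ := by
    intro κ
    rw [Finset.prod_inv_distrib]
    refine inv_anti₀ (Finset.prod_pos fun i _ => by positivity) ?_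
    calc ∏ i, (1 + |(κ i : ℝ)|) ^ 2 ≤ ∏ _i : ι, weight κ ^ 2 := by
          refine Finset.prod_le_prod (fun i _ => by positivity) fun i _ => ?_
          gcongr
          rw [weight, ← Int.norm_eq_abs]
          gcongr
          exact norm_le_pi_norm κ i
      _ = weight κ ^ (2 * Fintype.card ι) := by
          rw [Finset.prod_const, Finset.card_univ, pow_mul]
      _ ≤ weight κ ^ M := pow_le_pow_right₀ (one_le_weight κ) hM
  let V : ι → Finset ℤ := fun i => u.image fun κ => κ i
  have hsub : u ⊆ Fintype.piFinset V := fun κ hκ =>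
    Fintype.mem_piFinset.2 fun i => Finset.mem_image_of_mem _ hκ
  calc ∑ κ ∈ u, (weight κ ^ M)⁻¹ ≤ ∑ κ ∈ u, ∏ i, ((1 + |(κ i : ℝ)|) ^ 2)⁻¹ :=
        Finset.sum_le_sum fun κ _ => hle κ
    _ ≤ ∑ κ ∈ Fintype.piFinset V, ∏ i, ((1 + |(κ i : ℝ)|) ^ 2)⁻¹ :=
        Finset.sum_le_sum_of_subset_of_nonneg hsub fun κ _ _ =>
          Finset.prod_nonneg fun i _ => by positivity
    _ = ∏ i, ∑ j ∈ V i, ((1 + |(j : ℝ)|) ^ 2)⁻¹ :=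
        (Finset.prod_univ_sum V fun _ (j : ℤ) => ((1 + |(j : ℝ)|) ^ 2)⁻¹).symm
    _ ≤ ∏ _i : ι, S := by
        refine Finset.prod_le_prod (fun i _ => Finset.sum_nonneg fun j _ => by positivity)
          fun i _ => ?_
        exact h1.sum_le_tsum _ fun j _ => by positivity

variable {n d : ℕ} {v : Fin d → E n}

/-- The translation vector `2π m` attached to the index `κ = (k, m)`. -/
def shiftVec (κ : Fin n ⊕ Fin n → ℤ) : E n := (2 * Real.pi) • intVec fun i => κ (Sum.inr i)

theorem exists_shiftVec_bound (n : ℕ) :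
    ∃ B ≥ 2, ∀ κ : Fin n ⊕ Fin n → ℤ, 2 + ‖shiftVec κ‖ ≤ B * weight κ := by
  have hn : 0 ≤ 2 * Real.pi * n := by positivity
  refine ⟨2 + 2 * Real.pi * n, by linarith, fun κ => ?_⟩
  have h1 := norm_intVec_le fun i => κ (Sum.inr i)
  have h2 : ‖fun i => κ (Sum.inr i)‖ ≤ ‖κ‖ :=
    (pi_norm_le_iff_of_nonneg (norm_nonneg _)).2 fun i => norm_le_pi_norm κ (Sum.inr i)
  have h3 : ‖shiftVec κ‖ ≤ 2 * Real.pi * (n * ‖κ‖) := by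
    rw [shiftVec, norm_smul, Real.norm_eq_abs, abs_of_pos (by positivity)]
    gcongr
    exact h1.trans (by gcongr)
  have h4 : 0 ≤ 2 * Real.pi * n := by positivity
  unfold weight
  nlinarith [norm_nonneg κ]

/-- The summand of index `κ` of the left symbol. -/
def leftTerm (s : T n × Stot v → ℂ) (κ : Fin n ⊕ Fin n → ℤ)
    (q : E n × BlowupAmbient (coisotropicFibre v)) : ℂ :=
  amplitudeCoef s κ (shift (shiftVec κ) q)

theorem contDiffOn_leftTerm {s : T n × Stot v → ℂ} (hs : IsCcSmoothAmplitude s)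
    (κ : Fin n ⊕ Fin n → ℤ) : ContDiffOn ℝ ∞ (leftTerm s κ) (univ ×ˢ cone _) :=
  (contDiffOn_amplitudeCoef hs κ).comp (contDiff_shift (shiftVec κ)).contDiffOn
    fun _ hq => ⟨mem_univ _, shift_mem_cone _ hq.2⟩

/-- The translations grow polynomially in `κ`, with all their derivatives, and the Fourier
coefficients decay rapidly; hence so do the translated coefficients. -/
theorem exists_leftTerm_bound {s : T n × Stot v → ℂ} (hs : IsCcSmoothAmplitude s) (k M : ℕ)
    {q₀ : E n × BlowupAmbient (coisotropicFibre v)} (hq₀ : q₀ ∈ (univ : Set (E n)) ×ˢ cone _) :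
    ∃ ε > 0, ∃ C : ℝ, ∀ κ, ∀ q ∈ (univ ×ˢ cone (coisotropicFibre v)) ∩ Metric.ball q₀ ε,
      ‖iteratedFDerivWithin ℝ k (leftTerm s κ) (univ ×ˢ cone _) q‖ ≤ C * (weight κ ^ M)⁻¹ := by
  have hD := isCornerDomain_cone (coisotropicFibre v)
  set ν₀ := normalNorm q₀.2 with hν₀_def
  have hν₀ : 0 < ν₀ := hq₀.2.2
  have hcont : Continuous fun q : E n × BlowupAmbient (coisotropicFibre v) => normalNorm q.2 :=
    continuous_normalNorm.comp continuous_snd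
  -- near `q₀` the length of the normal vector stays between `ν₀ / 2` and `2 * ν₀`
  obtain ⟨ε, hε, hball⟩ := Metric.mem_nhds_iff.1
    ((hcont.isOpen_preimage _ (isOpen_Ioo (a := ν₀ / 2) (b := 2 * ν₀))).mem_nhds
      (show normalNorm q₀.2 ∈ Ioo (ν₀ / 2) (2 * ν₀) from
        ⟨by rw [← hν₀_def]; linarith, by rw [← hν₀_def]; linarith⟩))
  obtain ⟨B₁, hB₁, hsh⟩ := exists_shift_bound (L := coisotropicFibre v) k
    (isCompact_closedBall q₀ ε)
  obtain ⟨B₂, hB₂, hvec⟩ := exists_shiftVec_bound n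
  -- `k` powers of the weight are lost to the homogeneity, and `k` more to the chain rule
  choose C hC using fun i : ℕ => exists_amplitudeCoef_bound hs (2 * k + M) i
    (isCompact_closedBall q₀.1 ε)
  set C' := ∑ i ∈ Finset.range (k + 1), |C i| with hC'
  set c := 1 + B₂ * (2 * ν₀) + B₂ * (2 / ν₀) with hc
  have hc1 : 1 ≤ c := by
    have : 0 ≤ B₂ * (2 * ν₀) + B₂ * (2 / ν₀) := by positivity
    linarith
  refine ⟨ε, hε, (k.factorial : ℝ) * (C' * c ^ k) * (B₁ * B₂) ^ k, fun κ q hq => ?_⟩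
  have hw := weight_pos κ
  have hw1 := one_le_weight κ
  have hν := hball hq.2
  have hνl : ν₀ / 2 < normalNorm q.2 := hν.1
  have hνu : normalNorm q.2 < 2 * ν₀ := hν.2
  have hνp : 0 < normalNorm q.2 := hq.1.2.2
  set q' := shift (shiftVec κ) q with hq'
  have hq'D : q'.2 ∈ cone (coisotropicFibre v) := shift_mem_cone _ hq.1.2
  have hν'p : 0 < normalNorm q'.2 := hq'D.2
  have hup : normalNorm q'.2 ≤ B₂ * weight κ * (2 * ν₀) :=
    (normalNorm_shift_le _ q).trans (mul_le_mul (hvec κ) hνu.le hνp.le (by positivity))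
  have hlow : (normalNorm q'.2)⁻¹ ≤ B₂ * weight κ * (2 / ν₀) := by
    have h1 := normalNorm_le_shift (shiftVec κ) q
    have h2 : ν₀ / 2 ≤ B₂ * weight κ * normalNorm q'.2 :=
      hνl.le.trans (h1.trans (mul_le_mul_of_nonneg_right (hvec κ) hν'p.le))
    rw [inv_le_iff_one_le_mul₀ hν'p]
    have h3 : 1 = ν₀ / 2 * (2 / ν₀) := by field_simp
    rw [h3, mul_right_comm]
    gcongr
  have hsum : 1 + normalNorm q'.2 + (normalNorm q'.2)⁻¹ ≤ c * weight κ := by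
    rw [hc]
    nlinarith
  have hq'X : q' ∈ Metric.closedBall q₀.1 ε ×ˢ cone (coisotropicFibre v) := by
    refine ⟨?_, hq'D⟩
    rw [hq', shift_apply]
    have h1 := Metric.mem_ball.1 hq.2
    exact Metric.mem_closedBall.2 ((le_max_left _ _).trans
      ((Prod.dist_eq (x := q) (y := q₀)).symm.le.trans h1.le))
  have hcoef : ∀ i ≤ k, ‖iteratedFDerivWithin ℝ i (amplitudeCoef s κ) (univ ×ˢ cone _) q'‖ ≤
      C' * c ^ k * (weight κ ^ (k + M))⁻¹ := by
    intro i hi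
    have h1 := hC i κ q' hq'X
    have h2 : C i ≤ C' := (le_abs_self _).trans
      (Finset.single_le_sum (f := fun i => |C i|) (fun i _ => abs_nonneg _)
        (Finset.mem_range.2 (Nat.lt_succ_of_le hi)))
    have h3 : (1 + normalNorm q'.2 + (normalNorm q'.2)⁻¹) ^ i ≤ (c * weight κ) ^ k :=
      (pow_le_pow_left₀ (by positivity) hsum i).trans
        (pow_le_pow_right₀ (one_le_mul_of_one_le_of_one_le hc1 hw1) hi)
    have hC'0 : 0 ≤ C' := Finset.sum_nonneg fun i _ => abs_nonneg _
    have h4 : weight κ ^ (2 * k + M) *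
        ‖iteratedFDerivWithin ℝ i (amplitudeCoef s κ) (univ ×ˢ cone _) q'‖ ≤
          C' * (c * weight κ) ^ k :=
      h1.trans (mul_le_mul h2 h3 (by positivity) hC'0)
    rw [← div_eq_mul_inv, le_div_iff₀ (by positivity)]
    have h5 : weight κ ^ (2 * k + M) = weight κ ^ k * weight κ ^ (k + M) := by
      rw [← pow_add]
      congr 1
      ring
    rw [h5, mul_pow, mul_assoc, mul_left_comm C', mul_left_comm (c ^ k), mul_comm (c ^ k),
      ← mul_assoc C', mul_comm (C')] at h4
    have h6 := le_of_mul_le_mul_left (a := weight κ ^ k)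
      (b := weight κ ^ (k + M) *
        ‖iteratedFDerivWithin ℝ i (amplitudeCoef s κ) (univ ×ˢ cone _) q'‖)
      (c := C' * c ^ k) (by linarith) (by positivity)
    linarith
  have hderiv : ∀ i, 1 ≤ i → i ≤ k →
      ‖iteratedFDerivWithin ℝ i (shift (shiftVec κ)) (univ ×ˢ cone (coisotropicFibre v)) q‖ ≤
        (B₁ * B₂ * weight κ) ^ i := by
    intro i h1 hi
    have hi' : (i : WithTop ℕ∞) ≤ ∞ := by exact_mod_cast le_top
    rw [iteratedFDerivWithin_eq_iteratedFDeriv hD.uniqueDiffOn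
      ((contDiff_shift _).of_le hi').contDiffAt hq.1]
    refine (hsh (shiftVec κ) q (Metric.ball_subset_closedBall hq.2) i hi).trans ?_
    have h2 : B₁ * (1 + ‖shiftVec κ‖) ≤ B₁ * B₂ * weight κ := by
      rw [mul_assoc]
      have := hvec κ
      gcongr
      linarith
    refine h2.trans (le_self_pow₀ ?_ (by omega))
    exact one_le_mul_of_one_le_of_one_le
      (one_le_mul_of_one_le_of_one_le hB₁ (by linarith)) hw1
  have hmain := norm_iteratedFDerivWithin_comp_le (contDiffOn_amplitudeCoef hs κ)
    (contDiff_shift (shiftVec κ)).contDiffOn (n := k) (by exact_mod_cast le_top)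
    hD.uniqueDiffOn hD.uniqueDiffOn
    (fun _ hq => ⟨mem_univ _, shift_mem_cone _ hq.2⟩) hq.1 hcoef hderiv
  refine hmain.trans (le_of_eq ?_)
  rw [mul_pow, pow_add, mul_inv]
  field_simp

theorem contDiffOn_tsum_leftTerm {s : T n × Stot v → ℂ} (hs : IsCcSmoothAmplitude s) :
    ContDiffOn ℝ ∞ (fun q => ∑' κ, leftTerm s κ q) (univ ×ˢ cone _) := by
  refine contDiffOn_tsum (isCornerDomain_cone _) (fun κ => contDiffOn_leftTerm hs κ) ?_
  intro k q hq
  obtain ⟨ε, hε, C, hC⟩ := exists_leftTerm_bound hs k (2 * Fintype.card (Fin n ⊕ Fin n)) hq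
  exact ⟨ε, hε, _, (summable_weight le_rfl).mul_left C, hC⟩

end LeftTerm

/-! ### The left symbol -/

section LeftSymbol

open UnitAddTorus

theorem hasSum_fourierCoef {ι : Type} [Fintype ι] {f : UnitAddTorus ι → ℂ} (hf : Continuous f)
    (hs : Summable (fourierCoef f)) (t : UnitAddTorus ι) :
    HasSum (fun κ => fourierCoef f κ * mFourier κ t) (f t) :=
  hasSum_mFourier_series_apply_of_summable (f := ⟨f, hf⟩) hs t

theorem summable_of_weight_bound {ι : Type} [Fintype ι] {c : (ι → ℤ) → ℂ} {C : ℝ}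
    (h : ∀ κ, weight κ ^ (2 * Fintype.card ι) * ‖c κ‖ ≤ C) : Summable c := by
  refine Summable.of_norm_bounded ((summable_weight le_rfl).mul_left C) fun κ => ?_
  rw [← div_eq_mul_inv, le_div_iff₀ (pow_pos (weight_pos κ) _), mul_comm]
  exact h κ

variable {n d : ℕ} {v : Fin d → E n}

/-- The point of the cone over the blowup which lies over `(ξ, h)` and has `r = 1`. -/
def conePoint (v : Fin d → E n) (ξ : E n) (h : ℝ) : E n × BlowupAmbient (coisotropicFibre v) :=
  (0, 1, (coisotropicFibre v).orthogonalProjectionOnto ξ,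
    (coisotropicFibre v)ᗮ.orthogonalProjectionOnto ξ, h)

theorem conePoint_mem (ξ : E n) (h : Param) :
    (conePoint v ξ h).2 ∈ cone (coisotropicFibre v) :=
  ⟨⟨zero_le_one, h.2.1.le⟩, radius_pos _ ξ h.2.1⟩

/-- The Fourier coefficient of index `κ` of `s(⬝, ⬝, ξ; h)`. -/
def symbolCoef (s : T n × Stot v → ℂ) (κ : Fin n ⊕ Fin n → ℤ) (ξ : E n) (h : ℝ) : ℂ :=
  amplitudeCoef s κ (conePoint v ξ h)

theorem exists_symbolCoef_bound {s : T n × Stot v → ℂ} (hs : IsCcSmoothAmplitude s) (N : ℕ) :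
    ∃ C : ℝ, ∀ κ ξ, ∀ h : Param, weight κ ^ N * ‖symbolCoef s κ ξ h‖ ≤ C := by
  obtain ⟨C, hC⟩ := exists_amplitudeCoef_bound hs N 0 (isCompact_singleton (x := (0 : E n)))
  refine ⟨C, fun κ ξ h => ?_⟩
  simpa [symbolCoef] using hC κ (conePoint v ξ h) ⟨rfl, conePoint_mem ξ h⟩

theorem continuous_symbolCoef {s : T n × Stot v → ℂ} (hs : IsCcSmoothAmplitude s)
    (κ : Fin n ⊕ Fin n → ℤ) (h : Param) : Continuous fun ξ => symbolCoef s κ ξ h := by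
  have h1 : Continuous fun ξ : E n => conePoint v ξ h := by
    unfold conePoint
    fun_prop
  exact (contDiffOn_amplitudeCoef hs κ).continuousOn.comp_continuous h1
    fun ξ => ⟨mem_univ _, conePoint_mem ξ h⟩

theorem norm_le_of_projection (L : Submodule ℝ (E n)) (ξ : E n) :
    ‖ξ‖ ≤ ‖L.orthogonalProjectionOnto ξ‖ + ‖Lᗮ.orthogonalProjectionOnto ξ‖ := by
  have h : (L.orthogonalProjectionOnto ξ : E n) + Lᗮ.orthogonalProjectionOnto ξ = ξ :=
    Submodule.starProjection_add_starProjection_orthogonal ξ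
  calc ‖ξ‖ = ‖(L.orthogonalProjectionOnto ξ : E n) + Lᗮ.orthogonalProjectionOnto ξ‖ := by rw [h]
    _ ≤ _ := norm_add_le _ _

theorem SupportBound.symbolCoef_eq_zero {s : T n × Stot v → ℂ} {R δ : ℝ}
    (hs : SupportBound s R δ) (κ : Fin n ⊕ Fin n → ℤ) {ξ : E n} (h : Param) (hξ : 2 * R < ‖ξ‖) :
    symbolCoef s κ ξ h = 0 := by
  refine hs.amplitudeCoef_eq_zero (conePoint_mem ξ h) ?_ κ
  have h1 := norm_le_of_projection (coisotropicFibre v) ξ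
  have h2 := norm_fst_le_normalNorm (conePoint v ξ h).2
  by_contra hcon
  push Not at hcon
  have h3 := hcon.1
  have h4 := hcon.2.1
  simp only [conePoint, one_mul] at h2 h3 h4
  linarith

theorem hasSum_symbolCoef {s : T n × Stot v → ℂ} (hs : IsCcSmoothAmplitude s) (x y : T n)
    (ξ : E n) (h : Param) :
    HasSum (fun κ => symbolCoef s κ ξ h *
      (mFourier (fun i => κ (Sum.inl i)) x * mFourier (fun i => κ (Sum.inr i)) y))
      (amplitude s x y ξ h) := by
  obtain ⟨C, hC⟩ := exists_symbolCoef_bound hs (2 * Fintype.card (Fin n ⊕ Fin n))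
  have h1 := hasSum_fourierCoef (f := fun t => amplitudeFamily s t (conePoint v ξ h))
    ((isSmoothFamily_amplitudeFamily hs).continuous ⟨mem_univ _, conePoint_mem ξ h⟩)
    (summable_of_weight_bound fun κ => hC κ ξ h) (Sum.elim x y)
  have h2 : amplitudeFamily s (Sum.elim x y) (conePoint v ξ h) = amplitude s x y ξ h := by
    have h0 : toTorus (0 : E n) = 0 := by
      funext i
      simp [toTorus]
    simp only [amplitudeFamily, conePoint, h0, zero_add, Sum.elim_inl, Sum.elim_inr]
    exact homogenization_lift s x y ξ h
  rw [← h2]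
  refine h1.congr_fun fun κ => ?_
  simp [mFourier, Fintype.prod_sum_type, symbolCoef, amplitudeCoef]

/-- The left symbol of the operator with amplitude `s`, cut off by `η`, as a function on the blowup:
the summands of the Fourier series of `s` are restricted to the diagonal and translated by `2πhm`
in the fibres, through the cone over the blowup. -/
def leftSymbol (η : E n → ℝ) (s : T n × Stot v → ℂ) (z : Stot v) : ℂ :=
  (η (blowdown z.2).1 : ℂ) * ∑' κ : Fin n ⊕ Fin n → ℤ,
    mFourier (fun i => κ (Sum.inl i)) z.1 * mFourier (fun i => κ (Sum.inr i)) z.1 *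
      amplitudeCoef s κ (shift (shiftVec κ) (0, (z.2 : BlowupAmbient (coisotropicFibre v))))

/-- Periodicity in `x` is explicit in this form of the summand. -/
theorem leftTerm_apply (s : T n × Stot v → ℂ) (κ : Fin n ⊕ Fin n → ℤ) (x : E n)
    (p : BlowupAmbient (coisotropicFibre v)) :
    leftTerm s κ (x, p) =
      mFourier (fun i => κ (Sum.inl i)) (toTorus x) *
        mFourier (fun i => κ (Sum.inr i)) (toTorus x) *
        amplitudeCoef s κ (shift (shiftVec κ) (0, p)) := by
  rw [leftTerm, shift_apply, shift_apply, amplitudeCoef_eq_mul]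

/-- Over the interior the left symbol is the usual one: by invariance under dilations, the lifted
translation may be followed by a normalization. -/
theorem leftSymbol_lift (η : E n → ℝ) (s : T n × Stot v → ℂ) (x : T n) (ξ : E n) (h : Param) :
    leftSymbol η s (x, blowupLift (coisotropicFibre v) ξ h) =
      (η ξ : ℂ) * ∑' κ : Fin n ⊕ Fin n → ℤ,
        mFourier (fun i => κ (Sum.inl i)) x * mFourier (fun i => κ (Sum.inr i)) x *
          symbolCoef s κ (ξ + (h : ℝ) • shiftVec κ) h := by
  rw [leftSymbol]
  simp only
  rw [blowdown_blowupLift]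
  congr 1
  refine tsum_congr fun κ => ?_
  congr 1
  have hr := radius_pos (coisotropicFibre v) ξ h.2.1
  rw [symbolCoef, ← amplitudeCoef_dilation s κ _ hr]
  congr 1
  rw [dilation_apply, shift_apply]
  simp only [blowupLift, conePoint, map_add, map_smul]
  have h1 : radius (coisotropicFibre v) ξ h * ((h : ℝ) / radius (coisotropicFibre v) ξ h) = h :=
    mul_div_cancel₀ _ hr.ne'
  refine Prod.ext rfl (Prod.ext ?_ (Prod.ext ?_ (Prod.ext ?_ ?_)))
  · exact inv_mul_cancel₀ hr.ne'
  · simp only [h1]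
  · simp only [smul_add, smul_smul, h1, mul_inv_cancel₀ hr.ne', one_smul]
  · exact h1

theorem isCompact_truncatedBlowup (L : Submodule ℝ (E n)) {δ : ℝ} (hδ : δ < 1) (ρ : ℝ) :
    IsCompact {p : Blowup L | ‖(blowdown p).1‖ ≤ ρ ∧ p.1.1 * p.1.2.2.2 ≤ δ} := by
  rw [Subtype.isCompact_iff]
  have himage : ((↑) : Blowup L → BlowupAmbient L) ''
      {p : Blowup L | ‖(blowdown p).1‖ ≤ ρ ∧ p.1.1 * p.1.2.2.2 ≤ δ} =
      {p : BlowupAmbient L | (0 ≤ p.1 ∧ 0 ≤ p.2.2.2 ∧ ‖p.2.2.1‖ ^ 2 + p.2.2.2 ^ 2 = 1) ∧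
        ‖(p.2.1 : E n) + p.1 • (p.2.2.1 : E n)‖ ≤ ρ ∧ p.1 * p.2.2.2 ≤ δ} := by
    ext p
    constructor
    · rintro ⟨⟨p, h1, h2, h3, h4⟩, h5, rfl⟩
      exact ⟨⟨h1, h2, h3⟩, h5⟩
    · rintro ⟨⟨h1, h2, h3⟩, h5⟩
      exact ⟨⟨p, h1, h2, h3, h5.2.trans_lt hδ⟩, h5, rfl⟩
  rw [himage]
  refine (((isCompact_Icc (a := (0 : ℝ)) (b := ρ + 1)).prod
    ((isCompact_closedBall (0 : L) ρ).prod
    ((isCompact_closedBall (0 : Lᗮ) 1).prod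
      (isCompact_Icc (a := (0 : ℝ)) (b := 1)))))).of_isClosed_subset ?_ ?_
  · have h1 : IsClosed {p : BlowupAmbient L | 0 ≤ p.1} :=
      isClosed_le continuous_const (by fun_prop)
    have h2 : IsClosed {p : BlowupAmbient L | 0 ≤ p.2.2.2} :=
      isClosed_le continuous_const (by fun_prop)
    have h3 : IsClosed {p : BlowupAmbient L | ‖p.2.2.1‖ ^ 2 + p.2.2.2 ^ 2 = 1} :=
      isClosed_eq (by fun_prop) continuous_const
    have h4 : IsClosed {p : BlowupAmbient L | ‖(p.2.1 : E n) + p.1 • (p.2.2.1 : E n)‖ ≤ ρ} :=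
      isClosed_le (by fun_prop) continuous_const
    have h5 : IsClosed {p : BlowupAmbient L | p.1 * p.2.2.2 ≤ δ} :=
      isClosed_le (by fun_prop) continuous_const
    exact (h1.inter (h2.inter h3)).inter (h4.inter h5)
  · rintro p ⟨⟨h1, h2, h3⟩, h4, h5⟩
    have hθ : p.2.2.2 ≤ 1 := by nlinarith [sq_nonneg ‖p.2.2.1‖]
    have hω : ‖p.2.2.1‖ ≤ 1 := by nlinarith [sq_nonneg p.2.2.2, norm_nonneg p.2.2.1]
    have horth : inner ℝ (p.2.1 : E n) (p.1 • (p.2.2.1 : E n)) = 0 := by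
      rw [inner_smul_right, Submodule.inner_right_of_mem_orthogonal p.2.1.2 p.2.2.1.2, mul_zero]
    have hpyth := norm_add_sq_eq_norm_sq_add_norm_sq_of_inner_eq_zero _ _ horth
    have hρ : 0 ≤ ρ := (norm_nonneg _).trans h4
    have hsq : ‖(p.2.1 : E n) + p.1 • (p.2.2.1 : E n)‖ *
      ‖(p.2.1 : E n) + p.1 • (p.2.2.1 : E n)‖ ≤ ρ * ρ := by gcongr
    have hw : ‖p.2.1‖ ≤ ρ := by
      have h6 : ‖(p.2.1 : E n)‖ = ‖p.2.1‖ := rfl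
      rw [h6] at hpyth
      nlinarith [norm_nonneg p.2.1, mul_self_nonneg ‖p.1 • (p.2.2.1 : E n)‖]
    have hr : p.1 ≤ ρ + 1 := by
      have h6 : ‖p.1 • (p.2.2.1 : E n)‖ = p.1 * ‖p.2.2.1‖ := by
        rw [norm_smul, Real.norm_eq_abs, abs_of_nonneg h1]
        rfl
      rw [h6] at hpyth
      have h7 : p.1 ^ 2 = (p.1 * ‖p.2.2.1‖) * (p.1 * ‖p.2.2.1‖) +
          (p.1 * p.2.2.2) * (p.1 * p.2.2.2) := by
        rw [show (p.1 * ‖p.2.2.1‖) * (p.1 * ‖p.2.2.1‖) + (p.1 * p.2.2.2) * (p.1 * p.2.2.2) =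
          p.1 ^ 2 * (‖p.2.2.1‖ ^ 2 + p.2.2.2 ^ 2) by ring, h3, mul_one]
      have h8 : 0 ≤ p.1 * p.2.2.2 := mul_nonneg h1 h2
      have h9 : (p.1 * p.2.2.2) * (p.1 * p.2.2.2) ≤ 1 := by nlinarith
      have h10 : p.1 ^ 2 ≤ (ρ + 1) ^ 2 := by
        nlinarith [mul_self_nonneg ‖(p.2.1 : E n)‖]
      exact abs_le_of_sq_le_sq' h10 (by positivity) |>.2
    exact ⟨⟨h1, hr⟩, by simpa using hw, by simpa using hω, h2, hθ⟩

theorem isCcSmooth_leftSymbol {s : T n × Stot v → ℂ} (hs : IsCcSmoothAmplitude s) {η : E n → ℝ}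
    (hη : ContDiff ℝ ∞ η) {ρ : ℝ} (hρ : ∀ ξ, ρ < ‖ξ‖ → η ξ = 0) :
    IsCcSmooth (leftSymbol η s) where
  smooth := by
    refine ⟨fun q => (η ((q.2.2.1 : E n) + q.2.1 • (q.2.2.2.1 : E n)) : ℂ) *
      ∑' κ, leftTerm s κ q, ?_, ?_⟩
    · have h1 : ContDiff ℝ ∞ fun q : E n × BlowupAmbient (coisotropicFibre v) =>
          (q.2.2.1 : E n) + q.2.1 • (q.2.2.2.1 : E n) := by
        have h2 : ContDiff ℝ ∞ fun q : E n × BlowupAmbient (coisotropicFibre v) =>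
            (q.2.2.1 : E n) :=
          (coisotropicFibre v).subtypeL.contDiff.comp (by fun_prop)
        have h3 : ContDiff ℝ ∞ fun q : E n × BlowupAmbient (coisotropicFibre v) =>
            (q.2.2.2.1 : E n) :=
          (coisotropicFibre v)ᗮ.subtypeL.contDiff.comp (by fun_prop)
        fun_prop
      refine ContDiffOn.mul (Complex.ofRealCLM.contDiff.comp (hη.comp h1)).contDiffOn
        ((contDiffOn_tsum_leftTerm hs).mono ?_)
      exact prod_mono_right fun p hp => mem_cone_of_mem hp
    · intro x p
      simp only [leftTerm_apply, leftSymbol, blowdown]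
  compact := by
    obtain ⟨R, δ, hb⟩ := exists_supportBound hs
    refine HasCompactSupport.intro (isCompact_univ.prod
      (isCompact_truncatedBlowup (coisotropicFibre v) hb.lt_one ρ)) ?_
    rintro ⟨x, p⟩ hp
    have hp' : ρ < ‖(blowdown p).1‖ ∨ δ < p.1.1 * p.1.2.2.2 := by
      by_contra hcon
      push Not at hcon
      exact hp ⟨mem_univ _, hcon⟩
    rw [leftSymbol]
    rcases hp' with h | h
    · simp only [hρ _ h, Complex.ofReal_zero, zero_mul]
    · have h1 : ∀ κ, amplitudeCoef s κ
          (shift (shiftVec κ) (0, (p : BlowupAmbient (coisotropicFibre v)))) = 0 := fun κ =>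
        hb.amplitudeCoef_eq_zero (shift_mem_cone _ (mem_cone_of_mem p.2))
          (Or.inr (Or.inr (by rw [shift_apply]; exact h))) κ
      simp [h1]

end LeftSymbol

/-! ### Operators given by absolutely convergent series of exponentials -/

section SeriesOp

open UnitAddTorus

variable {n : ℕ}

/-- The exponential `e^{2πi k⬝x}` as an element of `L²(𝕋ⁿ)`. -/
def torusExp (k : Fin n → ℤ) : L2 n := ContinuousMap.toLp 2 (torusMeasure n) ℂ (mFourier k)

theorem orthonormal_torusExp : Orthonormal ℂ (torusExp (n := n)) :=
  orthonormal_mFourier (d := Fin n)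

theorem norm_torusExp (k : Fin n → ℤ) : ‖torusExp k‖ = 1 := orthonormal_torusExp.1 k

theorem inner_torusExp (k : Fin n → ℤ) (u : L2 n) :
    inner ℂ (torusExp k) u = ∫ y, mFourier (-k) y * u y ∂(torusMeasure n) := by
  rw [L2.inner_def]
  refine integral_congr_ae ?_
  filter_upwards [ContinuousMap.coeFn_toLp (p := 2) (𝕜 := ℂ) (torusMeasure n) (mFourier k)]
    with y hy
  rw [torusExp, hy, RCLike.inner_apply, mFourier_neg, mul_comm]

/-- The operator with Schwartz kernel `∑ⱼ cⱼ e^{2πi (aⱼ⬝x + bⱼ⬝y)}`. It is used for summable `c`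
only. -/
def seriesOp {J : Type} (c : J → ℂ) (a b : J → Fin n → ℤ) : L2 n →L[ℂ] L2 n :=
  ∑' j, c j • InnerProductSpace.rankOne ℂ (torusExp (a j)) (torusExp (-b j))

variable {J : Type} {c : J → ℂ} (a b : J → Fin n → ℤ)

theorem norm_smul_rankOne_torusExp (z : ℂ) (k m : Fin n → ℤ) :
    ‖z • InnerProductSpace.rankOne ℂ (torusExp k) (torusExp m)‖ = ‖z‖ := by
  rw [norm_smul, InnerProductSpace.norm_rankOne, norm_torusExp, norm_torusExp, mul_one, mul_one]

theorem hasSum_seriesOp (hc : Summable fun j => ‖c j‖) :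
    HasSum (fun j => c j • InnerProductSpace.rankOne ℂ (torusExp (a j)) (torusExp (-b j)))
      (seriesOp c a b) :=
  (Summable.of_norm (by simpa only [norm_smul_rankOne_torusExp] using hc)).hasSum

theorem norm_seriesOp_le_tsum (hc : Summable fun j => ‖c j‖) :
    ‖seriesOp c a b‖ ≤ ∑' j, ‖c j‖ := by
  have h := norm_tsum_le_tsum_norm
    (f := fun j => c j • InnerProductSpace.rankOne ℂ (torusExp (a j)) (torusExp (-b j)))
    (by simpa only [norm_smul_rankOne_torusExp] using hc)
  simpa only [norm_smul_rankOne_torusExp, seriesOp] using h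

theorem hasSum_seriesOp_apply (hc : Summable fun j => ‖c j‖) (u : L2 n) :
    HasSum (fun j => (c j * inner ℂ (torusExp (-b j)) u) • torusExp (a j)) (seriesOp c a b u) := by
  have h := (hasSum_seriesOp a b hc).mapL (ContinuousLinearMap.apply ℂ (L2 n) u)
  refine h.congr_fun fun j => ?_
  simp [InnerProductSpace.rankOne_apply, smul_smul]

theorem hasSum_inner_seriesOp (hc : Summable fun j => ‖c j‖) (w u : L2 n) :
    HasSum (fun j => c j * inner ℂ (torusExp (-b j)) u * inner ℂ w (torusExp (a j)))
      (inner ℂ w (seriesOp c a b u)) := by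
  have h := (hasSum_seriesOp_apply a b hc u).mapL (innerSL ℂ w)
  refine h.congr_fun fun j => ?_
  simp

/-- The operator `seriesOp c a b` is the integral operator with the kernel given by the series. -/
theorem seriesOp_kernel [Countable J] (hc : Summable fun j => ‖c j‖) {K : T n → T n → ℂ}
    (hK : ∀ x y, HasSum (fun j => c j * (mFourier (a j) x * mFourier (b j) y)) (K x y)) (u : L2 n) :
    ∀ᵐ x ∂(torusMeasure n), Integrable (fun y => K x y * u y) (torusMeasure n) ∧
      seriesOp c a b u x = ∫ y, K x y * u y ∂(torusMeasure n) := by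
  have hu : Integrable (fun y => u y) (torusMeasure n) :=
    (Lp.memLp u).integrable one_le_two
  have hterm : ∀ x y j, ‖c j * (mFourier (a j) x * mFourier (b j) y)‖ = ‖c j‖ := fun x y j => by
    rw [norm_mul, norm_mul, norm_mFourier_apply, norm_mFourier_apply, mul_one, mul_one]
  have hKc : ∀ x, Continuous fun y => K x y := fun x => by
    have : (fun y => K x y) = fun y => ∑' j, c j * (mFourier (a j) x * mFourier (b j) y) :=
      funext fun y => (hK x y).tsum_eq.symm
    rw [this]
    exact continuous_tsum (fun j => by fun_prop) hc fun j y => (hterm x y j).le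
  have hcoef : ∀ j, ‖inner ℂ (torusExp (-b j)) u‖ ≤ ‖u‖ := fun j => by
    simpa [norm_torusExp] using norm_inner_le_norm (𝕜 := ℂ) (torusExp (-b j)) u
  have hsum : Summable fun j => (c j * inner ℂ (torusExp (-b j)) u) • mFourier (a j) := by
    refine Summable.of_norm_bounded (hc.mul_right ‖u‖) fun j => ?_
    rw [norm_smul, mFourier_norm, mul_one, norm_mul]
    gcongr
    exact hcoef j
  set g : C(T n, ℂ) := ∑' j, (c j * inner ℂ (torusExp (-b j)) u) • mFourier (a j) with hg
  have h1 : seriesOp c a b u = ContinuousMap.toLp 2 (torusMeasure n) ℂ g := by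
    have h2 := hsum.hasSum.mapL (ContinuousMap.toLp 2 (torusMeasure n) ℂ)
    refine (hasSum_seriesOp_apply a b hc u).unique (h2.congr_fun fun j => ?_)
    simp [torusExp]
  have h3 := ContinuousMap.coeFn_toLp (p := 2) (𝕜 := ℂ) (torusMeasure n) g
  rw [h1]
  filter_upwards [h3] with x hx
  refine ⟨hu.bdd_mul (c := ∑' j, ‖c j‖) (hKc x).aestronglyMeasurable
    (Filter.Eventually.of_forall fun y => ?_), ?_⟩
  · rw [← (hK x y).tsum_eq]
    refine (norm_tsum_le_tsum_norm (by simpa only [hterm] using hc)).trans_eq ?_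
    simp only [hterm]
  · rw [hx]
    have hgx : HasSum (fun j => (c j * inner ℂ (torusExp (-b j)) u) * mFourier (a j) x) (g x) := by
      have := hsum.hasSum.mapL (ContinuousMap.evalCLM ℂ x)
      refine this.congr_fun fun j => ?_
      simp
    have hint := hasSum_integral_of_summable_integral_norm (μ := torusMeasure n)
      (F := fun j y => c j * (mFourier (a j) x * mFourier (b j) y) * u y)
      (fun j => hu.bdd_mul (c := ‖c j‖) (by fun_prop : Continuous fun y =>
          c j * (mFourier (a j) x * mFourier (b j) y)).aestronglyMeasurable
        (Filter.Eventually.of_forall fun y => (hterm x y j).le)) (by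
        simp only [norm_mul _ (u _), hterm, integral_const_mul]
        exact hc.mul_right _)
    refine hgx.unique ?_
    have hKu : (fun y => K x y * u y) = fun y => ∑' j,
        c j * (mFourier (a j) x * mFourier (b j) y) * u y :=
      funext fun y => ((hK x y).mul_right (u y)).tsum_eq.symm
    rw [hKu]
    refine hint.congr_fun fun j => ?_
    rw [inner_torusExp, neg_neg, mul_right_comm, ← integral_const_mul]
    refine integral_congr_ae (Filter.Eventually.of_forall fun y => ?_)
    simp only
    ring

theorem sum_norm_inner_mul_le {P : Type} (s : Finset P) {α β : P → Fin n → ℤ}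
    (hα : Function.Injective α) (hβ : Function.Injective β) (w u : L2 n) :
    ∑ p ∈ s, ‖inner ℂ (torusExp (β p)) u‖ * ‖inner ℂ w (torusExp (α p))‖ ≤ ‖u‖ * ‖w‖ := by
  refine (Real.sum_mul_le_sqrt_mul_sqrt s _ _).trans ?_
  have h1 : ∑ p ∈ s, ‖inner ℂ (torusExp (β p)) u‖ ^ 2 ≤ ‖u‖ ^ 2 :=
    (orthonormal_torusExp.comp β hβ).sum_inner_products_le u
  have h2 : ∑ p ∈ s, ‖inner ℂ w (torusExp (α p))‖ ^ 2 ≤ ‖w‖ ^ 2 := by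
    simp only [norm_inner_symm w]
    exact (orthonormal_torusExp.comp α hα).sum_inner_products_le w
  gcongr
  · exact Real.sqrt_le_iff.2 ⟨norm_nonneg _, h1⟩
  · exact Real.sqrt_le_iff.2 ⟨norm_nonneg _, h2⟩

/-- A sum of weighted shifts is bounded by the sum of the suprema of the weights, by Bessel's
inequality. -/
theorem norm_seriesOp_le {I P : Type} [Nonempty P] {c : I × P → ℂ} {a b : I × P → Fin n → ℤ}
    (hc : Summable fun j => ‖c j‖) (ha : ∀ i, Function.Injective fun p => a (i, p))
    (hb : ∀ i, Function.Injective fun p => b (i, p)) {M : I → ℝ} (hM : Summable M)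
    (hcM : ∀ i p, ‖c (i, p)‖ ≤ M i) : ‖seriesOp c a b‖ ≤ ∑' i, M i := by
  have hM0 : ∀ i, 0 ≤ M i := fun i => (norm_nonneg _).trans (hcM i (Classical.arbitrary P))
  have h0 : 0 ≤ ∑' i, M i := tsum_nonneg fun i => hM0 i
  have key : ∀ w u : L2 n, ‖inner ℂ w (seriesOp c a b u)‖ ≤ (∑' i, M i) * (‖u‖ * ‖w‖) := by
    intro w u
    have h1 := hasSum_inner_seriesOp a b hc w u
    have hs : Summable fun j =>
        ‖c j * inner ℂ (torusExp (-b j)) u * inner ℂ w (torusExp (a j))‖ := by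
      refine Summable.of_nonneg_of_le (fun j => norm_nonneg _) (fun j => ?_)
        (hc.mul_right (‖u‖ * ‖w‖))
      rw [norm_mul, norm_mul, mul_assoc]
      have h2 := norm_inner_le_norm (𝕜 := ℂ) (torusExp (-b j)) u
      have h3 := norm_inner_le_norm (𝕜 := ℂ) w (torusExp (a j))
      rw [norm_torusExp, one_mul] at h2
      rw [norm_torusExp, mul_one] at h3
      gcongr
    rw [← h1.tsum_eq]
    refine (norm_tsum_le_tsum_norm hs).trans ?_
    rw [hs.tsum_prod, ← tsum_mul_right]
    refine Summable.tsum_le_tsum (fun i => ?_) hs.prod (hM.mul_right _)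
    refine (hs.prod_factor i).tsum_le_of_sum_le fun s => ?_
    calc _ ≤ ∑ p ∈ s, M i * (‖inner ℂ (torusExp (-b (i, p))) u‖ *
          ‖inner ℂ w (torusExp (a (i, p)))‖) := by
          refine Finset.sum_le_sum fun p _ => ?_
          rw [norm_mul, norm_mul, mul_assoc]
          gcongr
          exact hcM i p
      _ ≤ M i * (‖u‖ * ‖w‖) := by
          rw [← Finset.mul_sum]
          exact mul_le_mul_of_nonneg_left (sum_norm_inner_mul_le s (ha i)
            (β := fun p => -b (i, p)) (fun p q hpq => hb i (neg_injective hpq)) w u) (hM0 i)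
  refine ContinuousLinearMap.opNorm_le_bound _ h0 fun u => ?_
  have h2 := key (seriesOp c a b u) u
  rw [inner_self_eq_norm_sq_to_K, norm_pow, RCLike.norm_ofReal, abs_norm] at h2
  rcases (norm_nonneg (seriesOp c a b u)).eq_or_lt with h3 | h3
  · rw [← h3]
    positivity
  · nlinarith

end SeriesOp

/-! ### The cutoff near the diagonal and the exponential on a fundamental cell -/

section Diagonal

open UnitAddTorus FourierTransform

variable {n : ℕ}

theorem toTorus_torusDiff (x y : T n) : toTorus (torusDiff x y) = x - y := by
  funext i
  exact AddCircle.coe_equivIco (p := (1 : ℝ)) (a := -1 / 2)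

theorem abs_torusDiff (x y : T n) (i : Fin n) : |torusDiff x y i| = ‖x i - y i‖ := by
  have h0 : ((torusDiff x y i : ℝ) : UnitAddCircle) = x i - y i :=
    congrFun (toTorus_torusDiff x y) i
  have h1 := (AddCircle.equivIco (1 : ℝ) (-1 / 2) (x i - y i)).2
  have h2 : torusDiff x y i = (AddCircle.equivIco (1 : ℝ) (-1 / 2) (x i - y i) : ℝ) := rfl
  rw [← h0]
  refine ((AddCircle.norm_coe_eq_abs_iff (1 : ℝ) one_ne_zero).2 ?_).symm
  rw [abs_one, h2, abs_le]
  exact ⟨by linarith [h1.1], by linarith [h1.2]⟩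

theorem torusDiff_eq_sub (x y : T n) : torusDiff x y = torusDiff (x - y) 0 := by
  unfold torusDiff
  simp only [Pi.sub_apply, Pi.zero_apply, sub_zero]

theorem torusDiff_toTorus {z : E n} (hz : ∀ i, |z i| < 1 / 2) : torusDiff (toTorus z) 0 = z := by
  refine PiLp.ext fun i => ?_
  have h1 := abs_lt.1 (hz i)
  have h2 : torusDiff (toTorus z) 0 i =
      (AddCircle.equivIco (1 : ℝ) (-1 / 2) (((z i : ℝ) : UnitAddCircle) - 0) : ℝ) := rfl
  rw [h2, sub_zero]
  exact AddCircle.equivIco_coe_of_mem ⟨by linarith, by linarith⟩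

theorem continuousAt_torusDiff {Z : T n} (hZ : ∀ i, ‖Z i‖ < 1 / 2) :
    ContinuousAt (fun Z : T n => torusDiff Z 0) Z := by
  have h1 : ∀ i, ContinuousAt
      (fun Z : T n => (AddCircle.equivIco (1 : ℝ) (-1 / 2) (Z i - 0) : ℝ)) Z := by
    intro i
    simp only [sub_zero]
    have h2 : Z i ≠ ((-1 / 2 : ℝ) : UnitAddCircle) := by
      intro h3
      have h4 := hZ i
      rw [h3, (AddCircle.norm_coe_eq_abs_iff (1 : ℝ) one_ne_zero).2 (by norm_num [abs_div])] at h4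
      norm_num [abs_div] at h4
    exact continuous_subtype_val.continuousAt.comp
      (ContinuousAt.comp (f := fun Z : T n => Z i) (AddCircle.continuousAt_equivIco 1 (-1 / 2) h2)
        (continuous_apply i).continuousAt)
  exact (PiLp.continuous_toLp 2 _).continuousAt.comp (continuousAt_pi.2 h1)

/-- A bump function on `ℝⁿ` that is supported in the open unit cell centred at the origin. -/
structure CellBump (ρ : ℝ) (ψ : E n → ℝ) : Prop where
  smooth : ContDiff ℝ ∞ ψ
  eq_one : ∀ z, (∀ i, |z i| ≤ ρ) → ψ z = 1
  exists_eq_zero : ∃ r < 1 / 2, ∀ z, (∃ i, r < |z i|) → ψ z = 0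

/-- A product of bump functions of one variable. -/
theorem exists_cellBump {ρ : ℝ} (h0 : 0 < ρ) (hρ : ρ < 1 / 2) : ∃ ψ : E n → ℝ, CellBump ρ ψ := by
  let f : ContDiffBump (0 : ℝ) := ⟨ρ, (ρ + 1 / 2) / 2, h0, by linarith⟩
  refine ⟨fun z => ∏ i, f (z i), ?_, fun z hz => ?_, (ρ + 1 / 2) / 2, by linarith, ?_⟩
  · refine contDiff_prod fun i _ => f.contDiff.comp ?_
    exact (EuclideanSpace.proj (𝕜 := ℝ) i).contDiff
  · refine Finset.prod_eq_one fun i _ => f.one_of_mem_closedBall ?_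
    simpa [f] using hz i
  · rintro z ⟨i, hi⟩
    refine Finset.prod_eq_zero (Finset.mem_univ i) (f.zero_of_le_dist ?_)
    simpa [f] using hi.le

theorem CellBump.hasCompactSupport {ρ : ℝ} {ψ : E n → ℝ} (hψ : CellBump ρ ψ) :
    HasCompactSupport fun z => (ψ z : ℂ) := by
  obtain ⟨r, -, hr⟩ := hψ.exists_eq_zero
  refine HasCompactSupport.intro (K := (EuclideanSpace.equiv (Fin n) ℝ) ⁻¹'
    Icc (fun _ => -r) (fun _ => r)) ?_ fun z hz => ?_
  · exact (EuclideanSpace.equiv (Fin n) ℝ).toHomeomorph.isCompact_preimage.2 isCompact_Icc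
  · rw [hr z, Complex.ofReal_zero]
    by_contra hcon
    push Not at hcon
    exact hz ⟨fun i => (abs_le.1 (hcon i)).1, fun i => (abs_le.1 (hcon i)).2⟩

theorem CellBump.contDiff_ofReal {ρ : ℝ} {ψ : E n → ℝ} (hψ : CellBump ρ ψ) :
    ContDiff ℝ ∞ fun z => (ψ z : ℂ) := Complex.ofRealCLM.contDiff.comp hψ.smooth

/-- The Fourier transform of a bump function, as a Schwartz function. -/
def CellBump.transform {ρ : ℝ} {ψ : E n → ℝ} (hψ : CellBump ρ ψ) : SchwartzMap (E n) ℂ :=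
  𝓕 (hψ.hasCompactSupport.toSchwartzMap hψ.contDiff_ofReal)

theorem CellBump.transform_apply {ρ : ℝ} {ψ : E n → ℝ} (hψ : CellBump ρ ψ) (w : E n) :
    hψ.transform w = ∫ z : E n, Complex.exp (-(2 * Real.pi * Complex.I * (inner ℝ z w : ℝ))) *
      (ψ z : ℂ) := by
  have h1 : hψ.transform w = 𝓕 (fun z => (ψ z : ℂ)) w := by
    rw [CellBump.transform, SchwartzMap.fourier_coe]
    rfl
  rw [h1, Real.fourier_eq']
  refine integral_congr_ae (Filter.Eventually.of_forall fun z => ?_)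
  simp only [smul_eq_mul]
  congr 2
  push_cast
  ring

theorem exists_schwartz_bound (f : SchwartzMap (E n) ℂ) (N : ℕ) :
    ∃ C : ℝ, ∀ w, (1 + ‖w‖) ^ N * ‖f w‖ ≤ C := by
  refine ⟨2 ^ N * ((Finset.Iic (N, 0)).sup fun m => SchwartzMap.seminorm ℝ m.1 m.2) f,
    fun w => ?_⟩
  have h := SchwartzMap.one_add_le_sup_seminorm_apply (𝕜 := ℝ) (m := (N, 0)) le_rfl le_rfl f w
  rwa [norm_iteratedFDeriv_zero] at h

theorem weight_le_intVec (p : Fin n → ℤ) : weight p ≤ 1 + ‖intVec p‖ := by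
  unfold weight
  gcongr
  refine (pi_norm_le_iff_of_nonneg (norm_nonneg _)).2 fun i => ?_
  rw [Int.norm_eq_abs, ← Real.norm_eq_abs]
  exact PiLp.norm_apply_le (intVec p) i

/-- Peetre's inequality for the values of a Schwartz function on a translate of the lattice. -/
theorem exists_schwartz_lattice_bound (f : SchwartzMap (E n) ℂ) (N : ℕ) :
    ∃ C : ℝ, 0 ≤ C ∧ ∀ (p : Fin n → ℤ) (w : E n),
      ‖f (intVec p - w)‖ ≤ C * (1 + ‖w‖) ^ N * (weight p ^ N)⁻¹ := by
  obtain ⟨C, hC⟩ := exists_schwartz_bound f N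
  have hC0 : 0 ≤ C := le_trans (by positivity) (hC 0)
  refine ⟨C, hC0, fun p w => ?_⟩
  rw [← div_eq_mul_inv, le_div_iff₀ (pow_pos (weight_pos p) _)]
  have h1 : weight p ≤ (1 + ‖w‖) * (1 + ‖intVec p - w‖) := by
    have h2 : ‖intVec p‖ ≤ ‖intVec p - w‖ + ‖w‖ := by simpa using norm_add_le (intVec p - w) w
    have h3 := mul_nonneg (norm_nonneg w) (norm_nonneg (intVec p - w))
    linarith [weight_le_intVec p]
  calc ‖f (intVec p - w)‖ * weight p ^ N
      ≤ ‖f (intVec p - w)‖ * ((1 + ‖w‖) * (1 + ‖intVec p - w‖)) ^ N := by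
        gcongr
        exact (weight_pos p).le
    _ = (1 + ‖w‖) ^ N * ((1 + ‖intVec p - w‖) ^ N * ‖f (intVec p - w)‖) := by
        rw [mul_pow]
        ring
    _ ≤ (1 + ‖w‖) ^ N * C := by
        gcongr
        exact hC _
    _ = C * (1 + ‖w‖) ^ N := mul_comm _ _

/-- The exponential `e^{2πi z⬝η}`, with `z` in the cell centred at the origin, cut off by `ψ`: a
function on the torus. -/
def cellExp (ψ : E n → ℝ) (η : E n) (Z : T n) : ℂ :=
  Complex.exp (2 * Real.pi * Complex.I * (inner ℝ (torusDiff Z 0) η : ℝ)) *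
    (ψ (torusDiff Z 0) : ℂ)

theorem CellBump.continuous_cellExp {ρ : ℝ} {ψ : E n → ℝ} (hψ : CellBump ρ ψ) (η : E n) :
    Continuous (cellExp ψ η) := by
  obtain ⟨r, hr2, hr⟩ := hψ.exists_eq_zero
  have hψc := hψ.smooth.continuous
  refine continuous_iff_continuousAt.2 fun Z => ?_
  -- the representative jumps at the boundary of the cell, where `ψ` vanishes
  by_cases hZ : ∀ i, ‖Z i‖ < 1 / 2
  · have h1 : Continuous fun z : E n =>
        Complex.exp (2 * Real.pi * Complex.I * (inner ℝ z η : ℝ)) * (ψ z : ℂ) := by fun_prop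
    exact h1.continuousAt.comp (continuousAt_torusDiff hZ)
  · push Not at hZ
    obtain ⟨i, hi⟩ := hZ
    have h2 : ∀ᶠ Z' : T n in nhds Z, r < ‖Z' i‖ :=
      (continuous_apply i).norm.continuousAt.eventually (lt_mem_nhds (hr2.trans_le hi))
    have h3 : cellExp ψ η =ᶠ[nhds Z] fun _ => 0 := by
      filter_upwards [h2] with Z' hZ'
      rw [cellExp, hr _ ⟨i, by rwa [abs_torusDiff, Pi.zero_apply, sub_zero]⟩, Complex.ofReal_zero,
        mul_zero]
    exact continuousAt_const.congr h3.symm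

/-- The Fourier coefficients of `cellExp ψ η` are the values of the Fourier transform of `ψ` on a
translate of the lattice, as `ψ` is supported in the cell. -/
theorem CellBump.fourierCoef_cellExp {ρ : ℝ} {ψ : E n → ℝ} (hψ : CellBump ρ ψ) (η : E n)
    (p : Fin n → ℤ) : fourierCoef (cellExp ψ η) p = hψ.transform (intVec p - η) := by
  obtain ⟨r, hr2, hr⟩ := hψ.exists_eq_zero
  rw [CellBump.transform_apply, ← (PiLp.volume_preserving_toLp (Fin n)).integral_comp
    (MeasurableEquiv.toLp 2 (Fin n → ℝ)).measurableEmbedding]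
  refine (mFourierCoeff_eq_integral (cellExp ψ η) p fun _ => -1 / 2).trans ?_
  have hzero : ∀ y : Fin n → ℝ, (∃ i, r < |y i|) →
      Complex.exp (-(2 * Real.pi * Complex.I * (inner ℝ (WithLp.toLp 2 y) (intVec p - η) : ℝ))) *
        (ψ (WithLp.toLp 2 y) : ℂ) = 0 := by
    rintro y ⟨i, hi⟩
    rw [hr _ ⟨i, hi⟩, Complex.ofReal_zero, mul_zero]
  have hS : MeasurableSet {y : Fin n → ℝ | ∀ i, y i ∈ Ioc (-1 / 2 : ℝ) (-1 / 2 + 1)} :=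
    MeasurableSet.univ_pi' fun i => measurableSet_Ioc
  refine Eq.trans ?_ (setIntegral_eq_integral_of_forall_compl_eq_zero
    (s := {y : Fin n → ℝ | ∀ i, y i ∈ Ioc (-1 / 2 : ℝ) (-1 / 2 + 1)}) ?_)
  · refine setIntegral_congr_fun hS fun y hy => ?_
    have hyt : (fun i => ((y i : ℝ) : UnitAddCircle)) = toTorus (WithLp.toLp 2 y) := rfl
    simp only [hyt, smul_eq_mul]
    by_cases hz : ∃ i, r < |y i|
    · rw [hzero y hz]
      obtain ⟨i, hi⟩ := hz
      have habs : |torusDiff (toTorus (WithLp.toLp 2 y)) 0 i| = |y i| := by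
        rw [abs_torusDiff]
        have h1 : ∀ i, y i ∈ Ioc (-1 / 2 : ℝ) (-1 / 2 + 1) := hy
        have h2 := h1 i
        have h3 : toTorus (WithLp.toLp 2 y) i - (0 : T n) i = ((y i : ℝ) : UnitAddCircle) := by
          simp [toTorus]
        rw [h3]
        refine (AddCircle.norm_coe_eq_abs_iff (1 : ℝ) one_ne_zero).2 ?_
        rw [abs_one, abs_le]
        exact ⟨by linarith [h2.1], by linarith [h2.2]⟩
      rw [cellExp, hr _ ⟨i, habs ▸ hi⟩, Complex.ofReal_zero, mul_zero, mul_zero]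
    · push Not at hz
      rw [cellExp, torusDiff_toTorus fun i => (hz i).trans_lt hr2]
      have h4 : mFourier (-p) (toTorus (WithLp.toLp 2 y)) =
          Complex.exp (-(2 * Real.pi * Complex.I *
            (inner ℝ (WithLp.toLp 2 y) (intVec p) : ℝ))) := by
        refine (mFourier_torusMk (-p) y).trans ?_
        congr 1
        rw [← mul_neg]
        congr 1
        rw [← Complex.ofReal_neg]
        congr 1
        simp [PiLp.inner_apply, intVec, mul_comm]
      rw [h4, ← mul_assoc, ← Complex.exp_add]
      congr 2
      rw [inner_sub_right]
      push_cast
      ring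
  · intro y hy
    refine hzero y ?_
    by_contra hcon
    push Not at hcon
    refine hy fun i => ?_
    have := abs_lt.1 ((hcon i).trans_lt hr2)
    exact ⟨by linarith, by linarith⟩

theorem CellBump.hasSum_cellExp {ρ : ℝ} {ψ : E n → ℝ} (hψ : CellBump ρ ψ) (η : E n) (Z : T n) :
    HasSum (fun p => hψ.transform (intVec p - η) * mFourier p Z) (cellExp ψ η Z) := by
  obtain ⟨C, hC0, hC⟩ := exists_schwartz_lattice_bound hψ.transform (2 * Fintype.card (Fin n))
  have h1 := hasSum_fourierCoef (hψ.continuous_cellExp η)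
    (summable_of_weight_bound (C := C * (1 + ‖η‖) ^ (2 * Fintype.card (Fin n))) fun p => by
      rw [hψ.fourierCoef_cellExp, mul_comm, ← le_div_iff₀ (pow_pos (weight_pos p) _),
        div_eq_mul_inv]
      exact hC p η) Z
  simpa only [hψ.fourierCoef_cellExp] using h1

/-- The Fourier coefficients of the cutoff, as a function on the torus of dimension `2n`. -/
def cutoffCoef (χ : T n × T n → ℝ) (κ : Fin n ⊕ Fin n → ℤ) : ℂ :=
  fourierCoef (fun t : UnitAddTorus (Fin n ⊕ Fin n) =>
    (χ (fun i => t (Sum.inl i), fun i => t (Sum.inr i)) : ℂ)) κ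

theorem IsDiagonalCutoff.isSmoothFamily {χ : T n × T n → ℝ} (hχ : IsDiagonalCutoff χ) :
    -- the parameter in `ℝ` is a dummy
    IsSmoothFamily (Q := ℝ) univ fun (t : UnitAddTorus (Fin n ⊕ Fin n)) _ =>
      (χ (fun i => t (Sum.inl i), fun i => t (Sum.inr i)) : ℂ) := by
  have h1 : ContDiff ℝ ∞ fun z : (Fin n ⊕ Fin n → ℝ) × ℝ =>
      ((WithLp.toLp 2 fun i => z.1 (Sum.inl i), WithLp.toLp 2 fun i => z.1 (Sum.inr i)) :
        E n × E n) := by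
    refine ContDiff.prodMk (contDiff_euclidean.2 fun i => ?_) (contDiff_euclidean.2 fun i => ?_) <;>
    · simp only
      fun_prop
  exact (Complex.ofRealCLM.contDiff.comp (hχ.smooth.comp h1)).contDiffOn

theorem IsDiagonalCutoff.exists_cutoffCoef_bound {χ : T n × T n → ℝ} (hχ : IsDiagonalCutoff χ)
    (N : ℕ) : ∃ C : ℝ, ∀ κ, weight κ ^ N * ‖cutoffCoef χ κ‖ ≤ C := by
  obtain ⟨C, hC⟩ := hχ.isSmoothFamily.exists_weight_bound uniqueDiffOn_univ N
    (isCompact_singleton (x := (0 : ℝ))) (subset_univ _)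
  exact ⟨C, fun κ => hC κ 0 rfl⟩

theorem IsDiagonalCutoff.hasSum_cutoffCoef {χ : T n × T n → ℝ} (hχ : IsDiagonalCutoff χ)
    (x y : T n) :
    HasSum (fun κ => cutoffCoef χ κ *
      (mFourier (fun i => κ (Sum.inl i)) x * mFourier (fun i => κ (Sum.inr i)) y))
      (χ (x, y) : ℂ) := by
  obtain ⟨C, hC⟩ := hχ.exists_cutoffCoef_bound (2 * Fintype.card (Fin n ⊕ Fin n))
  have h1 := hasSum_fourierCoef (hχ.isSmoothFamily.continuous (mem_univ (0 : ℝ)))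
    (summable_of_weight_bound fun κ => hC κ) (Sum.elim x y)
  simp only [Sum.elim_inl, Sum.elim_inr] at h1
  refine h1.congr_fun fun κ => ?_
  simp [mFourier, Fintype.prod_sum_type, cutoffCoef]

/-- By compactness the support of the cutoff is at a positive distance from the set where some
`xᵢ - yᵢ` equals `1/2`. -/
theorem IsDiagonalCutoff.exists_norm_le {χ : T n × T n → ℝ} (hχ : IsDiagonalCutoff χ) :
    ∃ ρ : ℝ, 0 < ρ ∧ ρ < 1 / 2 ∧ ∀ x y, χ (x, y) ≠ 0 → ∀ i, ‖x i - y i‖ ≤ ρ := by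
  have hK : IsCompact (tsupport χ) := (isClosed_tsupport χ).isCompact
  have h1 : ∀ i, ∃ ρ < 1 / 2, ∀ z ∈ tsupport χ, ‖z.1 i - z.2 i‖ ≤ ρ := by
    intro i
    rcases (tsupport χ).eq_empty_or_nonempty with h0 | h0
    · exact ⟨0, by norm_num, by simp [h0]⟩
    · obtain ⟨z, hz, hmax⟩ := hK.exists_isMaxOn h0
        (f := fun z : T n × T n => ‖z.1 i - z.2 i‖) (by fun_prop)
      exact ⟨_, hχ.tsupport_subset hz i, fun z hz => hmax hz⟩
  choose ρ hρ hρ' using h1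
  have h2 : ∀ s : Finset (Fin n), ∃ r : ℝ, 0 < r ∧ r < 1 / 2 ∧ ∀ i ∈ s, ρ i ≤ r := by
    intro s
    induction s using Finset.induction_on with
    | empty => exact ⟨1 / 4, by norm_num, by norm_num, by simp⟩
    | insert i s _ ih =>
      obtain ⟨r, hr0, hr1, hr⟩ := ih
      refine ⟨max r (ρ i), lt_max_of_lt_left hr0, max_lt hr1 (hρ i), fun j hj => ?_⟩
      rcases Finset.mem_insert.1 hj with rfl | hj
      · exact le_max_right _ _
      · exact (hr j hj).trans (le_max_left _ _)
  obtain ⟨r, hr0, hr1, hr⟩ := h2 Finset.univ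
  exact ⟨r, hr0, hr1, fun x y hxy i =>
    (hρ' i (x, y) (subset_tsupport χ hxy)).trans (hr i (Finset.mem_univ i))⟩

end Diagonal

/-! ### The Fourier expansion of the kernel -/

section KernelExpansion

open UnitAddTorus

variable {n : ℕ} {ρ₀ : ℝ} {ψ : E n → ℝ}

/-- A semiclassical amplitude that depends on `ξ` only: continuous, bounded by `M`, and supported in
the ball of radius `ρ`. -/
structure IsBoundedSymbol (A : E n → ℂ) (M ρ : ℝ) : Prop where
  continuous : Continuous A
  norm_le : ∀ ξ, ‖A ξ‖ ≤ M
  eq_zero : ∀ ξ, ρ < ‖ξ‖ → A ξ = 0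

theorem IsBoundedSymbol.nonneg {A : E n → ℂ} {M ρ : ℝ} (hA : IsBoundedSymbol A M ρ) : 0 ≤ M :=
  (norm_nonneg _).trans (hA.norm_le 0)

theorem IsBoundedSymbol.integrable_mul {A : E n → ℂ} {M ρ : ℝ} (hA : IsBoundedSymbol A M ρ)
    {g : E n → ℂ} (hg : Continuous g) : Integrable fun ξ => A ξ * g ξ := by
  have h1 := hA.continuous
  refine Continuous.integrable_of_hasCompactSupport (by fun_prop)
    (HasCompactSupport.intro (isCompact_closedBall (0 : E n) ρ) fun ξ hξ => ?_)
  rw [mem_closedBall_zero_iff, not_le] at hξ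
  rw [hA.eq_zero ξ hξ, zero_mul]

theorem IsBoundedSymbol.integrable {A : E n → ℂ} {M ρ : ℝ} (hA : IsBoundedSymbol A M ρ) :
    Integrable A := by
  simpa using hA.integrable_mul (g := fun _ => 1) continuous_const

theorem IsBoundedSymbol.integral_norm_mul_le {A : E n → ℂ} {M ρ : ℝ} (hA : IsBoundedSymbol A M ρ)
    {g : E n → ℂ} {B : ℝ} (hB : ∀ ξ, ‖ξ‖ ≤ ρ → ‖g ξ‖ ≤ B) :
    ∫ ξ, ‖A ξ * g ξ‖ ≤ M * B * volume.real (Metric.closedBall (0 : E n) ρ) := by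
  have h1 : ∀ ξ, ξ ∉ Metric.closedBall (0 : E n) ρ → ‖A ξ * g ξ‖ = 0 := fun ξ hξ => by
    rw [mem_closedBall_zero_iff, not_le] at hξ
    rw [hA.eq_zero ξ hξ, zero_mul, norm_zero]
  rw [← setIntegral_eq_integral_of_forall_compl_eq_zero h1]
  refine (le_abs_self _).trans (norm_setIntegral_le_of_norm_le_const
    (μ := (volume : Measure (E n))) (s := Metric.closedBall 0 ρ) (f := fun ξ => ‖A ξ * g ξ‖)
    measure_closedBall_lt_top fun ξ hξ => ?_)
  rw [norm_norm, norm_mul]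
  exact mul_le_mul (hA.norm_le ξ) (hB ξ (mem_closedBall_zero_iff.1 hξ)) (norm_nonneg _) hA.nonneg

/-- The function `(2πh)^{-n} ∫ e^{(i/h) z⬝ξ} ψ(z) A(ξ) dξ` of a point `Z` of the torus, where `z` is
the representative of `Z` in the cell centred at the origin. -/
def cellIntegral (ψ : E n → ℝ) (h : ℝ) (A : E n → ℂ) (Z : T n) : ℂ :=
  (((2 * Real.pi * h) ^ n : ℝ) : ℂ)⁻¹ * ∫ ξ, A ξ * cellExp ψ ((2 * Real.pi * h)⁻¹ • ξ) Z

/-- The Fourier coefficients of `cellIntegral`; `f` is the Fourier transform of `ψ`. -/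
def cellCoef (f : E n → ℂ) (h : ℝ) (A : E n → ℂ) (p : Fin n → ℤ) : ℂ :=
  (((2 * Real.pi * h) ^ n : ℝ) : ℂ)⁻¹ * ∫ ξ, A ξ * f (intVec p - (2 * Real.pi * h)⁻¹ • ξ)

theorem continuous_cellExp_scale (ψ : E n → ℝ) (c : ℝ) (Z : T n) :
    Continuous fun ξ : E n => cellExp ψ (c • ξ) Z := by
  unfold cellExp
  fun_prop

theorem norm_cellExp_le (ψ : E n → ℝ) (η : E n) (Z : T n) :
    ‖cellExp ψ η Z‖ ≤ |ψ (torusDiff Z 0)| := by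
  have h1 : (2 * Real.pi * Complex.I * (inner ℝ (torusDiff Z 0) η : ℝ) : ℂ) =
      ((2 * Real.pi * inner ℝ (torusDiff Z 0) η : ℝ) : ℂ) * Complex.I := by
    push_cast
    ring
  rw [cellExp, norm_mul, h1, Complex.norm_exp_ofReal_mul_I, one_mul, Complex.norm_real,
    Real.norm_eq_abs]

theorem mFourier_eq_exp_torusDiff (m : Fin n → ℤ) (Z : T n) :
    mFourier m Z = Complex.exp (2 * Real.pi * Complex.I *
      (inner ℝ (torusDiff Z 0) (intVec m) : ℝ)) := by
  have h1 : torusMk (fun i => torusDiff Z 0 i) = Z := by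
    have := toTorus_torusDiff Z 0
    rwa [sub_zero] at this
  conv_lhs => rw [← h1]
  rw [mFourier_torusMk]
  congr 2

theorem mFourier_mul_cellExp (ψ : E n → ℝ) (m : Fin n → ℤ) (η : E n) (Z : T n) :
    mFourier m Z * cellExp ψ η Z = cellExp ψ (η + intVec m) Z := by
  rw [mFourier_eq_exp_torusDiff, cellExp, cellExp, ← mul_assoc, ← Complex.exp_add, inner_add_right]
  congr 2
  push_cast
  ring

/-- Multiplication by an exponential on the torus is a translation by a vector of size `h` in the
frequency variable. -/
theorem mFourier_mul_cellIntegral (ψ : E n → ℝ) {h : ℝ} (hh : 0 < h) (m : Fin n → ℤ)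
    (A : E n → ℂ) (Z : T n) :
    mFourier m Z * cellIntegral ψ h A Z =
      cellIntegral ψ h (fun ξ => A (ξ - h • (2 * Real.pi) • intVec m)) Z := by
  rw [cellIntegral, cellIntegral, mul_left_comm, ← integral_const_mul]
  congr 1
  rw [← integral_sub_right_eq_self (μ := (volume : Measure (E n))) _ (h • (2 * Real.pi) • intVec m)]
  refine integral_congr_ae (Filter.Eventually.of_forall fun ξ => ?_)
  simp only
  rw [mul_left_comm, mFourier_mul_cellExp]
  congr 2
  rw [smul_sub, smul_smul, smul_smul]
  have h1 : (2 * Real.pi * h)⁻¹ * h * (2 * Real.pi) = 1 := by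
    have := Real.pi_pos
    field_simp
  rw [h1, one_smul, sub_add_cancel]

/-- On the support of the cutoff the bump function equals one, so that inserting it does not change
the kernel. -/
theorem kernel_eq_mul_cellIntegral {χ : T n × T n → ℝ} (hψ : CellBump ρ₀ ψ)
    (hχ : ∀ x y, χ (x, y) ≠ 0 → ∀ i, ‖x i - y i‖ ≤ ρ₀) (a : T n → T n → E n → Param → ℂ) (h : Param)
    (x y : T n) :
    kernel χ a h x y = χ (x, y) * cellIntegral ψ h (fun ξ => a x y ξ h) (x - y) := by
  have hh : (h : ℝ) ≠ 0 := h.2.1.ne'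
  rw [kernel, cellIntegral, mul_left_comm, ← integral_const_mul (χ (x, y) : ℂ)]
  congr 1
  refine integral_congr_ae (Filter.Eventually.of_forall fun ξ => ?_)
  simp only
  by_cases h0 : χ (x, y) = 0
  · simp [h0]
  · have h1 : ψ (torusDiff (x - y) 0) = 1 := hψ.eq_one _ fun i => by
      rw [abs_torusDiff, Pi.zero_apply, sub_zero]
      exact hχ x y h0 i
    rw [cellExp, h1, Complex.ofReal_one, mul_one, ← torusDiff_eq_sub, inner_smul_right]
    have h2 : (2 * Real.pi * Complex.I *
        (((2 * Real.pi * h)⁻¹ * inner ℝ (torusDiff x y) ξ : ℝ) : ℂ) : ℂ) =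
        Complex.I * ((inner ℝ (torusDiff x y) ξ / (h : ℝ) : ℝ) : ℂ) := by
      have h3 : (2 * Real.pi * h)⁻¹ * inner ℝ (torusDiff x y) ξ =
          (2 * Real.pi)⁻¹ * (inner ℝ (torusDiff x y) ξ / h) := by
        field_simp
      have h4 : (2 * Real.pi : ℂ) ≠ 0 := by
        exact_mod_cast (by positivity : (2 * Real.pi : ℝ) ≠ 0)
      rw [h3]
      push_cast
      field_simp
    rw [h2]
    ring

theorem norm_normalization {h : ℝ} (hh : 0 < h) :
    ‖(((2 * Real.pi * h) ^ n : ℝ) : ℂ)⁻¹‖ = ((2 * Real.pi * h) ^ n)⁻¹ := by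
  rw [norm_inv, Complex.norm_real, Real.norm_eq_abs, abs_of_nonneg (by positivity)]

/-- The Fourier coefficients of `cellIntegral` are bounded uniformly in `h`. -/
theorem norm_cellCoef_le (f : SchwartzMap (E n) ℂ) {h : ℝ} (hh : 0 < h) {A : E n → ℂ} {M ρ : ℝ}
    (hA : IsBoundedSymbol A M ρ) (p : Fin n → ℤ) :
    ‖cellCoef f h A p‖ ≤ M * ∫ w, ‖f w‖ := by
  have hc : 0 < 2 * Real.pi * h := by positivity
  have hfin : Integrable fun ξ : E n => f (intVec p - (2 * Real.pi * h)⁻¹ • ξ) := by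
    have h1 := (f.integrable (μ := volume)).comp_sub_left (intVec p)
    exact (integrable_comp_smul_iff volume _ (inv_ne_zero hc.ne')).2 h1
  rw [cellCoef, norm_mul, norm_normalization hh, inv_mul_le_iff₀ (by positivity)]
  calc ‖∫ ξ, A ξ * f (intVec p - (2 * Real.pi * h)⁻¹ • ξ)‖
      ≤ ∫ ξ, M * ‖f (intVec p - (2 * Real.pi * h)⁻¹ • ξ)‖ := by
        refine norm_integral_le_of_norm_le (hfin.norm.const_mul M)
          (Filter.Eventually.of_forall fun ξ => ?_)
        rw [norm_mul]
        exact mul_le_mul_of_nonneg_right (hA.norm_le ξ) (norm_nonneg _)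
    _ = M * ((2 * Real.pi * h) ^ n * ∫ w, ‖f w‖) := by
        rw [integral_const_mul]
        congr 1
        have h1 := Measure.integral_comp_smul (volume : Measure (E n))
          (fun ξ => ‖f (intVec p - ξ)‖) (2 * Real.pi * h)⁻¹
        rw [h1, integral_sub_left_eq_self (fun ξ => ‖f ξ‖) volume (intVec p)]
        rw [finrank_euclideanSpace_fin, inv_pow, inv_inv, abs_of_pos (by positivity), smul_eq_mul]
    _ = (2 * Real.pi * h) ^ n * (M * ∫ w, ‖f w‖) := by ring

/-- The Fourier coefficients of `cellIntegral` are rapidly decreasing, at the cost of powers of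
`h`. -/
theorem exists_cellCoef_bound (f : SchwartzMap (E n) ℂ) {ρ : ℝ} (hρ : 0 ≤ ρ) (N : ℕ) :
    ∃ C : ℝ, 0 ≤ C ∧ ∀ (h : Param) (A : E n → ℂ) (M : ℝ), IsBoundedSymbol A M ρ →
      ∀ p : Fin n → ℤ, ((2 * Real.pi * (h : ℝ)) ^ n)⁻¹ *
        ∫ ξ, ‖A ξ * f (intVec p - (2 * Real.pi * (h : ℝ))⁻¹ • ξ)‖ ≤
          C * M * ((h : ℝ)⁻¹) ^ (N + n) * (weight p ^ N)⁻¹ := by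
  obtain ⟨C, hC0, hC⟩ := exists_schwartz_lattice_bound f N
  set V := volume.real (Metric.closedBall (0 : E n) ρ)
  have hV : 0 ≤ V := measureReal_nonneg
  refine ⟨C * (1 + ρ) ^ N * V, by positivity, fun h A M hA p => ?_⟩
  have hh := h.2.1
  have hh1 : 1 ≤ (h : ℝ)⁻¹ := (one_le_inv₀ hh).2 h.2.2.le
  have hM := hA.nonneg
  have hw := weight_pos p
  have hpi : 1 ≤ 2 * Real.pi := by linarith [Real.pi_gt_three]
  have h1 : ((2 * Real.pi * (h : ℝ)) ^ n)⁻¹ ≤ ((h : ℝ)⁻¹) ^ n := by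
    rw [inv_pow]
    refine inv_anti₀ (by positivity) (pow_le_pow_left₀ hh.le ?_ n)
    nlinarith
  have h2 := hA.integral_norm_mul_le
    (g := fun ξ => f (intVec p - (2 * Real.pi * (h : ℝ))⁻¹ • ξ))
    (B := C * ((1 + ρ) * (h : ℝ)⁻¹) ^ N * (weight p ^ N)⁻¹) fun ξ hξ => by
      refine (hC p _).trans ?_
      have h3 : 1 + ‖(2 * Real.pi * (h : ℝ))⁻¹ • ξ‖ ≤ (1 + ρ) * (h : ℝ)⁻¹ := by
        rw [norm_smul, Real.norm_eq_abs, abs_of_pos (by positivity), mul_inv]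
        have h4 : (2 * Real.pi)⁻¹ ≤ 1 := inv_le_one_of_one_le₀ hpi
        have h5 : (2 * Real.pi)⁻¹ * (h : ℝ)⁻¹ * ‖ξ‖ ≤ 1 * (h : ℝ)⁻¹ * ρ := by gcongr
        linarith
      gcongr
  calc _ ≤ ((h : ℝ)⁻¹) ^ n * (M * (C * ((1 + ρ) * (h : ℝ)⁻¹) ^ N * (weight p ^ N)⁻¹) * V) := by
        refine mul_le_mul h1 h2 (integral_nonneg fun ξ => norm_nonneg _) (by positivity)
    _ = _ := by
        rw [mul_pow, pow_add]
        ring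

theorem norm_cellCoef_le_integral (f : E n → ℂ) {h : ℝ} (hh : 0 < h) (A : E n → ℂ)
    (p : Fin n → ℤ) :
    ‖cellCoef f h A p‖ ≤ ((2 * Real.pi * h) ^ n)⁻¹ *
      ∫ ξ, ‖A ξ * f (intVec p - (2 * Real.pi * h)⁻¹ • ξ)‖ := by
  rw [cellCoef, norm_mul, norm_normalization hh]
  have := norm_integral_le_integral_norm (μ := volume)
    fun ξ : E n => A ξ * f (intVec p - (2 * Real.pi * h)⁻¹ • ξ)
  gcongr

theorem CellBump.hasSum_cellCoef (hψ : CellBump ρ₀ ψ) (h : Param) {A : E n → ℂ} {M ρ : ℝ}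
    (hρ : 0 ≤ ρ) (hA : IsBoundedSymbol A M ρ) (Z : T n) :
    HasSum (fun p => cellCoef hψ.transform h A p * mFourier p Z) (cellIntegral ψ h A Z) := by
  set c : ℝ := 2 * Real.pi * (h : ℝ)
  have hc : 0 < c := by
    have := h.2.1
    positivity
  obtain ⟨C, hC0, hC⟩ := exists_cellCoef_bound hψ.transform hρ (2 * Fintype.card (Fin n))
  have hcont : ∀ p : Fin n → ℤ, Continuous fun ξ : E n =>
      hψ.transform (intVec p - c⁻¹ • ξ) * mFourier p Z := fun p => by
    have := hψ.transform.continuous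
    fun_prop
  have h1 := hasSum_integral_of_summable_integral_norm (μ := (volume : Measure (E n)))
    (F := fun (p : Fin n → ℤ) ξ => A ξ * (hψ.transform (intVec p - c⁻¹ • ξ) * mFourier p Z))
    (fun p => hA.integrable_mul (hcont p)) (by
      have h2 : Summable fun p : Fin n → ℤ => c ^ n * (C * M *
          ((h : ℝ)⁻¹) ^ (2 * Fintype.card (Fin n) + n) *
          (weight p ^ (2 * Fintype.card (Fin n)))⁻¹) :=
        ((summable_weight le_rfl).mul_left _).mul_left _
      refine Summable.of_nonneg_of_le (fun p => integral_nonneg fun ξ => norm_nonneg _)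
        (fun p => ?_) h2
      rw [← inv_mul_le_iff₀ (by positivity)]
      refine le_trans (le_of_eq ?_) (hC h A M hA p)
      congr 1
      refine integral_congr_ae (Filter.Eventually.of_forall fun ξ => ?_)
      simp only [norm_mul, norm_mFourier_apply, mul_one, c])
  have h3 := h1.mul_left (((c ^ n : ℝ) : ℂ)⁻¹)
  have h4 : (((c ^ n : ℝ) : ℂ)⁻¹) * (∫ ξ : E n, ∑' p : Fin n → ℤ,
      A ξ * (hψ.transform (intVec p - c⁻¹ • ξ) * mFourier p Z)) = cellIntegral ψ h A Z := by
    rw [cellIntegral]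
    congr 1
    refine integral_congr_ae (Filter.Eventually.of_forall fun ξ => ?_)
    simp only
    rw [← ((hψ.hasSum_cellExp (c⁻¹ • ξ) Z).mul_left (A ξ)).tsum_eq]
  rw [h4] at h3
  refine h3.congr_fun fun p => ?_
  rw [cellCoef, mul_assoc, ← integral_mul_const]
  simp only [mul_assoc, c]

/-- `cellIntegral` is countably additive in the amplitude. -/
theorem hasSum_cellIntegral {J : Type} [Countable J] (ψ : E n → ℝ) {h : ℝ} {A : J → E n → ℂ}
    {M : J → ℝ} {ρ : ℝ} (hA : ∀ κ, IsBoundedSymbol (A κ) (M κ) ρ) (hM : Summable M)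
    {e : J → ℂ} (he : ∀ κ, ‖e κ‖ = 1) {a : E n → ℂ}
    (ha : ∀ ξ, HasSum (fun κ => e κ * A κ ξ) (a ξ)) (Z : T n) :
    HasSum (fun κ => e κ * cellIntegral ψ h (A κ) Z) (cellIntegral ψ h a Z) := by
  have hcont := continuous_cellExp_scale ψ (2 * Real.pi * h)⁻¹ Z
  have h1 := hasSum_integral_of_summable_integral_norm (μ := (volume : Measure (E n)))
    (F := fun κ ξ => A κ ξ * (cellExp ψ ((2 * Real.pi * h)⁻¹ • ξ) Z * e κ))
    (fun κ => (hA κ).integrable_mul (by fun_prop)) (by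
      refine Summable.of_nonneg_of_le (fun κ => integral_nonneg fun ξ => norm_nonneg _)
        (fun κ => (hA κ).integral_norm_mul_le (B := |ψ (torusDiff Z 0)|) fun ξ _ => ?_)
        ((hM.mul_right _).mul_right _)
      rw [norm_mul, he, mul_one]
      exact norm_cellExp_le _ _ _)
  have h3 := h1.mul_left ((((2 * Real.pi * h) ^ n : ℝ) : ℂ)⁻¹)
  have h4 : ((((2 * Real.pi * h) ^ n : ℝ) : ℂ)⁻¹) * (∫ ξ : E n, ∑' κ,
      A κ ξ * (cellExp ψ ((2 * Real.pi * h)⁻¹ • ξ) Z * e κ)) = cellIntegral ψ h a Z := by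
    rw [cellIntegral]
    congr 1
    refine integral_congr_ae (Filter.Eventually.of_forall fun ξ => ?_)
    simp only
    rw [← ((ha ξ).mul_right _).tsum_eq]
    refine tsum_congr fun κ => ?_
    ring
  rw [h4] at h3
  refine h3.congr_fun fun κ => ?_
  rw [cellIntegral, mul_left_comm, ← integral_const_mul]
  congr 1
  refine integral_congr_ae (Filter.Eventually.of_forall fun ξ => ?_)
  simp only
  ring

end KernelExpansion

/-! ### Quantization by a series of exponentials -/

section Quantization

open UnitAddTorus

variable {n : ℕ} {ρ₀ : ℝ} {ψ : E n → ℝ}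

/-- Frequencies in `(x, y) ∈ 𝕋ⁿ × 𝕋ⁿ`. -/
abbrev PairFreq (n : ℕ) := Fin n ⊕ Fin n → ℤ

/-- The index set of the expansion of a kernel: frequencies of the cutoff, of the amplitude, and of
the oscillatory integral as a function of `x - y`. -/
abbrev KernelFreq (n : ℕ) := (PairFreq n × PairFreq n) × (Fin n → ℤ)

/-- The total frequency in `x`. -/
def freqX (j : KernelFreq n) : Fin n → ℤ :=
  (fun i => j.1.1 (Sum.inl i)) + (fun i => j.1.2 (Sum.inl i)) + j.2

/-- The total frequency in `y`. -/
def freqY (j : KernelFreq n) : Fin n → ℤ :=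
  (fun i => j.1.1 (Sum.inr i)) + (fun i => j.1.2 (Sum.inr i)) + -j.2

/-- The Fourier coefficients of the kernel of an operator with amplitude
`∑ κ, A κ ξ e^{2πi κ⬝(x, y)}`; `f` is the Fourier transform of the bump function on the cell. -/
def quantCoef (χ : T n × T n → ℝ) (f : E n → ℂ) (h : ℝ) (A : PairFreq n → E n → ℂ)
    (j : KernelFreq n) : ℂ :=
  cutoffCoef χ j.1.1 * cellCoef f h (A j.1.2) j.2

/-- The operator with amplitude `∑ κ, A κ ξ e^{2πi κ⬝(x, y)}`. -/
def quantOp (χ : T n × T n → ℝ) (f : E n → ℂ) (h : ℝ) (A : PairFreq n → E n → ℂ) :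
    L2 n →L[ℂ] L2 n :=
  seriesOp (quantCoef χ f h A) freqX freqY

theorem mFourier_sub_apply (p : Fin n → ℤ) (x y : T n) :
    mFourier p (x - y) = mFourier p x * mFourier (-p) y := by
  have h1 : mFourier p y * mFourier (-p) y = 1 := by
    rw [← mFourier_add, add_neg_cancel, mFourier_zero, ContinuousMap.one_apply]
  have h2 := mFourier_add_apply p (x - y) y
  rw [sub_add_cancel] at h2
  rw [h2, mul_assoc, h1, mul_one]

theorem mFourier_freq (j : KernelFreq n) (x y : T n) :
    mFourier (freqX j) x * mFourier (freqY j) y =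
      mFourier (fun i => j.1.1 (Sum.inl i)) x * mFourier (fun i => j.1.1 (Sum.inr i)) y *
        (mFourier (fun i => j.1.2 (Sum.inl i)) x * mFourier (fun i => j.1.2 (Sum.inr i)) y *
          mFourier j.2 (x - y)) := by
  rw [freqX, freqY, mFourier_add, mFourier_add, mFourier_add, mFourier_add, mFourier_sub_apply]
  ring

theorem freqX_injective (i : PairFreq n × PairFreq n) :
    Function.Injective fun p : Fin n → ℤ => freqX (i, p) :=
  fun _ _ h => add_left_cancel h

theorem freqY_injective (i : PairFreq n × PairFreq n) :
    Function.Injective fun p : Fin n → ℤ => freqY (i, p) :=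
  fun _ _ h => neg_injective (add_left_cancel h)

theorem IsDiagonalCutoff.summable_cutoffCoef {χ : T n × T n → ℝ} (hχ : IsDiagonalCutoff χ) :
    Summable fun κ => ‖cutoffCoef χ κ‖ := by
  obtain ⟨C, hC⟩ := hχ.exists_cutoffCoef_bound (2 * Fintype.card (Fin n ⊕ Fin n))
  exact (summable_of_weight_bound hC).norm

variable {A : PairFreq n → E n → ℂ} {M : PairFreq n → ℝ} {ρ : ℝ}

theorem summable_cellCoef (f : SchwartzMap (E n) ℂ) (h : Param) (hρ : 0 ≤ ρ)
    (hA : ∀ κ, IsBoundedSymbol (A κ) (M κ) ρ) (hM : Summable M) :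
    Summable fun j : PairFreq n × (Fin n → ℤ) => ‖cellCoef f h (A j.1) j.2‖ := by
  obtain ⟨C, hC0, hC⟩ := exists_cellCoef_bound f hρ (2 * Fintype.card (Fin n))
  have h1 := (hM.mul_of_nonneg (summable_weight (ι := Fin n) le_rfl) (fun κ => (hA κ).nonneg)
    fun p => inv_nonneg.2 (pow_nonneg (weight_pos p).le _)).mul_left
      (C * ((h : ℝ)⁻¹) ^ (2 * Fintype.card (Fin n) + n))
  refine Summable.of_nonneg_of_le (fun j => norm_nonneg _) (fun j => ?_) h1
  refine ((norm_cellCoef_le_integral f h.2.1 _ _).trans (hC h _ _ (hA j.1) j.2)).trans_eq ?_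
  ring

theorem IsDiagonalCutoff.summable_quantCoef {χ : T n × T n → ℝ} (hχ : IsDiagonalCutoff χ)
    (f : SchwartzMap (E n) ℂ) (h : Param) (hρ : 0 ≤ ρ)
    (hA : ∀ κ, IsBoundedSymbol (A κ) (M κ) ρ) (hM : Summable M) :
    Summable fun j => ‖quantCoef χ f h A j‖ := by
  have h1 := hχ.summable_cutoffCoef.mul_of_nonneg (summable_cellCoef f h hρ hA hM)
    (fun _ => norm_nonneg _) fun _ => norm_nonneg _
  refine ((Equiv.prodAssoc _ _ _).summable_iff.2 h1).congr fun j => ?_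
  rw [quantCoef, norm_mul]
  rfl

theorem IsDiagonalCutoff.norm_quantOp_le {χ : T n × T n → ℝ} (hχ : IsDiagonalCutoff χ)
    (f : SchwartzMap (E n) ℂ) (h : Param) (hρ : 0 ≤ ρ)
    (hA : ∀ κ, IsBoundedSymbol (A κ) (M κ) ρ) (hM : Summable M) :
    ‖quantOp χ f h A‖ ≤
      ∑' i : PairFreq n × PairFreq n, ‖cutoffCoef χ i.1‖ * (M i.2 * ∫ w, ‖f w‖) := by
  refine norm_seriesOp_le (hχ.summable_quantCoef f h hρ hA hM) freqX_injective freqY_injective ?_ ?_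
  · exact hχ.summable_cutoffCoef.mul_of_nonneg (hM.mul_right _) (fun _ => norm_nonneg _)
      fun κ => mul_nonneg (hA κ).nonneg (integral_nonneg fun _ => norm_nonneg _)
  · intro i p
    rw [quantCoef, norm_mul]
    gcongr
    exact norm_cellCoef_le f h.2.1 (hA _) p

theorem IsDiagonalCutoff.hasSum_quantCoef {χ : T n × T n → ℝ} (hχ : IsDiagonalCutoff χ)
    (hψ : CellBump ρ₀ ψ) (h : Param) (hρ : 0 ≤ ρ)
    (hA : ∀ κ, IsBoundedSymbol (A κ) (M κ) ρ) (hM : Summable M) {x y : T n} {z : ℂ}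
    (hz : HasSum (fun κ : PairFreq n =>
      mFourier (fun i => κ (Sum.inl i)) x * mFourier (fun i => κ (Sum.inr i)) y *
        cellIntegral ψ h (A κ) (x - y)) z) :
    HasSum (fun j => quantCoef χ hψ.transform h A j * (mFourier (freqX j) x * mFourier (freqY j) y))
      (χ (x, y) * z) := by
  have hsum : Summable fun j : PairFreq n × (Fin n → ℤ) =>
      mFourier (fun i => j.1 (Sum.inl i)) x * mFourier (fun i => j.1 (Sum.inr i)) y *
        (cellCoef hψ.transform h (A j.1) j.2 * mFourier j.2 (x - y)) := by
    refine Summable.of_norm ((summable_cellCoef hψ.transform h hρ hA hM).congr fun j => ?_)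
    simp only [norm_mul, norm_mFourier_apply, mul_one, one_mul]
  have h1 := hsum.hasSum
  have h2 := h1.prod_fiberwise fun κ => (hψ.hasSum_cellCoef h hρ (hA κ) (x - y)).mul_left
    (mFourier (fun i => κ (Sum.inl i)) x * mFourier (fun i => κ (Sum.inr i)) y)
  rw [h2.unique hz] at h1
  have h3 := (hχ.hasSum_cutoffCoef x y).mul h1 (by
    refine Summable.of_norm (((Equiv.prodAssoc _ _ _).symm.summable_iff.2
      (hχ.summable_quantCoef hψ.transform h hρ hA hM)).congr fun j => ?_)
    simp only [Function.comp_apply, quantCoef, norm_mul, norm_mFourier_apply, mul_one, one_mul,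
      Equiv.prodAssoc_symm_apply])
  refine ((Equiv.prodAssoc _ _ _).hasSum_iff.2 h3).congr_fun fun j => ?_
  rw [mFourier_freq, quantCoef]
  simp only [Function.comp_apply, Equiv.prodAssoc_apply]
  ring

/-- The operator `quantOp χ f h A` is the quantization of every amplitude whose oscillatory integral
is the sum of those of the terms `A κ ξ e^{2πi κ⬝(x, y)}`; the amplitude itself may differ from the
sum of these terms. -/
theorem IsDiagonalCutoff.quantOp_apply {χ : T n × T n → ℝ} (hχ : IsDiagonalCutoff χ)
    (hψ : CellBump ρ₀ ψ) (hχρ : ∀ x y, χ (x, y) ≠ 0 → ∀ i, ‖x i - y i‖ ≤ ρ₀) (h : Param)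
    (hρ : 0 ≤ ρ) (hA : ∀ κ, IsBoundedSymbol (A κ) (M κ) ρ) (hM : Summable M)
    {a : T n → T n → E n → Param → ℂ}
    (ha : ∀ x y, HasSum (fun κ : PairFreq n =>
      mFourier (fun i => κ (Sum.inl i)) x * mFourier (fun i => κ (Sum.inr i)) y *
        cellIntegral ψ h (A κ) (x - y)) (cellIntegral ψ h (fun ξ => a x y ξ h) (x - y)))
    (u : L2 n) :
    ∀ᵐ x ∂(torusMeasure n), Integrable (fun y => kernel χ a h x y * u y) (torusMeasure n) ∧
      quantOp χ hψ.transform h A u x = ∫ y, kernel χ a h x y * u y ∂(torusMeasure n) :=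
  seriesOp_kernel freqX freqY (hχ.summable_quantCoef hψ.transform h hρ hA hM)
    (fun x y => by
      rw [kernel_eq_mul_cellIntegral hψ hχρ]
      exact hχ.hasSum_quantCoef hψ h hρ hA hM (ha x y)) u

theorem cellCoef_add (f : SchwartzMap (E n) ℂ) (h : ℝ) {A B : E n → ℂ} {M M' ρ ρ' : ℝ}
    (hA : IsBoundedSymbol A M ρ) (hB : IsBoundedSymbol B M' ρ') (p : Fin n → ℤ) :
    cellCoef f h (fun ξ => A ξ + B ξ) p = cellCoef f h A p + cellCoef f h B p := by
  have hf := f.continuous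
  have hcont : Continuous fun ξ : E n => f (intVec p - (2 * Real.pi * h)⁻¹ • ξ) := by fun_prop
  rw [cellCoef, cellCoef, cellCoef, ← mul_add,
    ← integral_add (hA.integrable_mul hcont) (hB.integrable_mul hcont)]
  simp only [add_mul]

theorem IsDiagonalCutoff.quantOp_add {χ : T n × T n → ℝ} (hχ : IsDiagonalCutoff χ)
    (f : SchwartzMap (E n) ℂ) (h : Param) (hρ : 0 ≤ ρ) {B : PairFreq n → E n → ℂ}
    (hA : ∀ κ, IsBoundedSymbol (A κ) (M κ) ρ) (hB : ∀ κ, IsBoundedSymbol (B κ) (M κ) ρ)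
    (hM : Summable M) :
    quantOp χ f h (fun κ ξ => A κ ξ + B κ ξ) = quantOp χ f h A + quantOp χ f h B := by
  have h1 := hasSum_seriesOp freqX freqY (hχ.summable_quantCoef f h hρ hA hM)
  have h2 := hasSum_seriesOp freqX freqY (hχ.summable_quantCoef f h hρ hB hM)
  rw [quantOp, quantOp, quantOp, ← (h1.add h2).tsum_eq, seriesOp]
  refine tsum_congr fun j => ?_
  rw [← add_smul, quantCoef, quantCoef, quantCoef, cellCoef_add f h (hA _) (hB _), mul_add]

theorem isBoundedSymbol_of_hasSum (hA : ∀ κ, IsBoundedSymbol (A κ) (M κ) ρ) (hM : Summable M)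
    {e : PairFreq n → ℂ} (he : ∀ κ, ‖e κ‖ = 1) {a : E n → ℂ}
    (ha : ∀ ξ, HasSum (fun κ => e κ * A κ ξ) (a ξ)) : IsBoundedSymbol a (∑' κ, M κ) ρ := by
  have h1 : ∀ κ ξ, ‖e κ * A κ ξ‖ ≤ M κ := fun κ ξ => by
    rw [norm_mul, he, one_mul]
    exact (hA κ).norm_le ξ
  have h2 : a = fun ξ => ∑' κ, e κ * A κ ξ := funext fun ξ => (ha ξ).tsum_eq.symm
  refine ⟨?_, fun ξ => ?_, fun ξ hξ => ?_⟩
  · rw [h2]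
    exact continuous_tsum (fun κ => continuous_const.mul (hA κ).continuous) hM h1
  · rw [h2]
    exact tsum_of_norm_bounded hM.hasSum fun κ => h1 κ ξ
  · rw [h2]
    simp only [(hA _).eq_zero ξ hξ, mul_zero, tsum_zero]

end Quantization

/-! ### Residual operators with rapidly decreasing coefficients -/

section Residual

open UnitAddTorus

variable {n d : ℕ}

theorem inner_torusExp_toL2 (p : Fin n → ℤ) (u : SmoothFun n) :
    inner ℂ (torusExp p) (toL2 u) = fourierCoef (fun t => u.1 t) p := by
  rw [inner_torusExp, fourierCoef]
  refine integral_congr_ae ?_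
  filter_upwards [ContinuousMap.coeFn_toLp (p := 2) (𝕜 := ℂ) (torusMeasure n) u.1] with y hy
  rw [toL2, hy, smul_eq_mul]

theorem inner_torusExp_hD (w : E n) (h : ℝ) (p : Fin n → ℤ) (u : SmoothFun n) :
    inner ℂ (torusExp p) (toL2 (hD w h u)) =
      ((2 * Real.pi * h * inner ℝ w (intVec p) : ℝ) : ℂ) * inner ℂ (torusExp p) (toL2 u) := by
  rw [inner_torusExp_toL2, inner_torusExp_toL2]
  have hu : ContDiff ℝ 1 fun y : Fin n → ℝ => u.1 (torusMk y) :=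
    ((show ContDiff ℝ ∞ fun x : E n => u.1 (toTorus x) from u.2).comp
      (EuclideanSpace.equiv (Fin n) ℝ).symm.contDiff).of_le one_le_infty
  have h1 := fourierCoef_torusDeriv hu (fun i => w i) p
  have h2 : (fun t => (hD w h u).1 t) =
      fun t => (-Complex.I * h) • torusDeriv (fun i => w i) (fun t => u.1 t) t := rfl
  have h3 : inner ℝ w (intVec p) = ∑ i, (p i : ℝ) * w i := by
    simp [PiLp.inner_apply, intVec]
  have h4 : ∀ (c : ℂ) (g : T n → ℂ), fourierCoef (fun t => c • g t) p = c * fourierCoef g p := by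
    intro c g
    rw [fourierCoef, fourierCoef, ← integral_const_mul]
    simp only [smul_eq_mul, mul_left_comm]
  rw [h2, h4, h1, h3, smul_eq_mul, ← mul_assoc]
  congr 1
  push_cast
  linear_combination (-(2 : ℂ) * h * Real.pi * ∑ i, (p i : ℂ) * (w i : ℂ)) * Complex.I_sq

theorem inner_torusExp_pow {X : Module.End ℂ (SmoothFun n)} {c : ℂ} {p : Fin n → ℤ}
    (hX : ∀ u, inner ℂ (torusExp p) (toL2 (X u)) = c * inner ℂ (torusExp p) (toL2 u)) (k : ℕ)
    (u : SmoothFun n) :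
    inner ℂ (torusExp p) (toL2 ((X ^ k) u)) = c ^ k * inner ℂ (torusExp p) (toL2 u) := by
  induction k generalizing u with
  | zero => simp
  | succ k ih => rw [pow_succ, Module.End.mul_apply, ih, hX, pow_succ, mul_assoc]

theorem inner_torusExp_prod {p : Fin n → ℤ} (X : Fin d → Module.End ℂ (SmoothFun n)) (c : Fin d → ℂ)
    (hX : ∀ j u, inner ℂ (torusExp p) (toL2 (X j u)) = c j * inner ℂ (torusExp p) (toL2 u))
    (u : SmoothFun n) :
    inner ℂ (torusExp p) (toL2 ((List.ofFn X).prod u)) =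
      (∏ j, c j) * inner ℂ (torusExp p) (toL2 u) := by
  induction d with
  | zero => simp
  | succ d ih =>
    rw [List.ofFn_succ, List.prod_cons, Module.End.mul_apply, hX, Fin.prod_univ_succ, mul_assoc]
    congr 1
    exact ih (fun j => X j.succ) (fun j => c j.succ) (fun j => hX j.succ)

/-- The value at the frequency `p` of the symbol of `h^{-|β|} 𝐁^β`. -/
def freqMonomial (v : Fin d → E n) (β : Fin d → ℕ) (p : Fin n → ℤ) : ℝ :=
  ∏ j, (2 * Real.pi * inner ℝ (v j) (intVec p)) ^ β j

theorem inner_torusExp_monomialB (v : Fin d → E n) (h : ℝ) (β : Fin d → ℕ) (p : Fin n → ℤ)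
    (u : SmoothFun n) :
    inner ℂ (torusExp p) (toL2 (monomialB v h β u)) =
      ((h ^ (∑ j, β j) * freqMonomial v β p : ℝ) : ℂ) * inner ℂ (torusExp p) (toL2 u) := by
  rw [monomialB, inner_torusExp_prod _ _
    fun j => inner_torusExp_pow (inner_torusExp_hD (v j) h p) (β j)]
  congr 1
  rw [freqMonomial, ← Finset.prod_pow_eq_pow_sum, ← Finset.prod_mul_distrib]
  push_cast
  refine Finset.prod_congr rfl fun j _ => ?_
  rw [← mul_pow]
  congr 1
  ring

theorem exists_freqMonomial_bound (v : Fin d → E n) (β : Fin d → ℕ) :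
    ∃ C : ℝ, 0 ≤ C ∧ ∀ p, |freqMonomial v β p| ≤ C * weight p ^ (∑ j, β j) := by
  have hpi := Real.pi_pos
  refine ⟨∏ j, (2 * Real.pi * (‖v j‖ * n)) ^ β j, Finset.prod_nonneg fun j _ => by positivity,
    fun p => ?_⟩
  rw [freqMonomial, ← Finset.prod_pow_eq_pow_sum, ← Finset.prod_mul_distrib, Finset.abs_prod]
  refine Finset.prod_le_prod (fun j _ => abs_nonneg _) fun j _ => ?_
  rw [abs_pow, ← mul_pow]
  refine pow_le_pow_left₀ (abs_nonneg _) ?_ _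
  rw [abs_mul, abs_of_pos (by positivity), mul_assoc (2 * Real.pi)]
  refine mul_le_mul_of_nonneg_left ?_ (by positivity)
  refine (abs_real_inner_le_norm _ _).trans ?_
  rw [mul_assoc]
  refine mul_le_mul_of_nonneg_left ((norm_intVec_le p).trans ?_) (norm_nonneg _)
  unfold weight
  gcongr
  linarith

theorem weight_neg (p : Fin n → ℤ) : weight (-p) = weight p := by
  unfold weight
  rw [norm_neg]

theorem weight_add_le (p q : Fin n → ℤ) : weight (p + q) ≤ weight p * weight q := by
  unfold weight
  have := mul_nonneg (norm_nonneg p) (norm_nonneg q)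
  linarith [norm_add_le p q]

theorem weight_comp_le {ι κ : Type} [Fintype ι] [Fintype κ] (k : κ → ℤ) (f : ι → κ) :
    weight (fun i => k (f i)) ≤ weight k := by
  unfold weight
  gcongr
  exact (pi_norm_le_iff_of_nonneg (norm_nonneg _)).2 fun i => norm_le_pi_norm k (f i)

theorem weight_freqX_le (j : KernelFreq n) :
    weight (freqX j) ≤ weight j.1.1 * weight j.1.2 * weight j.2 := by
  have h0 := (weight_pos j.2).le
  have h1 := (weight_pos j.1.1).le
  have h2 := (weight_pos (fun i => j.1.2 (Sum.inl i))).le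
  refine (weight_add_le _ _).trans (mul_le_mul_of_nonneg_right ?_ h0)
  exact (weight_add_le _ _).trans (mul_le_mul (weight_comp_le _ _) (weight_comp_le _ _) h2 h1)

theorem weight_freqY_le (j : KernelFreq n) :
    weight (freqY j) ≤ weight j.1.1 * weight j.1.2 * weight j.2 := by
  have h0 := (weight_pos j.2).le
  have h1 := (weight_pos j.1.1).le
  have h2 := (weight_pos (fun i => j.1.2 (Sum.inr i))).le
  refine (weight_add_le _ _).trans ?_
  rw [weight_neg]
  refine mul_le_mul_of_nonneg_right ?_ h0
  exact (weight_add_le _ _).trans (mul_le_mul (weight_comp_le _ _) (weight_comp_le _ _) h2 h1)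

/-- An operator is residual if the Fourier coefficients of its kernel are rapidly decreasing,
uniformly in `h`. The eigenvalues of `B_j` on the exponentials have a factor `h`, which cancels the
negative power of `h` in the definition of residual operators. -/
theorem isResidual_seriesOp (v : Fin d → E n) {J : Type} (a b : J → Fin n → ℤ) (c : Param → J → ℂ)
    (hc : ∀ N : ℕ, ∃ g : J → ℝ, Summable g ∧
      ∀ h j, ‖c h j‖ * (weight (a j) ^ N * weight (b j) ^ N) ≤ g j) :
    IsResidual v 0 fun h => seriesOp (c h) a b := by
  intro β γ
  obtain ⟨Cβ, hCβ0, hCβ⟩ := exists_freqMonomial_bound v β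
  obtain ⟨Cγ, hCγ0, hCγ⟩ := exists_freqMonomial_bound v γ
  obtain ⟨g, hg, hcg⟩ := hc (∑ j, β j + ∑ j, γ j)
  obtain ⟨g₀, hg₀, hcg₀⟩ := hc 0
  have hsum₀ : ∀ h, Summable fun j => ‖c h j‖ := fun h => by
    refine Summable.of_nonneg_of_le (fun j => norm_nonneg _) (fun j => ?_) hg₀
    simpa using hcg₀ h j
  -- the coefficients of the kernel of `h^{-|β + γ|} 𝐁^β R 𝐁^γ`
  set c' : Param → J → ℂ := fun h j =>
    c h j * ((freqMonomial v β (a j) * freqMonomial v γ (-b j) : ℝ) : ℂ) with hc'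
  have hbound : ∀ h j, ‖c' h j‖ ≤ Cβ * Cγ * g j := by
    intro h j
    have h1 := hCβ (a j)
    have h2 := hCγ (-b j)
    rw [weight_neg] at h2
    have hwa := one_le_weight (a j)
    have hwb := one_le_weight (b j)
    have h3 : weight (a j) ^ (∑ j, β j) ≤ weight (a j) ^ (∑ j, β j + ∑ j, γ j) :=
      pow_le_pow_right₀ hwa (Nat.le_add_right _ _)
    have h4 : weight (b j) ^ (∑ j, γ j) ≤ weight (b j) ^ (∑ j, β j + ∑ j, γ j) :=
      pow_le_pow_right₀ hwb (Nat.le_add_left _ _)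
    have h5 : 0 ≤ weight (b j) ^ (∑ j, γ j) := pow_nonneg (zero_le_one.trans hwb) _
    have h6 : 0 ≤ weight (a j) ^ (∑ j, β j + ∑ j, γ j) := pow_nonneg (zero_le_one.trans hwa) _
    rw [hc']
    simp only
    rw [norm_mul, Complex.norm_real, Real.norm_eq_abs, abs_mul]
    calc ‖c h j‖ * (|freqMonomial v β (a j)| * |freqMonomial v γ (-b j)|)
        ≤ ‖c h j‖ * ((Cβ * weight (a j) ^ (∑ j, β j + ∑ j, γ j)) *
          (Cγ * weight (b j) ^ (∑ j, β j + ∑ j, γ j))) := by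
          gcongr
          · exact h1.trans (mul_le_mul_of_nonneg_left h3 hCβ0)
          · exact h2.trans (mul_le_mul_of_nonneg_left h4 hCγ0)
      _ = Cβ * Cγ * (‖c h j‖ * (weight (a j) ^ (∑ j, β j + ∑ j, γ j) *
          weight (b j) ^ (∑ j, β j + ∑ j, γ j))) := by ring
      _ ≤ Cβ * Cγ * g j := by
          gcongr
          exact hcg h j
  have hsum : ∀ h, Summable fun j => ‖c' h j‖ := fun h =>
    Summable.of_nonneg_of_le (fun j => norm_nonneg _) (hbound h) (hg.mul_left _)
  refine ⟨∑' j, Cβ * Cγ * g j, fun h => seriesOp (c' h) a b, fun h => ⟨?_, fun u w => ?_⟩⟩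
  · exact (norm_seriesOp_le_tsum a b (hsum h)).trans
      ((hsum h).tsum_le_tsum (hbound h) (hg.mul_left _))
  · have hh := h.2.1
    have h1 := hasSum_inner_seriesOp a b (hsum h) (toL2 w) (toL2 u)
    have h2 := (hasSum_inner_seriesOp a b (hsum₀ h) (toL2 (monomialB v h β w))
      (toL2 (monomialB v h γ u))).mul_left
        (((h : ℝ) ^ (0 - ((∑ j, β j + ∑ j, γ j : ℕ) : ℝ)) : ℝ) : ℂ)
    refine h1.unique (h2.congr_fun fun j => ?_)
    have hconj : inner ℂ (toL2 (monomialB v h β w)) (torusExp (a j)) =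
        (((h : ℝ) ^ (∑ j, β j) * freqMonomial v β (a j) : ℝ) : ℂ) *
          inner ℂ (toL2 w) (torusExp (a j)) := by
      rw [← inner_conj_symm, inner_torusExp_monomialB, map_mul, inner_conj_symm,
        Complex.conj_ofReal]
    have hpow : (((h : ℝ) ^ (0 - ((∑ j, β j + ∑ j, γ j : ℕ) : ℝ)) : ℝ) : ℂ) *
        ((h : ℝ) : ℂ) ^ (∑ j, β j) * ((h : ℝ) : ℂ) ^ (∑ j, γ j) = 1 := by
      rw [zero_sub, Real.rpow_neg hh.le, Real.rpow_natCast, mul_assoc, ← pow_add]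
      push_cast
      exact inv_mul_cancel₀ (pow_ne_zero _ (by exact_mod_cast hh.ne'))
    rw [hconj, inner_torusExp_monomialB, hc']
    push_cast at hpow ⊢
    linear_combination (-(c h j * freqMonomial v β (a j) * freqMonomial v γ (-b j) *
      inner ℂ (torusExp (-b j)) (toL2 u) * inner ℂ (toL2 w) (torusExp (a j)))) * hpow

/-- If the amplitudes `A h κ` are rapidly decreasing in `κ` and vanish unless `κ` is at least of
size `h⁻¹`, then the quantization is residual. -/
theorem IsDiagonalCutoff.isResidual_quantOp (v : Fin d → E n) {χ : T n × T n → ℝ}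
    (hχ : IsDiagonalCutoff χ) (f : SchwartzMap (E n) ℂ) {A : Param → PairFreq n → E n → ℂ}
    {ρ : ℝ} (hρ : 0 ≤ ρ)
    (hA : ∀ N : ℕ, ∃ C : ℝ, ∀ h κ, IsBoundedSymbol (A h κ) (C * (weight κ ^ N)⁻¹) ρ) {B : ℝ}
    (hB : ∀ (h : Param) κ, A h κ = 0 ∨ (h : ℝ)⁻¹ ≤ B * weight κ) :
    IsResidual v 0 fun h => quantOp χ f h (A h) := by
  refine isResidual_seriesOp v freqX freqY (fun h => quantCoef χ f h (A h)) fun N => ?_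
  -- `L` is the order of summability, and `N` derivatives fall on each side
  set L : ℕ := 2 * Fintype.card (Fin n ⊕ Fin n)
  have hLn : 2 * Fintype.card (Fin n) ≤ L := by
    simp only [L, Fintype.card_sum]
    omega
  obtain ⟨Cχ, hCχ⟩ := hχ.exists_cutoffCoef_bound (N + N + L)
  obtain ⟨C₁, hC₁0, hC₁⟩ := exists_cellCoef_bound f hρ (N + N + L)
  obtain ⟨C₂, hC₂⟩ := hA (N + N + L + n + (N + N + L))
  have hCχ0 : 0 ≤ Cχ := le_trans
    (mul_nonneg (pow_nonneg (weight_pos 0).le _) (norm_nonneg _)) (hCχ 0)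
  have hC₂0 : 0 ≤ C₂ := by
    have h0 : (0 : ℝ) < ((1 : ℝ) / 2) := by norm_num
    have h1 := (hC₂ ⟨1 / 2, h0, by norm_num⟩ 0).nonneg
    exact nonneg_of_mul_nonneg_left h1 (inv_pos.2 (pow_pos (weight_pos _) _))
  set C := Cχ * (C₁ * C₂ * |B| ^ (N + N + L + n)) with hCdef
  have hg : Summable fun j : KernelFreq n =>
      C * ((weight j.1.1 ^ L)⁻¹ * (weight j.1.2 ^ L)⁻¹ * (weight j.2 ^ L)⁻¹) := by
    have hw0 : ∀ {ι : Type} [Fintype ι] (κ : ι → ℤ), 0 ≤ (weight κ ^ L)⁻¹ := fun κ =>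
      inv_nonneg.2 (pow_nonneg (weight_pos κ).le _)
    have h1 : Summable fun κ : PairFreq n => (weight κ ^ L)⁻¹ := summable_weight le_rfl
    exact ((h1.mul_of_nonneg h1 hw0 hw0).mul_of_nonneg (summable_weight (ι := Fin n) hLn)
      (fun i => mul_nonneg (hw0 _) (hw0 _)) hw0).mul_left C
  refine ⟨_, hg, fun h j => ?_⟩
  have hh := h.2.1
  have hw₁ := weight_pos j.1.1
  have hw₂ := weight_pos j.1.2
  have hw₃ := weight_pos j.2
  have h1 : ‖cutoffCoef χ j.1.1‖ ≤ Cχ * (weight j.1.1 ^ (N + N + L))⁻¹ := by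
    rw [← div_eq_mul_inv, le_div_iff₀ (by positivity), mul_comm]
    exact hCχ _
  have h2 : ‖cellCoef f h (A h j.1.2) j.2‖ ≤ C₁ * C₂ * |B| ^ (N + N + L + n) *
      (weight j.1.2 ^ (N + N + L))⁻¹ * (weight j.2 ^ (N + N + L))⁻¹ := by
    rcases hB h j.1.2 with h3 | h3
    · have h4 : cellCoef f h (A h j.1.2) j.2 = 0 := by
        rw [h3, cellCoef]
        simp
      rw [h4, norm_zero]
      positivity
    · refine ((norm_cellCoef_le_integral f hh _ _).trans (hC₁ h _ _ (hC₂ h j.1.2) j.2)).trans ?_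
      have h4 : ((h : ℝ)⁻¹) ^ (N + N + L + n) ≤ (|B| * weight j.1.2) ^ (N + N + L + n) := by
        gcongr
        exact h3.trans (mul_le_mul_of_nonneg_right (le_abs_self B) hw₂.le)
      calc C₁ * (C₂ * (weight j.1.2 ^ (N + N + L + n + (N + N + L)))⁻¹) *
            ((h : ℝ)⁻¹) ^ (N + N + L + n) * (weight j.2 ^ (N + N + L))⁻¹
          ≤ C₁ * (C₂ * (weight j.1.2 ^ (N + N + L + n + (N + N + L)))⁻¹) *
            (|B| * weight j.1.2) ^ (N + N + L + n) * (weight j.2 ^ (N + N + L))⁻¹ := by gcongr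
        _ = _ := by
            rw [pow_add (weight j.1.2) (N + N + L + n), mul_pow]
            field_simp
  have hx := (weight_pos (freqX j)).le
  have hy := (weight_pos (freqY j)).le
  have h3 : weight (freqX j) ^ N * weight (freqY j) ^ N ≤
      (weight j.1.1 * weight j.1.2 * weight j.2) ^ (N + N) := by
    rw [pow_add]
    have h4 := weight_freqX_le j
    have h5 := weight_freqY_le j
    gcongr
  calc ‖quantCoef χ f h (A h) j‖ * (weight (freqX j) ^ N * weight (freqY j) ^ N)
      ≤ (Cχ * (weight j.1.1 ^ (N + N + L))⁻¹ * (C₁ * C₂ * |B| ^ (N + N + L + n) *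
        (weight j.1.2 ^ (N + N + L))⁻¹ * (weight j.2 ^ (N + N + L))⁻¹)) *
          (weight j.1.1 * weight j.1.2 * weight j.2) ^ (N + N) := by
        rw [quantCoef, norm_mul]
        gcongr
    _ = C * ((weight j.1.1 ^ L)⁻¹ * (weight j.1.2 ^ L)⁻¹ * (weight j.2 ^ L)⁻¹) := by
        rw [hCdef, pow_add _ (N + N) L, pow_add _ (N + N) L, pow_add _ (N + N) L, mul_pow, mul_pow]
        field_simp

end Residual

/-! ### Reduction to left quantization -/

section Reduction

open UnitAddTorus

variable {n d : ℕ} {v : Fin d → E n} {s : T n × Stot v → ℂ}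

theorem exists_isBoundedSymbol_symbolCoef (hs : IsCcSmoothAmplitude s) {R δ : ℝ}
    (hb : SupportBound s R δ) (N : ℕ) :
    ∃ C : ℝ, ∀ (h : Param) κ,
      IsBoundedSymbol (fun ξ => symbolCoef s κ ξ h) (C * (weight κ ^ N)⁻¹) (2 * R) := by
  obtain ⟨C, hC⟩ := exists_symbolCoef_bound hs N
  refine ⟨C, fun h κ => ⟨continuous_symbolCoef hs κ h, fun ξ => ?_,
    fun ξ hξ => hb.symbolCoef_eq_zero κ h hξ⟩⟩
  rw [← div_eq_mul_inv, le_div_iff₀ (pow_pos (weight_pos κ) _), mul_comm]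
  exact hC κ ξ h

theorem IsBoundedSymbol.const_mul_of_norm_le_one {A : E n → ℂ} {M ρ : ℝ}
    (hA : IsBoundedSymbol A M ρ) {g : E n → ℂ} (hg : Continuous g) (hg1 : ∀ ξ, ‖g ξ‖ ≤ 1) :
    IsBoundedSymbol (fun ξ => g ξ * A ξ) M ρ where
  continuous := hg.mul hA.continuous
  norm_le ξ := by
    rw [norm_mul]
    exact (mul_le_of_le_one_left (norm_nonneg _) (hg1 ξ)).trans (hA.norm_le ξ)
  eq_zero ξ hξ := by rw [hA.eq_zero ξ hξ, mul_zero]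

/-- The operator with the coefficients of `s` is the quantization of `s`. -/
theorem IsDiagonalCutoff.isQuantization_quantOp {χ : T n × T n → ℝ} (hχ : IsDiagonalCutoff χ)
    {ρ₀ : ℝ} {ψ : E n → ℝ} (hψ : CellBump ρ₀ ψ)
    (hχρ : ∀ x y, χ (x, y) ≠ 0 → ∀ i, ‖x i - y i‖ ≤ ρ₀) (hs : IsCcSmoothAmplitude s)
    {M : PairFreq n → ℝ} {ρ : ℝ} (hρ : 0 ≤ ρ)
    (hA : ∀ (h : Param) κ, IsBoundedSymbol (fun ξ => symbolCoef s κ ξ h) (M κ) ρ)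
    (hM : Summable M) :
    IsQuantization χ (amplitude s) fun h =>
      quantOp χ hψ.transform h fun κ ξ => symbolCoef s κ ξ h := by
  intro h
  have he : ∀ (x y : T n) (κ : PairFreq n),
      ‖mFourier (fun i => κ (Sum.inl i)) x * mFourier (fun i => κ (Sum.inr i)) y‖ = 1 :=
    fun x y κ => by rw [norm_mul, norm_mFourier_apply, norm_mFourier_apply, one_mul]
  have ha : ∀ x y ξ, HasSum (fun κ : PairFreq n =>
      mFourier (fun i => κ (Sum.inl i)) x * mFourier (fun i => κ (Sum.inr i)) y *
        symbolCoef s κ ξ h) (amplitude s x y ξ h) := fun x y ξ =>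
    (hasSum_symbolCoef hs x y ξ h).congr_fun fun κ => mul_comm _ _
  exact ⟨fun x y => (isBoundedSymbol_of_hasSum (hA h) hM (he x y) (ha x y)).integrable,
    hχ.quantOp_apply hψ hχρ h hρ (hA h) hM fun x y =>
      hasSum_cellIntegral ψ (hA h) hM (he x y) (ha x y) _⟩

/-- The coefficients of the quantization of the left symbol. In the sum that defines the left symbol
the exponential `e^{2πi m⬝y}` of `s` has been replaced by `e^{2πi m⬝x}`, and the argument `ξ` of its
coefficient by `ξ + 2πhm`; the quotient of the two exponentials is undone by a translation of the
variable of integration, so that only the cutoff `η` is left with a translated argument. -/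
theorem IsDiagonalCutoff.isLeftQuantization_quantOp {χ : T n × T n → ℝ} (hχ : IsDiagonalCutoff χ)
    {ρ₀ : ℝ} {ψ : E n → ℝ} (hψ : CellBump ρ₀ ψ)
    (hχρ : ∀ x y, χ (x, y) ≠ 0 → ∀ i, ‖x i - y i‖ ≤ ρ₀)
    {M : PairFreq n → ℝ} {ρ ρ' : ℝ} (hρ : 0 ≤ ρ)
    (hA : ∀ (h : Param) κ, IsBoundedSymbol (fun ξ => symbolCoef s κ ξ h) (M κ) ρ)
    (hM : Summable M) {η : E n → ℝ} (hηc : Continuous fun ξ => (η ξ : ℂ))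
    (hη1 : ∀ ξ, ‖(η ξ : ℂ)‖ ≤ 1) (hη0 : ∀ ξ, ρ' < ‖ξ‖ → η ξ = 0) :
    IsLeftQuantization χ
      (fun x ξ h => leftSymbol η s (x, blowupLift (coisotropicFibre v) ξ h)) fun h =>
        quantOp χ hψ.transform h fun κ ξ =>
          η (ξ - (h : ℝ) • shiftVec κ) * symbolCoef s κ ξ h := by
  intro h
  have hlB : ∀ κ, IsBoundedSymbol
      (fun ξ => (η ξ : ℂ) * symbolCoef s κ (ξ + (h : ℝ) • shiftVec κ) h) (M κ) ρ' := fun κ =>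
    { continuous := hηc.mul ((hA h κ).continuous.comp (continuous_id.add continuous_const))
      norm_le := fun ξ => by
        rw [norm_mul]
        exact (mul_le_of_le_one_left (norm_nonneg _) (hη1 ξ)).trans ((hA h κ).norm_le _)
      eq_zero := fun ξ hξ => by rw [hη0 ξ hξ, Complex.ofReal_zero, zero_mul] }
  have he : ∀ (x : T n) (κ : PairFreq n),
      ‖mFourier (fun i => κ (Sum.inl i)) x * mFourier (fun i => κ (Sum.inr i)) x‖ = 1 :=
    fun x κ => by rw [norm_mul, norm_mFourier_apply, norm_mFourier_apply, one_mul]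
  have hl : ∀ x ξ, HasSum (fun κ : PairFreq n =>
      mFourier (fun i => κ (Sum.inl i)) x * mFourier (fun i => κ (Sum.inr i)) x *
        ((η ξ : ℂ) * symbolCoef s κ (ξ + (h : ℝ) • shiftVec κ) h))
      (leftSymbol η s (x, blowupLift (coisotropicFibre v) ξ h)) := fun x ξ => by
    have h1 : Summable fun κ : PairFreq n =>
        mFourier (fun i => κ (Sum.inl i)) x * mFourier (fun i => κ (Sum.inr i)) x *
          symbolCoef s κ (ξ + (h : ℝ) • shiftVec κ) h :=
      Summable.of_norm_bounded hM fun κ => by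
        rw [norm_mul, he, one_mul]
        exact (hA h κ).norm_le _
    rw [leftSymbol_lift]
    exact (h1.hasSum.mul_left (η ξ : ℂ)).congr_fun fun κ => mul_left_comm _ _ _
  refine ⟨fun x y => (isBoundedSymbol_of_hasSum hlB hM (he x) (hl x)).integrable, ?_⟩
  have hrB : ∀ κ, IsBoundedSymbol
      (fun ξ => (η (ξ - (h : ℝ) • shiftVec κ) : ℂ) * symbolCoef s κ ξ h) (M κ) ρ := fun κ =>
    (hA h κ).const_mul_of_norm_le_one (hηc.comp (continuous_id.sub continuous_const)) fun ξ => hη1 _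
  refine hχ.quantOp_apply hψ hχρ h hρ hrB hM fun x y => ?_
  refine (hasSum_cellIntegral ψ hlB hM (he x) (hl x) (x - y)).congr_fun fun κ => ?_
  have h2 := mFourier_mul_cellIntegral ψ h.2.1 (fun i => κ (Sum.inr i))
    (fun ξ => (η ξ : ℂ) * symbolCoef s κ (ξ + (h : ℝ) • shiftVec κ) h) (x - y)
  have h3 : mFourier (fun i => κ (Sum.inr i)) x =
      mFourier (fun i => κ (Sum.inr i)) (x - y) * mFourier (fun i => κ (Sum.inr i)) y := by
    rw [← mFourier_add_apply, sub_add_cancel]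
  simp only [shiftVec, sub_add_cancel] at h2
  rw [h3, mul_right_comm, mul_assoc, mul_assoc]
  simp only [shiftVec]
  rw [← h2]
  ring

/-- The part of the operator that is lost by cutting off the left symbol is residual: where `η ≠ 1`
the translation `2πhm` is bounded below, so that the frequency `m` has at least the size `h⁻¹`. -/
theorem IsDiagonalCutoff.isResidual_quantOp_one_sub {χ : T n × T n → ℝ} (hχ : IsDiagonalCutoff χ)
    (f : SchwartzMap (E n) ℂ) {ρ : ℝ} (hρ : 0 ≤ ρ)
    (hA : ∀ N : ℕ, ∃ C : ℝ, ∀ (h : Param) κ,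
      IsBoundedSymbol (fun ξ => symbolCoef s κ ξ h) (C * (weight κ ^ N)⁻¹) ρ)
    {η : E n → ℝ} (hηc : Continuous fun ξ => (η ξ : ℂ)) (hη1 : ∀ ξ, ‖(1 - η ξ : ℂ)‖ ≤ 1)
    (hη : ∀ ξ, ‖ξ‖ ≤ ρ + 1 → η ξ = 1) :
    IsResidual v 0 fun h => quantOp χ f h fun κ ξ =>
      (1 - η (ξ - (h : ℝ) • shiftVec κ)) * symbolCoef s κ ξ h := by
  obtain ⟨B, -, hB⟩ := exists_shiftVec_bound n
  refine hχ.isResidual_quantOp v f hρ (fun N => ?_) (B := B) fun h κ => ?_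
  · obtain ⟨C, hC⟩ := hA N
    exact ⟨C, fun h κ => (hC h κ).const_mul_of_norm_le_one (continuous_const.sub
      (hηc.comp (continuous_id.sub continuous_const))) fun ξ => hη1 _⟩
  · by_cases h1 : (h : ℝ)⁻¹ ≤ B * weight κ
    · exact Or.inr h1
    · refine Or.inl (funext fun ξ => ?_)
      by_cases hξ : ρ < ‖ξ‖
      · obtain ⟨C, hC⟩ := hA 0
        simp only [(hC h κ).eq_zero ξ hξ, mul_zero, Pi.zero_apply]
      · push Not at h1 hξ
        have h2 : ‖(h : ℝ) • shiftVec κ‖ ≤ 1 := by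
          rw [norm_smul, Real.norm_eq_abs, abs_of_pos h.2.1]
          have h3 : ‖shiftVec κ‖ ≤ (h : ℝ)⁻¹ := by linarith [hB κ]
          calc (h : ℝ) * ‖shiftVec κ‖ ≤ h * (h : ℝ)⁻¹ :=
                mul_le_mul_of_nonneg_left h3 h.2.1.le
            _ = 1 := mul_inv_cancel₀ h.2.1.ne'
        have h4 : η (ξ - (h : ℝ) • shiftVec κ) = 1 :=
          hη _ ((norm_sub_le _ _).trans (add_le_add hξ h2))
        simp only [h4, Complex.ofReal_one, sub_self, zero_mul, Pi.zero_apply]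

end Reduction

end SecondMicro

end

open SecondMicro in
theorem mainTheorem7 {n d : ℕ} (v : Fin d → SecondMicro.E n) (hv : LinearIndependent ℝ v)
    (χ : SecondMicro.T n × SecondMicro.T n → ℝ) (hχ : SecondMicro.IsDiagonalCutoff χ)
    (s : SecondMicro.T n × SecondMicro.Stot v → ℂ) (hs : SecondMicro.IsCcSmoothAmplitude s) :
    ∃ A : SecondMicro.Param → SecondMicro.L2 n →L[ℂ] SecondMicro.L2 n,
      SecondMicro.IsQuantization χ (SecondMicro.amplitude s) A ∧
      SecondMicro.IsSecondMicrolocal v χ 0 0 A ∧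
      ∃ C : ℝ, ∀ h, ‖A h‖ ≤ C := by
  obtain ⟨R, δ, hb⟩ := exists_supportBound hs
  have hR := hb.pos
  have h2R : 0 ≤ 2 * R := by linarith
  obtain ⟨ρ₀, hρ₀, hρ₀', hχρ⟩ := hχ.exists_norm_le
  obtain ⟨ψ, hψ⟩ := exists_cellBump (n := n) hρ₀ hρ₀'
  obtain ⟨C, hC⟩ := exists_isBoundedSymbol_symbolCoef hs hb (2 * Fintype.card (Fin n ⊕ Fin n))
  have hM : Summable fun κ : PairFreq n =>
      C * (weight κ ^ (2 * Fintype.card (Fin n ⊕ Fin n)))⁻¹ := (summable_weight le_rfl).mul_left C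
  -- the coefficients of `s` vanish outside the ball of radius `2 * R`
  let η : ContDiffBump (0 : SecondMicro.E n) := ⟨2 * R + 1, 2 * R + 2, by linarith, by linarith⟩
  have hη0 : ∀ ξ, 2 * R + 2 < ‖ξ‖ → η ξ = 0 := fun ξ hξ =>
    η.zero_of_le_dist (by rw [dist_zero_right]; exact hξ.le)
  have hη : ∀ ξ, ‖ξ‖ ≤ 2 * R + 1 → η ξ = 1 := fun ξ hξ =>
    η.one_of_mem_closedBall (mem_closedBall_zero_iff.2 hξ)
  have hη1 : ∀ ξ, ‖(η ξ : ℂ)‖ ≤ 1 := fun ξ => by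
    rw [Complex.norm_real, Real.norm_eq_abs, abs_of_nonneg η.nonneg]
    exact η.le_one
  have hη1' : ∀ ξ, ‖(1 - η ξ : ℂ)‖ ≤ 1 := fun ξ => by
    rw [← Complex.ofReal_one, ← Complex.ofReal_sub, Complex.norm_real, Real.norm_eq_abs,
      abs_of_nonneg (sub_nonneg.2 η.le_one)]
    linarith [η.nonneg (x := ξ)]
  have hηc : Continuous fun ξ => (η ξ : ℂ) := Complex.continuous_ofReal.comp η.continuous
  refine ⟨_, hχ.isQuantization_quantOp hψ hχρ hs h2R hC hM, ⟨_,
    ⟨leftSymbol η s, isCcSmooth_leftSymbol hs η.contDiff hη0, fun x ξ h => ?_⟩, _, _,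
    hχ.isLeftQuantization_quantOp hψ hχρ h2R hC hM hηc hη1 hη0,
    hχ.isResidual_quantOp_one_sub hψ.transform h2R (exists_isBoundedSymbol_symbolCoef hs hb)
      hηc hη1' hη, fun h => ?_⟩, _, fun h => hχ.norm_quantOp_le _ h h2R (hC h) hM⟩
  -- both exponents are zero
  · simp only [neg_zero, Real.rpow_zero, mul_one, Complex.ofReal_one, one_mul]
  · have hηs : ∀ κ : PairFreq n, Continuous fun ξ => (η (ξ - (h : ℝ) • shiftVec κ) : ℂ) := fun κ =>
      hηc.comp (continuous_id.sub continuous_const)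
    have hηs' : ∀ κ : PairFreq n, Continuous fun ξ => (1 - η (ξ - (h : ℝ) • shiftVec κ) : ℂ) :=
      fun κ => continuous_const.sub (hηs κ)
    rw [← hχ.quantOp_add hψ.transform h h2R
      (fun κ => (hC h κ).const_mul_of_norm_le_one (hηs κ) fun ξ => hη1 _)
      (fun κ => (hC h κ).const_mul_of_norm_le_one (hηs' κ) fun ξ => hη1' _) hM]
    simp only [← add_mul, add_sub_cancel, one_mul]
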